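/- Theorem 3.6. Everything is smooth and real. Let $M$ be a (Hausdorff) manifold and let $E\to M$ be a real vector bundle of finite rank with a quaternionic structure, that is, a rank three subbundle $Q\subseteq\mathrm{End}(E)$ which is locally spanned by sections $I,J,K$ with $I^2=J^2=-1$, $IJ=K=-JI$. Let $V,TM\subseteq E$ be vector subbundles such that $E=V\oplus TM$ and $JV\subseteq TM$ for every $x\in M$ and every $J\in Q_x$ with $J^2=-1$ (that is, $(E,V)$ is an almost $f$-quaternionic structure on $M$). Let $\nabla$ be a connection on $E$ which preserves the subbundles $V$ and $TM$ of $E$ and $Q$ of $\mathrm{End}(E)$, and suppose that the connection $D$ which it induces on $M$ is torsion free. Put $l=\mathrm{rank}\,V$. If $\mathrm{rank}\,E>4l\geq 8$ then, locally, $(M,E,V,\nabla)$ is the product of $(\mathrm{Im}\,\mathbb{H})^{l}$ with a hypercomplex manifold. Explicitly, for every $x_0\in M$ there are - a manifold $N$, $\dim N=4m$, with a hypercomplex structure $(J_1,J_2,J_3)$ (almost complex structures with vanishing Nijenhuis tensors and $J_1J_2=J_3=-J_2J_1$), and a torsion free connection $D^N$ on $N$ for which $J_1,J_2,J_3$ are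 covariantly constant (its Obata connection); - a diffeomorphism $\varphi$ from an open neighbourhood $U$ of $x_0$ onto an open subset of $(\mathrm{Im}\,\mathbb{H})^{l}\times N$; - a vector bundle isomorphism $\Phi$, covering $\varphi$, from $E|_U$ to (the restriction of) $\mathbb{H}^{l}\times TN$, regarded as a vector bundle over $(\mathrm{Im}\,\mathbb{H})^{l}\times N$; such that $\Phi$ restricts to the differential of $\varphi$ from $TM|_U$ to $T\bigl((\mathrm{Im}\,\mathbb{H})^{l}\times N\bigr)=(\mathrm{Im}\,\mathbb{H})^{l}\times TN$, maps $V|_U$ onto $\mathbb{R}^{l}\times 0$, maps $Q|_U$ onto the bundle of endomorphisms $(q,X)\mapsto(uq,\;u_1J_1X+u_2J_2X+u_3J_3X)$ with $u=u_1i+u_2j+u_3k\in\mathrm{Im}\,\mathbb{H}$, and maps $\nabla$ to the direct sum of the trivial connection on $\mathbb{H}^{l}$ and the pullback of $D^N$. -/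

import Mathlib

open Bundle Set Module VectorField
open scoped Manifold ContDiff Topology Quaternion Bundle

noncomputable section

/-- The space `Im ℍ` of imaginary quaternions. -/
abbrev ImH : Submodule ℝ ℍ[ℝ] :=
  LinearMap.ker (QuaternionAlgebra.reₗ (-1 : ℝ) (0 : ℝ) (-1 : ℝ))

/-- Three endomorphisms `A 0, A 1, A 2` satisfying the relations of the imaginary units `i, j, k`. -/
structure IsQuaternionicTriple {X : Type*} [AddCommGroup X] [Module ℝ X] [TopologicalSpace X]
    [IsTopologicalAddGroup X] (A : Fin 3 → X →L[ℝ] X) : Prop where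
  sq_zero : A 0 ∘L A 0 = -ContinuousLinearMap.id ℝ X
  sq_one : A 1 ∘L A 1 = -ContinuousLinearMap.id ℝ X
  zero_one : A 0 ∘L A 1 = A 2
  one_zero : A 1 ∘L A 0 = -A 2

/-- The endomorphism `u₁ A₁ + u₂ A₂ + u₃ A₃` attached to `u = u₁ i + u₂ j + u₃ k`. -/
def quaternionicAction {X : Type*} [AddCommGroup X] [Module ℝ X] [TopologicalSpace X]
    [IsTopologicalAddGroup X] [ContinuousSMul ℝ X] (A : Fin 3 → X →L[ℝ] X) (u : ImH) :
    X →L[ℝ] X :=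
  (u : ℍ[ℝ]).imI • A 0 + (u : ℍ[ℝ]).imJ • A 1 + (u : ℍ[ℝ]).imK • A 2

section FQuaternionic

variable {n : ℕ} {M : Type*} [TopologicalSpace M] [ChartedSpace (EuclideanSpace ℝ (Fin n)) M]
  [IsManifold (𝓡 n) ∞ M]
  (F : Type*) [NormedAddCommGroup F] [NormedSpace ℝ F]
  (E : M → Type*) [TopologicalSpace (TotalSpace F E)]
  [∀ x, AddCommGroup (E x)] [∀ x, Module ℝ (E x)] [∀ x, TopologicalSpace (E x)]
  [∀ x, IsTopologicalAddGroup (E x)] [∀ x, ContinuousSMul ℝ (E x)]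
  [FiberBundle F E] [VectorBundle ℝ F E]

/-- A quaternionic structure on the real vector bundle `E`: a smooth rank three subbundle `Q` of
`End E` which is, locally, spanned by a smooth triple `I, J, K` satisfying the quaternionic
relations. Equivalently, a reduction of the structural group of `E` to `Sp(1)·GL(k,ℍ)`, which is
the stabilizer in `GL(4k,ℝ)` of the span of the three standard complex structures of `ℍᵏ`. -/
structure QuaternionicStructure where
  Q : ∀ x, Submodule ℝ (E x →L[ℝ] E x)
  exists_frame : ∀ x₀ : M, ∃ u : Set M, IsOpen u ∧ x₀ ∈ u ∧
    ∃ A : Fin 3 → ∀ x, E x →L[ℝ] E x,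
      (∀ i, ContMDiffOn (𝓡 n) ((𝓡 n).prod 𝓘(ℝ, F →L[ℝ] F)) ∞
        (fun x ↦ TotalSpace.mk' (F →L[ℝ] F) (E := fun x ↦ E x →L[ℝ] E x) x (A i x)) u) ∧
      ∀ x ∈ u, IsQuaternionicTriple (fun i ↦ A i x) ∧
        Submodule.span ℝ (range fun i ↦ A i x) = Q x

/-- An almost `f`-quaternionic structure `(E, V)` on `M` with `rank V = l`: a quaternionic vector
bundle `E` together with (smooth) vector subbundles `V` and `TM` (the latter embedded by `incl`)
such that `E = V ⊕ TM` and `J V ⊆ TM` for every admissible linear complex structure `J`. -/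
structure AlmostFQuaternionicStructure (l : ℕ) extends QuaternionicStructure (n := n) F E where
  incl : ∀ x : M, TangentSpace (𝓡 n) x →L[ℝ] E x
  contMDiff_incl : ContMDiff (𝓡 n) ((𝓡 n).prod 𝓘(ℝ, EuclideanSpace ℝ (Fin n) →L[ℝ] F)) ∞
    (fun x ↦ TotalSpace.mk' (EuclideanSpace ℝ (Fin n) →L[ℝ] F)
      (E := fun x ↦ TangentSpace (𝓡 n) x →L[ℝ] E x) x (incl x))
  injective_incl : ∀ x, Function.Injective (incl x)
  V : ∀ x, Submodule ℝ (E x)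
  exists_frame_V : ∀ x₀ : M, ∃ u : Set M, IsOpen u ∧ x₀ ∈ u ∧
    ∃ s : Fin l → ∀ x, E x,
      (∀ i, ContMDiffOn (𝓡 n) ((𝓡 n).prod 𝓘(ℝ, F)) ∞
        (fun x ↦ TotalSpace.mk' F x (s i x)) u) ∧
      ∀ x ∈ u, LinearIndependent ℝ (fun i ↦ s i x) ∧
        Submodule.span ℝ (range fun i ↦ s i x) = V x
  isCompl : ∀ x, IsCompl (V x) (LinearMap.range (incl x).toLinearMap)
  map_V : ∀ x, ∀ J ∈ Q x, J ∘L J = -ContinuousLinearMap.id ℝ (E x) →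
    ∀ v ∈ V x, J v ∈ LinearMap.range (incl x).toLinearMap

variable {F E} {l : ℕ}

/-- A smooth connection `∇` on `E` is compatible with the structural group of an almost
`f`-quaternionic structure (the group of quaternionic linear isomorphisms preserving `V` and `TM`)
if `V`, `TM` and `Q ⊆ End E` are preserved by `∇`.
Note that `cov s x v` is `(∇_v s)(x)`. -/
structure AlmostFQuaternionicStructure.IsCompatible
    (S : AlmostFQuaternionicStructure (n := n) F E l) (cov : CovariantDerivative (𝓡 n) F E) :
    Prop where
  smooth : CovariantDerivative.ContMDiffCovariantDerivative cov ∞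
  preserves_V : ∀ (s : ∀ x, E x) (x : M),
    MDifferentiableAt (𝓡 n) ((𝓡 n).prod 𝓘(ℝ, F)) (fun y ↦ TotalSpace.mk' F y (s y)) x →
    (∀ y, s y ∈ S.V y) → ∀ v : TangentSpace (𝓡 n) x, cov s x v ∈ S.V x
  preserves_TM : ∀ (s : ∀ x, E x) (x : M),
    MDifferentiableAt (𝓡 n) ((𝓡 n).prod 𝓘(ℝ, F)) (fun y ↦ TotalSpace.mk' F y (s y)) x →
    (∀ y, s y ∈ LinearMap.range (S.incl y).toLinearMap) → ∀ v : TangentSpace (𝓡 n) x,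
      cov s x v ∈ LinearMap.range (S.incl x).toLinearMap
  /-- For a section `A` of `Q`, the endomorphism `∇_v A : s ↦ ∇_v (A s) - A (∇_v s)` is in `Q`. -/
  preserves_Q : ∀ (A : ∀ x, E x →L[ℝ] E x) (x : M),
    MDifferentiableAt (𝓡 n) ((𝓡 n).prod 𝓘(ℝ, F →L[ℝ] F))
      (fun y ↦ TotalSpace.mk' (F →L[ℝ] F) (E := fun y ↦ E y →L[ℝ] E y) y (A y)) x →
    (∀ y, A y ∈ S.Q y) → ∀ v : TangentSpace (𝓡 n) x, ∃ B ∈ S.Q x, ∀ s : ∀ x, E x,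
      MDifferentiableAt (𝓡 n) ((𝓡 n).prod 𝓘(ℝ, F)) (fun y ↦ TotalSpace.mk' F y (s y)) x →
      cov (fun y ↦ A y (s y)) x v - A x (cov s x v) = B (s x)

/-- The connection `∇` on `E` is induced by the connection `D` on `M`, compatible with `(E, V)`:
`∇` is compatible with the structure and restricts to `D` on `TM ⊆ E`
(so that `∇ = D^V ⊕ D`, where `D^V` is the connection induced on `V`). -/
structure AlmostFQuaternionicStructure.IsInducedBy
    (S : AlmostFQuaternionicStructure (n := n) F E l) (cov : CovariantDerivative (𝓡 n) F E)
    (D : CovariantDerivative (𝓡 n) (EuclideanSpace ℝ (Fin n)) (TangentSpace (𝓡 n) : M → Type _)) :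
    Prop where
  isCompatible : S.IsCompatible cov
  restrict : ∀ (X : ∀ x : M, TangentSpace (𝓡 n) x) (x : M),
    MDifferentiableAt (𝓡 n) ((𝓡 n).prod 𝓘(ℝ, EuclideanSpace ℝ (Fin n)))
      (fun y ↦ TotalSpace.mk' (EuclideanSpace ℝ (Fin n)) y (X y)) x →
    ∀ v : TangentSpace (𝓡 n) x, cov (fun y ↦ S.incl y (X y)) x v = S.incl x (D X x v)

end FQuaternionic

section Hypercomplex

variable (m : ℕ) (N : Type*) [TopologicalSpace N]
  [ChartedSpace (EuclideanSpace ℝ (Fin (4 * m))) N] [IsManifold (𝓡 (4 * m)) ∞ N]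

/-- A hypercomplex structure on the manifold `N` of dimension `4m`: a smooth triple of almost
complex structures satisfying the quaternionic relations, each of which is integrable, that is,
its Nijenhuis tensor vanishes (equivalently, its `(0,1)` distribution is involutive). -/
structure HypercomplexStructure where
  J : Fin 3 → ∀ y : N, TangentSpace (𝓡 (4 * m)) y →L[ℝ] TangentSpace (𝓡 (4 * m)) y
  contMDiff_J : ∀ i, ContMDiff (𝓡 (4 * m)) ((𝓡 (4 * m)).prod
      𝓘(ℝ, EuclideanSpace ℝ (Fin (4 * m)) →L[ℝ] EuclideanSpace ℝ (Fin (4 * m)))) ∞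
    (fun y ↦ TotalSpace.mk' (EuclideanSpace ℝ (Fin (4 * m)) →L[ℝ] EuclideanSpace ℝ (Fin (4 * m)))
      (E := fun y : N ↦ TangentSpace (𝓡 (4 * m)) y →L[ℝ] TangentSpace (𝓡 (4 * m)) y) y (J i y))
  isQuaternionicTriple : ∀ y, IsQuaternionicTriple (fun i ↦ J i y)
  integrable : ∀ (i : Fin 3) (X Y : ∀ y : N, TangentSpace (𝓡 (4 * m)) y) (y : N),
    ContMDiffAt (𝓡 (4 * m)) ((𝓡 (4 * m)).prod 𝓘(ℝ, EuclideanSpace ℝ (Fin (4 * m)))) ∞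
      (fun z ↦ TotalSpace.mk' (EuclideanSpace ℝ (Fin (4 * m))) z (X z)) y →
    ContMDiffAt (𝓡 (4 * m)) ((𝓡 (4 * m)).prod 𝓘(ℝ, EuclideanSpace ℝ (Fin (4 * m)))) ∞
      (fun z ↦ TotalSpace.mk' (EuclideanSpace ℝ (Fin (4 * m))) z (Y z)) y →
    mlieBracket (𝓡 (4 * m)) (fun z ↦ J i z (X z)) (fun z ↦ J i z (Y z)) y
      - J i y (mlieBracket (𝓡 (4 * m)) (fun z ↦ J i z (X z)) Y y)
      - J i y (mlieBracket (𝓡 (4 * m)) X (fun z ↦ J i z (Y z)) y)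
      - mlieBracket (𝓡 (4 * m)) X Y y = 0

variable {m N}

/-- `D` is the Obata connection of the hypercomplex manifold `N`: the (unique) torsion-free
connection on `N` for which the three complex structures are covariantly constant. -/
structure HypercomplexStructure.IsObata (h : HypercomplexStructure m N)
    (D : CovariantDerivative (𝓡 (4 * m)) (EuclideanSpace ℝ (Fin (4 * m)))
      (TangentSpace (𝓡 (4 * m)) : N → Type _)) : Prop where
  smooth : CovariantDerivative.ContMDiffCovariantDerivative D ∞
  torsion_eq_zero : D.torsion = 0
  parallel : ∀ (i : Fin 3) (X : ∀ y : N, TangentSpace (𝓡 (4 * m)) y) (y : N),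
    MDifferentiableAt (𝓡 (4 * m)) ((𝓡 (4 * m)).prod 𝓘(ℝ, EuclideanSpace ℝ (Fin (4 * m))))
      (fun z ↦ TotalSpace.mk' (EuclideanSpace ℝ (Fin (4 * m))) z (X z)) y →
    ∀ v : TangentSpace (𝓡 (4 * m)) y, D (fun z ↦ h.J i z (X z)) y v = h.J i y (D X y v)

end Hypercomplex

section Product

variable {n : ℕ} {M : Type*} [TopologicalSpace M] [ChartedSpace (EuclideanSpace ℝ (Fin n)) M]
  [IsManifold (𝓡 n) ∞ M]
  {F : Type*} [NormedAddCommGroup F] [NormedSpace ℝ F]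
  {E : M → Type*} [TopologicalSpace (TotalSpace F E)]
  [∀ x, AddCommGroup (E x)] [∀ x, Module ℝ (E x)] [∀ x, TopologicalSpace (E x)]
  [∀ x, IsTopologicalAddGroup (E x)] [∀ x, ContinuousSMul ℝ (E x)]
  [FiberBundle F E] [VectorBundle ℝ F E] {l m : ℕ}
  {N : Type*} [TopologicalSpace N] [ChartedSpace (EuclideanSpace ℝ (Fin (4 * m))) N]
  [IsManifold (𝓡 (4 * m)) ∞ N]

/-- The product of `(Im ℍ)ˡ` with a hypercomplex manifold `N` is `(Im ℍ)ˡ × N` with the bundle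
`ℍˡ × TN`, whose subbundles `V` and `T((Im ℍ)ˡ × N)` are `ℝˡ × 0` and `(Im ℍ)ˡ × TN`, on which
`u ∈ Im ℍ` acts through left multiplication on `ℍˡ` and `u₁ I + u₂ J + u₃ K` on `TN`, and whose
connection is the direct sum of the trivial connection on `ℍˡ` and the (pullback of) the Obata
connection `D` of `N`.

The following says that the diffeomorphism `φ`, from an open subset of `M` onto an open subset of
`(Im ℍ)ˡ × N`, and the vector bundle isomorphism `(α, β)` from `E` to `ℍˡ × TN` covering it,
identify `(M, E, V, ∇)`, over the source of `φ`, with this product. -/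
structure AlmostFQuaternionicStructure.IsProductVia
    (S : AlmostFQuaternionicStructure (n := n) F E l) (cov : CovariantDerivative (𝓡 n) F E)
    (h : HypercomplexStructure m N)
    (D : CovariantDerivative (𝓡 (4 * m)) (EuclideanSpace ℝ (Fin (4 * m)))
      (TangentSpace (𝓡 (4 * m)) : N → Type _))
    (φ : PartialDiffeomorph (𝓡 n) (𝓘(ℝ, Fin l → ImH).prod (𝓡 (4 * m))) M
      ((Fin l → ImH) × N) ∞)
    (α : ∀ x : M, E x →L[ℝ] (Fin l → ℍ[ℝ]))
    (β : ∀ x : M, E x →L[ℝ] TangentSpace (𝓡 (4 * m)) (φ x).2) : Prop where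
  /-- `(α, β)` is a smooth morphism of vector bundles ... -/
  contMDiffOn_α : ContMDiffOn ((𝓡 n).prod 𝓘(ℝ, F)) 𝓘(ℝ, Fin l → ℍ[ℝ]) ∞
    (fun p : TotalSpace F E ↦ α p.proj p.snd) {p | p.proj ∈ φ.source}
  contMDiffOn_β : ContMDiffOn ((𝓡 n).prod 𝓘(ℝ, F)) (𝓡 (4 * m)).tangent ∞
    (fun p : TotalSpace F E ↦ (⟨(φ p.proj).2, β p.proj p.snd⟩ : TangentBundle (𝓡 (4 * m)) N))
    {p | p.proj ∈ φ.source}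
  /-- ... which is bijective on fibres. -/
  bijective : ∀ x ∈ φ.source, Function.Bijective (fun e : E x ↦ (α x e, β x e))
  /-- On `TM ⊆ E`, it is the differential of `φ`. -/
  α_incl : ∀ x ∈ φ.source, ∀ (v : TangentSpace (𝓡 n) x) (i : Fin l),
    α x (S.incl x v) i =
      ((mfderiv (𝓡 n) 𝓘(ℝ, Fin l → ImH) (fun y ↦ (φ y).1) x v : Fin l → ImH) i : ℍ[ℝ])
  β_incl : ∀ x ∈ φ.source, ∀ v : TangentSpace (𝓡 n) x,
    β x (S.incl x v) = mfderiv (𝓡 n) (𝓡 (4 * m)) (fun y ↦ (φ y).2) x v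
  /-- `V` corresponds to `ℝˡ × 0`. -/
  mem_V_iff : ∀ x ∈ φ.source, ∀ e : E x,
    e ∈ S.V x ↔ (∀ i, ∃ r : ℝ, α x e i = (r : ℍ[ℝ])) ∧ β x e = 0
  /-- The quaternionic structures correspond. -/
  mem_Q_iff : ∀ x ∈ φ.source, ∀ A : E x →L[ℝ] E x,
    A ∈ S.Q x ↔ ∃ u : ImH, ∀ e : E x, (∀ i, α x (A e) i = (u : ℍ[ℝ]) * α x e i) ∧
      β x (A e) = quaternionicAction (fun i ↦ h.J i (φ x).2) u (β x e)
  /-- The component of `∇` along `ℍˡ` is the trivial connection. -/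
  α_cov : ∀ x ∈ φ.source, ∀ s : ∀ x, E x,
    MDifferentiableAt (𝓡 n) ((𝓡 n).prod 𝓘(ℝ, F)) (fun y ↦ TotalSpace.mk' F y (s y)) x →
    ∀ v : TangentSpace (𝓡 n) x, α x (cov s x v) =
      (mfderiv (𝓡 n) 𝓘(ℝ, Fin l → ℍ[ℝ]) (fun y ↦ α y (s y)) x v : Fin l → ℍ[ℝ])
  /-- The component of `∇` along `TN` is the pullback of `D`, which is characterised by its values
  on the sections that are pullbacks of vector fields `Y` on `N`. -/
  β_cov : ∀ x ∈ φ.source, ∀ (s : ∀ x, E x) (Y : ∀ y : N, TangentSpace (𝓡 (4 * m)) y),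
    MDifferentiableAt (𝓡 n) ((𝓡 n).prod 𝓘(ℝ, F)) (fun y ↦ TotalSpace.mk' F y (s y)) x →
    MDifferentiableAt (𝓡 (4 * m)) ((𝓡 (4 * m)).prod 𝓘(ℝ, EuclideanSpace ℝ (Fin (4 * m))))
      (fun z ↦ TotalSpace.mk' (EuclideanSpace ℝ (Fin (4 * m))) z (Y z)) (φ x).2 →
    (∀ᶠ y in 𝓝 x, β y (s y) = Y (φ y).2) →
    ∀ v : TangentSpace (𝓡 n) x, β x (cov s x v) =
      D Y (φ x).2 (mfderiv (𝓡 n) (𝓡 (4 * m)) (fun y ↦ (φ y).2) x v)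

end Product

end

open Bundle Set Module VectorField
open scoped Manifold ContDiff Topology Quaternion Bundle

noncomputable section

set_option synthInstance.maxHeartbeats 200000

/-! ### Inverse functions that are smooth on a whole neighbourhood -/

section InverseFunction

variable {E G : Type*} [NormedAddCommGroup E] [NormedSpace ℝ E] [CompleteSpace E]
  [NormedAddCommGroup G] [NormedSpace ℝ G]

/-- The smooth inverse function theorem on an open set. -/
theorem ContDiffOn.exists_openPartialHomeomorph {f : E → G} {O : Set E}
    (hO : IsOpen O) (hf : ContDiffOn ℝ ∞ f O) {a : E} (ha : a ∈ O) (e : E ≃L[ℝ] G)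
    (he : fderiv ℝ f a = e) :
    ∃ h : OpenPartialHomeomorph E G, a ∈ h.source ∧ h.source ⊆ O ∧ (∀ x, h x = f x) ∧
      ContDiffOn ℝ ∞ h.symm h.target ∧
      ∀ x ∈ h.source, ∃ e' : E ≃L[ℝ] G, fderiv ℝ f x = e' := by
  have hfa : ContDiffAt ℝ ∞ f a := hf.contDiffAt (hO.mem_nhds ha)
  have hd : HasFDerivAt f (e : E →L[ℝ] G) a := by
    rw [← he]; exact (hfa.differentiableAt (by simp)).hasFDerivAt
  let h₀ := hfa.toOpenPartialHomeomorph f hd (by simp)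
  have hcont : ContinuousOn (fderiv ℝ f) O := hf.continuousOn_fderiv_of_isOpen hO (by simp)
  -- Isomorphisms form an open set, so the differential stays invertible near `a`. Restricting to
  -- such points makes the inverse smooth on its entire target, not only at the image of `a`.
  have hR : IsOpen (O ∩ fderiv ℝ f ⁻¹' (range ((↑) : (E ≃L[ℝ] G) → E →L[ℝ] G))) :=
    hcont.isOpen_inter_preimage hO ContinuousLinearEquiv.isOpen
  refine ⟨h₀.restrOpen _ hR, ?_, ?_, ?_, ?_, ?_⟩
  · exact ⟨hfa.mem_toOpenPartialHomeomorph_source hd (by simp), ha, e, he.symm⟩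
  · intro x hx; exact hx.2.1
  · intro x; rfl
  · intro y hy
    have hy' := (h₀.restrOpen _ hR).map_target hy
    obtain ⟨hx1, hx2, e', he'⟩ := hy'
    apply ContDiffAt.contDiffWithinAt
    refine (h₀.restrOpen _ hR).contDiffAt_symm (f₀' := e') hy ?_ ?_
    · have : DifferentiableAt ℝ f ((h₀.restrOpen _ hR).symm y) :=
        (hf.contDiffAt (hO.mem_nhds hx2)).differentiableAt (by simp)
      rw [he']
      exact this.hasFDerivAt
    · exact hf.contDiffAt (hO.mem_nhds hx2)
  · rintro x ⟨_, _, e', he'⟩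
    exact ⟨e', he'.symm⟩

end InverseFunction

/-! ### Normed structures on spaces of operators and of curves -/

section Shortcuts

variable {K E G : Type*} [TopologicalSpace K] [CompactSpace K] [NormedAddCommGroup E]
  [NormedSpace ℝ E] [NormedAddCommGroup G] [NormedSpace ℝ G]

/-- Shortcut instance. -/
instance clmSeminormedAddCommGroup : SeminormedAddCommGroup (E →L[ℝ] G) :=
  ContinuousLinearMap.toSeminormedAddCommGroup

/-- Shortcut instance. -/
instance clmNormedAddCommGroup : NormedAddCommGroup (E →L[ℝ] G) :=
  ContinuousLinearMap.toNormedAddCommGroup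

/-- Shortcut instance. -/
instance clmNormedSpace : NormedSpace ℝ (E →L[ℝ] G) :=
  ContinuousLinearMap.toNormedSpace

/-- Shortcut instance. -/
instance continuousMapSeminormedAddCommGroup : SeminormedAddCommGroup C(K, G) :=
  ContinuousMap.instSeminormedAddCommGroup

/-- Shortcut instance. -/
instance continuousMapNormedAddCommGroup : NormedAddCommGroup C(K, G) :=
  ContinuousMap.instNormedAddCommGroup

/-- Shortcut instance. -/
instance continuousMapNormedSpace : NormedSpace ℝ C(K, G) :=
  ContinuousMap.normedSpace

end Shortcuts

/-! ### Smoothness of superposition operators on spaces of continuous functions -/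

section Superposition

universe u

variable {K : Type*} [TopologicalSpace K] [CompactSpace K]

/-- Fibrewise application as a bounded bilinear map on spaces of continuous functions. -/
def ContinuousMap.applyL (K : Type*) [TopologicalSpace K] [CompactSpace K]
    (E G : Type*) [NormedAddCommGroup E] [NormedSpace ℝ E]
    [NormedAddCommGroup G] [NormedSpace ℝ G] :
    C(K, E →L[ℝ] G) →L[ℝ] C(K, E) →L[ℝ] C(K, G) :=
  LinearMap.mkContinuous₂
    (LinearMap.mk₂ ℝ (fun (a : C(K, E →L[ℝ] G)) (w : C(K, E)) ↦
        (⟨fun t ↦ a t (w t), by fun_prop⟩ : C(K, G)))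
      (by intros; ext; simp) (by intros; ext; simp) (by intros; ext; simp)
      (by intros; ext; simp)) 1 (by
      intro a w
      rw [ContinuousMap.norm_le _ (by positivity)]
      intro t
      simp only [LinearMap.mk₂_apply, ContinuousMap.coe_mk, one_mul]
      exact ((a t).le_opNorm _).trans (mul_le_mul (a.norm_coe_le_norm t) (w.norm_coe_le_norm t)
        (norm_nonneg _) (norm_nonneg _)))

@[simp]
theorem ContinuousMap.applyL_apply {E G : Type*} [NormedAddCommGroup E] [NormedSpace ℝ E]
    [NormedAddCommGroup G] [NormedSpace ℝ G] (a : C(K, E →L[ℝ] G)) (w : C(K, E)) (t : K) :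
    ContinuousMap.applyL K E G a w t = a t (w t) := rfl

/-- The superposition operator `w ↦ g ∘ w` is differentiable when `g` is `C¹`. -/
theorem ContDiff.hasFDerivAt_superposition {E G : Type*} [NormedAddCommGroup E] [NormedSpace ℝ E]
    [FiniteDimensional ℝ E] [NormedAddCommGroup G] [NormedSpace ℝ G] {g : E → G}
    (hg : ContDiff ℝ 1 g) (w : C(K, E)) :
    HasFDerivAt (fun w : C(K, E) ↦ (⟨g, hg.continuous⟩ : C(E, G)).comp w)
      (ContinuousMap.applyL K E G
        ((⟨fderiv ℝ g, hg.continuous_fderiv (by simp)⟩ : C(E, E →L[ℝ] G)).comp w)) w := by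
  rw [hasFDerivAt_iff_isLittleO_nhds_zero, Asymptotics.isLittleO_iff]
  intro ε hε
  -- For `‖h‖ < 1` all the segments from `w t` to `w t + h t` lie in this ball. It is compact, so
  -- `fderiv ℝ g` is uniformly continuous on it, which makes the estimate below uniform in `t`.
  have hc : IsCompact (Metric.closedBall (0 : E) (‖w‖ + 1)) := isCompact_closedBall _ _
  have huc := hc.uniformContinuousOn_of_continuous
    (hg.continuous_fderiv (by simp)).continuousOn
  rw [Metric.uniformContinuousOn_iff] at huc
  obtain ⟨δ, hδ, H⟩ := huc ε hε
  filter_upwards [Metric.ball_mem_nhds (0 : C(K, E)) (lt_min hδ one_pos)] with h hh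
  rw [mem_ball_zero_iff, lt_min_iff] at hh
  rw [ContinuousMap.norm_le _ (by positivity)]
  intro t
  have hw : ‖w t‖ ≤ ‖w‖ := w.norm_coe_le_norm t
  have hht : ‖h t‖ ≤ ‖h‖ := h.norm_coe_le_norm t
  -- Mean value inequality for `g` minus its linearization at `w t`.
  have key := (convex_segment (w t) (w t + h t)).norm_image_sub_le_of_norm_hasFDerivWithin_le'
    (f := g) (f' := fderiv ℝ g) (φ := fderiv ℝ g (w t)) (C := ε)
    (fun x _ ↦ ((hg.differentiable (by simp)) x).hasFDerivAt.hasFDerivWithinAt) ?_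
    (left_mem_segment ℝ _ _) (right_mem_segment ℝ _ _)
  · simp only [add_sub_cancel_left] at key
    simp only [ContinuousMap.sub_apply, ContinuousMap.comp_apply, ContinuousMap.coe_mk,
      ContinuousMap.add_apply, ContinuousMap.applyL_apply]
    exact key.trans (by gcongr)
  · intro x hx
    rw [segment_eq_image'] at hx
    obtain ⟨θ, hθ, rfl⟩ := hx
    have h1 : ‖θ • (w t + h t - w t)‖ ≤ ‖h‖ := by
      rw [add_sub_cancel_left, norm_smul, Real.norm_of_nonneg hθ.1]
      calc θ * ‖h t‖ ≤ 1 * ‖h‖ := by gcongr; exact hθ.2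
        _ = ‖h‖ := one_mul _
    rw [← dist_eq_norm]
    refine (H _ ?_ _ ?_ ?_).le
    · rw [mem_closedBall_zero_iff]
      refine (norm_add_le _ _).trans ?_
      linarith
    · rw [mem_closedBall_zero_iff]; linarith
    · rw [dist_eq_norm, add_sub_cancel_left]
      exact h1.trans_lt hh.1

/-- The derivative of a superposition operator is, up to a bounded linear map, the superposition
operator of `fderiv ℝ g`, so induction applies. The target `G` has to vary in the induction, since
it is replaced by `E →L[ℝ] G`; a common universe for `E` and `G` keeps this possible. -/
theorem ContDiff.contDiff_superposition_nat {E : Type u} [NormedAddCommGroup E] [NormedSpace ℝ E]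
    [FiniteDimensional ℝ E] (n : ℕ) :
    ∀ {G : Type u} [NormedAddCommGroup G] [NormedSpace ℝ G] {g : E → G} (hg : ContDiff ℝ ∞ g),
    ContDiff ℝ n (fun w : C(K, E) ↦ (⟨g, hg.continuous⟩ : C(E, G)).comp w) := by
  induction n with
  | zero =>
    intro G _ _ g hg
    exact contDiff_zero.2 (ContinuousMap.continuous_postcomp _)
  | succ n ih =>
    intro G _ _ g hg
    rw [Nat.cast_add, Nat.cast_one, contDiff_succ_iff_hasFDerivAt]
    exact ⟨_, (ContinuousMap.applyL K E G).contDiff.comp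
      (ih (hg.fderiv_right (m := ∞) (by simp))),
      fun w ↦ (hg.of_le (by simp)).hasFDerivAt_superposition w⟩

/-- The superposition operator `w ↦ g ∘ w` is smooth when `g` is. -/
theorem ContDiff.contDiff_superposition {E G : Type u} [NormedAddCommGroup E] [NormedSpace ℝ E]
    [FiniteDimensional ℝ E] [NormedAddCommGroup G] [NormedSpace ℝ G] {g : E → G}
    (hg : ContDiff ℝ ∞ g) :
    ContDiff ℝ ∞ (fun w : C(K, E) ↦ (⟨g, hg.continuous⟩ : C(E, G)).comp w) :=
  contDiff_infty.2 fun n ↦ ContDiff.contDiff_superposition_nat n hg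

end Superposition

/-! ### Integration of curves as a bounded operator -/

section Primitive

variable {Y : Type*} [NormedAddCommGroup Y] [NormedSpace ℝ Y]

/-- The primitive vanishing at `0`, as a continuous linear operator on `C([0,1], Y)`. -/
def primitiveL (Y : Type*) [NormedAddCommGroup Y] [NormedSpace ℝ Y] :
    C(unitInterval, Y) →L[ℝ] C(unitInterval, Y) :=
  LinearMap.mkContinuous
    { toFun := fun w ↦ ⟨fun t ↦ ∫ s in (0 : ℝ)..t, w (projIcc 0 1 zero_le_one s), by
        have : Continuous fun t : ℝ ↦ ∫ s in (0 : ℝ)..t, w (projIcc 0 1 zero_le_one s) :=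
          intervalIntegral.continuous_primitive
            (fun a b ↦ (w.continuous.comp continuous_projIcc).intervalIntegrable a b) 0
        exact this.comp continuous_subtype_val⟩
      map_add' := fun w w' ↦ by
        ext t
        exact intervalIntegral.integral_add
          ((w.continuous.comp continuous_projIcc).intervalIntegrable _ _)
          ((w'.continuous.comp continuous_projIcc).intervalIntegrable _ _)
      map_smul' := fun c w ↦ by
        ext t
        exact intervalIntegral.integral_smul _ _ } 1 (by
    intro w
    rw [one_mul, ContinuousMap.norm_le _ (norm_nonneg _)]
    intro t
    refine (intervalIntegral.norm_integral_le_of_norm_le_const (C := ‖w‖)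
      fun s _ ↦ w.norm_coe_le_norm _).trans ?_
    rw [sub_zero, abs_of_nonneg t.2.1]
    exact mul_le_of_le_one_right (norm_nonneg _) t.2.2)

theorem primitiveL_apply (w : C(unitInterval, Y)) (t : unitInterval) :
    primitiveL Y w t = ∫ s in (0 : ℝ)..t, w (projIcc 0 1 zero_le_one s) := rfl

/-- The fundamental theorem of calculus for `primitiveL`. -/
theorem primitiveL_eq_sub [CompleteSpace Y] {k : ℝ → Y} {w : C(unitInterval, Y)}
    (hk : ContinuousOn k (Icc 0 1))
    (hd : ∀ t (ht : t ∈ Ioo (0 : ℝ) 1), HasDerivAt k (w ⟨t, Ioo_subset_Icc_self ht⟩) t)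
    (t : unitInterval) : primitiveL Y w t = k t - k 0 := by
  rw [primitiveL_apply]
  refine intervalIntegral.integral_eq_sub_of_hasDerivAt_of_le t.2.1
    (hk.mono (Icc_subset_Icc_right t.2.2)) (fun s hs ↦ ?_)
    ((w.continuous.comp continuous_projIcc).intervalIntegrable _ _)
  have hs' : s ∈ Ioo (0 : ℝ) 1 := ⟨hs.1, hs.2.trans_le t.2.2⟩
  rw [projIcc_of_mem _ (Ioo_subset_Icc_self hs')]
  exact hd s hs'

/-- Continuing the integrand by constants beyond `[0, 1]` through `projIcc` gives a two-sided
derivative even at the endpoints. -/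
theorem hasDerivAt_primitiveL [CompleteSpace Y] (w : C(unitInterval, Y)) (t : ℝ) :
    HasDerivAt (fun t ↦ ∫ s in (0 : ℝ)..t, w (projIcc 0 1 zero_le_one s))
      (w (projIcc 0 1 zero_le_one t)) t :=
  intervalIntegral.integral_hasDerivAt_right
    ((w.continuous.comp continuous_projIcc).intervalIntegrable _ _)
    (w.continuous.comp continuous_projIcc).stronglyMeasurable.stronglyMeasurableAtFilter
    (w.continuous.comp continuous_projIcc).continuousAt

end Primitive

/-! ### Frobenius' theorem by the inverse function theorem on a space of curves -/

section Frobenius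

variable {X Y : Type} [NormedAddCommGroup X] [NormedSpace ℝ X]
  [NormedAddCommGroup Y] [NormedSpace ℝ Y]

namespace RadialEquation

/-- The map sending `((x, y), z)` to the constant curve `x`. -/
def fstConstL (X Y : Type) [NormedAddCommGroup X] [NormedSpace ℝ X]
    [NormedAddCommGroup Y] [NormedSpace ℝ Y] :
    ((X × Y) × C(unitInterval, Y)) →L[ℝ] C(unitInterval, X) :=
  ContinuousLinearMap.const ℝ unitInterval ∘L ContinuousLinearMap.fst ℝ X Y ∘L
    ContinuousLinearMap.fst ℝ (X × Y) C(unitInterval, Y)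

/-- The map sending `((x, y), z)` to the constant curve `y`. -/
def sndConstL (X Y : Type) [NormedAddCommGroup X] [NormedSpace ℝ X]
    [NormedAddCommGroup Y] [NormedSpace ℝ Y] :
    ((X × Y) × C(unitInterval, Y)) →L[ℝ] C(unitInterval, Y) :=
  ContinuousLinearMap.const ℝ unitInterval ∘L ContinuousLinearMap.snd ℝ X Y ∘L
    ContinuousLinearMap.fst ℝ (X × Y) C(unitInterval, Y)

@[simp]
theorem fstConstL_apply (q : (X × Y) × C(unitInterval, Y)) (t : unitInterval) :
    fstConstL X Y q t = q.1.1 := rfl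

@[simp]
theorem sndConstL_apply (q : (X × Y) × C(unitInterval, Y)) (t : unitInterval) :
    sndConstL X Y q t = q.1.2 := rfl

/-- The map `((x, y), z) ↦ (t ↦ (t x, z t))`. -/
def curveL (X Y : Type) [NormedAddCommGroup X] [NormedSpace ℝ X]
    [NormedAddCommGroup Y] [NormedSpace ℝ Y] :
    ((X × Y) × C(unitInterval, Y)) →L[ℝ] C(unitInterval, X × Y) :=
  (ContinuousLinearMap.inl ℝ X Y).compLeftContinuous ℝ unitInterval ∘L
      (ContinuousMap.applyL unitInterval X X
        (⟨fun t ↦ (t : ℝ) • ContinuousLinearMap.id ℝ X, by fun_prop⟩ :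
          C(unitInterval, X →L[ℝ] X))) ∘L fstConstL X Y +
    (ContinuousLinearMap.inr ℝ X Y).compLeftContinuous ℝ unitInterval ∘L
      ContinuousLinearMap.snd ℝ (X × Y) _

@[simp]
theorem curveL_apply (q : (X × Y) × C(unitInterval, Y)) (t : unitInterval) :
    curveL X Y q t = ((t : ℝ) • q.1.1, q.2 t) := by
  simp [curveL]

variable {A : X × Y → X →L[ℝ] Y}

/-- The right hand side `t ↦ A (t x, z t) x` of the radial equation. -/
def rhs (hA : ContDiff ℝ ∞ A) (q : (X × Y) × C(unitInterval, Y)) : C(unitInterval, Y) :=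
  ContinuousMap.applyL unitInterval X Y
    ((⟨A, hA.continuous⟩ : C(X × Y, X →L[ℝ] Y)).comp (curveL X Y q))
    (fstConstL X Y q)

theorem rhs_apply (hA : ContDiff ℝ ∞ A) (q : (X × Y) × C(unitInterval, Y)) (t : unitInterval) :
    rhs hA q t = A ((t : ℝ) • q.1.1, q.2 t) q.1.1 := by
  simp [rhs]

/-- The derivative of `rhs`. -/
def rhsDeriv (hA : ContDiff ℝ ∞ A) (q : (X × Y) × C(unitInterval, Y)) :
    ((X × Y) × C(unitInterval, Y)) →L[ℝ] C(unitInterval, Y) :=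
  ContinuousMap.applyL unitInterval X Y
      ((⟨A, hA.continuous⟩ : C(X × Y, X →L[ℝ] Y)).comp (curveL X Y q)) ∘L fstConstL X Y +
    (ContinuousMap.applyL unitInterval X Y).flip
      (fstConstL X Y q) ∘L
      (ContinuousMap.applyL unitInterval (X × Y) (X →L[ℝ] Y)
        ((⟨fderiv ℝ A, hA.continuous_fderiv (by simp)⟩ :
          C(X × Y, X × Y →L[ℝ] X →L[ℝ] Y)).comp (curveL X Y q))) ∘L curveL X Y

theorem rhsDeriv_apply (hA : ContDiff ℝ ∞ A) (q d : (X × Y) × C(unitInterval, Y))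
    (t : unitInterval) :
    rhsDeriv hA q d t = A ((t : ℝ) • q.1.1, q.2 t) d.1.1 +
      fderiv ℝ A ((t : ℝ) • q.1.1, q.2 t) ((t : ℝ) • d.1.1, d.2 t) q.1.1 := by
  simp [rhsDeriv]

/-- The equation `z t = y + ∫₀ᵗ A (s x, z s) x ds`, together with its parameters. -/
def equation (hA : ContDiff ℝ ∞ A) (q : (X × Y) × C(unitInterval, Y)) :
    (X × Y) × C(unitInterval, Y) :=
  (q.1, q.2 - sndConstL X Y q - primitiveL Y (rhs hA q))

/-- The derivative of `equation`. -/
def equationDeriv (hA : ContDiff ℝ ∞ A) (q : (X × Y) × C(unitInterval, Y)) :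
    ((X × Y) × C(unitInterval, Y)) →L[ℝ] (X × Y) × C(unitInterval, Y) :=
  (ContinuousLinearMap.fst ℝ (X × Y) _).prod (ContinuousLinearMap.snd ℝ (X × Y) _ -
    sndConstL X Y - primitiveL Y ∘L rhsDeriv hA q)

theorem equationDeriv_apply (hA : ContDiff ℝ ∞ A) (q d : (X × Y) × C(unitInterval, Y)) :
    equationDeriv hA q d = (d.1, d.2 - sndConstL X Y d -
      primitiveL Y (rhsDeriv hA q d)) := rfl

/-- At `x = 0` the integrand `A (t x, z t) x` is zero, and its derivative in the direction of `z` is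
zero too because of the factor `x`. The derivative of the equation is therefore block triangular
with identities on the diagonal. -/
theorem exists_equiv (hA : ContDiff ℝ ∞ A) (y₀ : Y) :
    ∃ e : ((X × Y) × C(unitInterval, Y)) ≃L[ℝ] (X × Y) × C(unitInterval, Y),
      equationDeriv hA ((0, y₀), ContinuousLinearMap.const ℝ unitInterval y₀) = e := by
  set b : (X × Y) × C(unitInterval, Y) := ((0, y₀), ContinuousLinearMap.const ℝ unitInterval y₀)
  refine ⟨(ContinuousLinearEquiv.refl ℝ (X × Y)).skewProd (.refl ℝ C(unitInterval, Y))
    (-(sndConstL X Y + primitiveL Y ∘L rhsDeriv hA b) ∘L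
      ContinuousLinearMap.inl ℝ (X × Y) _), ?_⟩
  have h0 : ∀ d, rhsDeriv hA b d = rhsDeriv hA b (d.1, 0) := by
    intro d
    ext t
    simp [rhsDeriv_apply, b]
  refine ContinuousLinearMap.ext fun d ↦ ?_
  rw [equationDeriv_apply, h0]
  refine Prod.ext (by simp) ?_
  have h1 : sndConstL X Y d = sndConstL X Y (d.1, 0) := rfl
  simp only [ContinuousLinearEquiv.coe_coe, ContinuousLinearEquiv.skewProd_apply,
    ContinuousLinearEquiv.refl_apply, neg_apply, add_apply,
    ContinuousLinearMap.comp_apply, ContinuousLinearMap.inl_apply]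
  rw [h1]
  abel

variable [FiniteDimensional ℝ X] [FiniteDimensional ℝ Y]

theorem contDiff_rhs (hA : ContDiff ℝ ∞ A) : ContDiff ℝ ∞ (rhs hA) := by
  have h1 : ContDiff ℝ ∞ fun q : (X × Y) × C(unitInterval, Y) ↦
      (⟨A, hA.continuous⟩ : C(X × Y, X →L[ℝ] Y)).comp (curveL X Y q) :=
    hA.contDiff_superposition.comp (curveL X Y).contDiff
  exact ((ContinuousMap.applyL unitInterval X Y).contDiff.comp h1).clm_apply
    (fstConstL X Y).contDiff

theorem hasFDerivAt_rhs (hA : ContDiff ℝ ∞ A) (q : (X × Y) × C(unitInterval, Y)) :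
    HasFDerivAt (rhs hA) (rhsDeriv hA q) q := by
  have h1 : HasFDerivAt (fun q : (X × Y) × C(unitInterval, Y) ↦
      (⟨A, hA.continuous⟩ : C(X × Y, X →L[ℝ] Y)).comp (curveL X Y q)) _ q :=
    ((hA.of_le (by simp)).hasFDerivAt_superposition (curveL X Y q)).comp q
      (curveL X Y).hasFDerivAt
  refine ((ContinuousMap.applyL unitInterval X Y).hasFDerivAt_of_bilinear h1
    (fstConstL X Y).hasFDerivAt).congr_fderiv ?_
  refine ContinuousLinearMap.ext fun d ↦ ContinuousMap.ext fun t ↦ ?_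
  rw [rhsDeriv_apply]
  simp

theorem contDiff_equation (hA : ContDiff ℝ ∞ A) : ContDiff ℝ ∞ (equation hA) := by
  exact contDiff_fst.prodMk ((contDiff_snd.sub (sndConstL X Y).contDiff).sub
    ((primitiveL Y).contDiff.comp (contDiff_rhs hA)))

theorem hasFDerivAt_equation (hA : ContDiff ℝ ∞ A) (q : (X × Y) × C(unitInterval, Y)) :
    HasFDerivAt (equation hA) (equationDeriv hA q) q := by
  exact HasFDerivAt.prodMk hasFDerivAt_fst ((hasFDerivAt_snd.sub (sndConstL X Y).hasFDerivAt).sub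
    ((primitiveL Y).hasFDerivAt.comp q (hasFDerivAt_rhs hA q)))

end RadialEquation

variable [FiniteDimensional ℝ X] [FiniteDimensional ℝ Y]

open RadialEquation

/-- **Frobenius' theorem** for the total differential equation `D_x u = A(x, u)`, when the right
hand side is globally defined and the compatibility condition holds near the base point. -/
theorem exists_solution_total_differential_equation_of_contDiff {A : X × Y → X →L[ℝ] Y}
    (hA : ContDiff ℝ ∞ A) {U : Set (X × Y)} (hU : IsOpen U) {y₀ : Y} (h0 : (0, y₀) ∈ U)
    (hint : ∀ p ∈ U, ∀ v w, fderiv ℝ A p (v, A p v) w = fderiv ℝ A p (w, A p w) v) :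
    ∃ (W : Set (X × Y)) (u : X × Y → Y), IsOpen W ∧ (0, y₀) ∈ W ∧ ContDiffOn ℝ ∞ u W ∧
      (∀ y, (0, y) ∈ W → u (0, y) = y) ∧
      ∀ p ∈ W, (p.1, u p) ∈ U ∧ HasFDerivAt (fun x ↦ u (x, p.2)) (A (p.1, u p)) p.1 := by
  obtain ⟨e, he⟩ := exists_equiv hA y₀
  set b : (X × Y) × C(unitInterval, Y) :=
    ((0, y₀), ContinuousLinearMap.const ℝ unitInterval y₀) with hb
  obtain ⟨h, hbh, -, hh, hsymm, hinv⟩ := (contDiff_equation hA).contDiffOn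
    |>.exists_openPartialHomeomorph isOpen_univ (mem_univ b) e
      ((hasFDerivAt_equation hA b).fderiv.trans he)
  have hEb : equation hA b = ((0, y₀), 0) := by
    have : rhs hA b = 0 := by ext t; simp [rhs_apply, hb]
    rw [equation, this, map_zero, sub_zero]
    refine Prod.ext rfl ?_
    ext t
    simp [hb]
  -- The second component of `equation` vanishes exactly when `z` solves the radial equation. So `q
  -- p` consists of the parameters `p = (x, y)` and of the solution curve that starts at `y`.
  let i : X × Y → (X × Y) × C(unitInterval, Y) := fun p ↦ (p, 0)
  have hi : ContDiff ℝ ∞ i := contDiff_id.prodMk contDiff_const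
  let q : X × Y → (X × Y) × C(unitInterval, Y) := fun p ↦ h.symm (i p)
  have hW0 : IsOpen (i ⁻¹' h.target) := h.open_target.preimage hi.continuous
  have hq : ContDiffOn ℝ ∞ q (i ⁻¹' h.target) :=
    hsymm.comp hi.contDiffOn (fun p hp ↦ hp)
  have hEq : ∀ p ∈ i ⁻¹' h.target, equation hA (q p) = i p := fun p hp ↦ by
    rw [← hh]; exact h.right_inv hp
  have hq1 : ∀ p ∈ i ⁻¹' h.target, (q p).1 = p := fun p hp ↦ congrArg Prod.fst (hEq p hp)
  have hq2 : ∀ p ∈ i ⁻¹' h.target, (q p).2 = sndConstL X Y (p, 0) +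
      primitiveL Y (rhs hA (q p)) := fun p hp ↦ by
    have := congrArg Prod.snd (hEq p hp)
    simp only [equation, i, hq1 p hp] at this
    rw [sub_sub, sub_eq_zero] at this
    refine this.trans (congrArg (· + _) ?_)
    ext t
    simp [hq1 p hp]
  have hqb : q (0, y₀) = b := by
    have : i (0, y₀) = h b := by rw [hh, hEb]
    simp only [q, this]
    exact h.left_inv hbh
  -- The integrability condition will be needed along the whole curve. Staying inside `U` is an open
  -- condition on curves because the interval is compact.
  let R : Set C(unitInterval, X × Y) := {w | MapsTo w univ U}
  have hR : IsOpen R := ContinuousMap.isOpen_setOfPred_mapsTo isCompact_univ hU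
  have hcq : ContinuousOn (fun p ↦ curveL X Y (q p)) (i ⁻¹' h.target) :=
    (curveL X Y).continuous.comp_continuousOn hq.continuousOn
  refine ⟨i ⁻¹' h.target ∩ (fun p ↦ curveL X Y (q p)) ⁻¹' R, fun p ↦ (q p).2 1,
    hcq.isOpen_inter_preimage hW0 hR, ⟨?_, ?_⟩, ?_, ?_, ?_⟩
  · have := h.map_source hbh
    rwa [hh, hEb] at this
  · intro t _
    simp only [hqb, curveL_apply, hb, smul_zero]
    exact h0
  · exact ((ContinuousMap.evalCLM ℝ (1 : unitInterval)).contDiff.comp contDiff_snd).comp_contDiffOn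
      (hq.mono inter_subset_left)
  · intro y hy
    have : rhs hA (q (0, y)) = 0 := by ext t; simp [rhs_apply, hq1 _ hy.1]
    simp [hq2 _ hy.1, this]
  · intro p hp
    have hpU : ∀ t : unitInterval, ((t : ℝ) • p.1, (q p).2 t) ∈ U := fun t ↦ by
      have := hp.2 (mem_univ t)
      rwa [curveL_apply, hq1 p hp.1] at this
    refine ⟨by simpa using hpU 1, ?_⟩
    have hqd : HasFDerivAt q (fderiv ℝ q p) p :=
      ((hq.contDiffAt (hW0.mem_nhds hp.1)).differentiableAt (by simp)).hasFDerivAt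
    have hcomp : HasFDerivAt (fun p ↦ equation hA (q p)) (equationDeriv hA (q p) ∘L fderiv ℝ q p) p :=
      (hasFDerivAt_equation hA (q p)).comp p hqd
    have hid : HasFDerivAt (fun p ↦ equation hA (q p)) (ContinuousLinearMap.inl ℝ (X × Y) _) p := by
      refine HasFDerivAt.congr_of_eventuallyEq (f := i)
        (ContinuousLinearMap.inl ℝ (X × Y) C(unitInterval, Y)).hasFDerivAt ?_
      filter_upwards [hW0.mem_nhds hp.1] with p' hp'
      exact hEq p' hp'
    have hE := hcomp.unique hid
    obtain ⟨e', he'⟩ := hinv (q p) (h.map_target hp.1)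
    rw [(hasFDerivAt_equation hA (q p)).fderiv] at he'
    have hAd : Differentiable ℝ A := hA.differentiable (by simp)
    let zx : ℝ → Y := fun t ↦ p.2 + ∫ s in (0 : ℝ)..t, rhs hA (q p) (projIcc 0 1 zero_le_one s)
    have hzx : ∀ t : unitInterval, zx t = (q p).2 t := fun t ↦ by
      rw [hq2 p hp.1]; rfl
    have hzd : ∀ t (ht : t ∈ Icc (0 : ℝ) 1), HasDerivAt zx (A (t • p.1, zx t) p.1) t := by
      intro t ht
      have := (hasDerivAt_primitiveL (rhs hA (q p)) t).const_add p.2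
      rw [projIcc_of_mem zero_le_one ht, rhs_apply, hq1 p hp.1] at this
      rw [hzx ⟨t, ht⟩]
      exact this
    -- If `D_x u = A` holds then, on the ray through `x`, the variation of the curve in the
    -- direction `v` must be `t ↦ A (t x, z t) (t v)`. This candidate is shown to solve the
    -- linearized equation, whose operator `e'` is injective, so it is the actual variation. Its
    -- value at `t = 1` is the assertion.
    have hcand : ∀ v : X, fderiv ℝ q p (v, 0) = ((v, 0), ContinuousMap.applyL unitInterval X Y
        ((⟨A, hA.continuous⟩ : C(X × Y, X →L[ℝ] Y)).comp (curveL X Y (q p)))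
        ⟨fun t ↦ (t : ℝ) • v, by fun_prop⟩) := by
      intro v
      apply e'.injective
      rw [← ContinuousLinearEquiv.coe_coe, ← he']
      have h1 : equationDeriv hA (q p) (fderiv ℝ q p (v, 0)) = ((v, 0), 0) :=
        congrArg (fun T : (X × Y) →L[ℝ] _ ↦ T (v, 0)) hE
      rw [h1, equationDeriv_apply]
      refine Prod.ext rfl ?_
      ext t
      set w : C(unitInterval, Y) := ContinuousMap.applyL unitInterval X Y
        ((⟨A, hA.continuous⟩ : C(X × Y, X →L[ℝ] Y)).comp (curveL X Y (q p)))
        ⟨fun t ↦ (t : ℝ) • v, by fun_prop⟩ with hw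
      have hwt : ∀ t, w t = A ((t : ℝ) • p.1, (q p).2 t) ((t : ℝ) • v) := fun t ↦ by
        simp [hw, hq1 p hp.1]
      have hkd : ∀ t (ht : t ∈ Icc (0 : ℝ) 1), HasDerivAt (fun t : ℝ ↦ A (t • p.1, zx t) (t • v))
          (fderiv ℝ A (t • p.1, zx t) (p.1, A (t • p.1, zx t) p.1) (t • v) +
            A (t • p.1, zx t) v) t := by
        intro t ht
        have h2 : HasDerivAt (fun t : ℝ ↦ (t • p.1, zx t)) (p.1, A (t • p.1, zx t) p.1) t := by
          have h3 : HasDerivAt (fun t : ℝ ↦ t • p.1) p.1 t := by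
            simpa using (hasDerivAt_id t).smul_const p.1
          exact h3.prodMk (hzd t ht)
        have h4 : HasDerivAt (fun t : ℝ ↦ A (t • p.1, zx t)) _ t :=
          (hAd _).hasFDerivAt.comp_hasDerivAt t h2
        have h5 : HasDerivAt (fun t : ℝ ↦ t • v) v t := by
          simpa using (hasDerivAt_id t).smul_const v
        exact h4.clm_apply h5
      have hFTC := primitiveL_eq_sub (w := rhsDeriv hA (q p) ((v, 0), w))
        (k := fun t : ℝ ↦ A (t • p.1, zx t) (t • v))
        (fun t ht ↦ (hkd t ht).continuousAt.continuousWithinAt) (fun t ht ↦ ?_) t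
      · rw [ContinuousMap.sub_apply, ContinuousMap.sub_apply, hFTC, ContinuousMap.zero_apply, hwt, hzx,
          sndConstL_apply]
        simp
      · refine (hkd t (Ioo_subset_Icc_self ht)).congr_deriv ?_
        rw [rhsDeriv_apply, hwt, hq1 p hp.1, add_comm]
        -- The time derivative of the candidate differs from the linearized right hand side only by
        -- exchanging `x` and `t v` in the derivative of `A`, which is what integrability permits.
        have := hint _ (hpU ⟨t, Ioo_subset_Icc_self ht⟩) p.1 (t • v)
        rw [← hzx ⟨t, Ioo_subset_Icc_self ht⟩] at this ⊢
        simp only at this ⊢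
        rw [this]
    have hx : HasFDerivAt (fun x : X ↦ (x, p.2)) (ContinuousLinearMap.inl ℝ X Y) p.1 :=
      hasFDerivAt_prodMk_left p.1 p.2
    have hfin : HasFDerivAt (fun x ↦ (q (x, p.2)).2 1)
        (((ContinuousMap.evalCLM ℝ (1 : unitInterval)) ∘L ContinuousLinearMap.snd ℝ (X × Y) _ ∘L
          fderiv ℝ q p) ∘L ContinuousLinearMap.inl ℝ X Y) p.1 := by
      refine HasFDerivAt.comp p.1 (g := fun p ↦ (q p).2 1) ?_ hx
      exact ((ContinuousMap.evalCLM ℝ (1 : unitInterval)) ∘L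
        ContinuousLinearMap.snd ℝ (X × Y) C(unitInterval, Y)).hasFDerivAt.comp p hqd
    refine hfin.congr_fderiv (ContinuousLinearMap.ext fun v ↦ ?_)
    simp [hcand, hq1 p hp.1]

/-- A function which is smooth on an open set agrees, near any given point of this set, with a
globally smooth function. -/
theorem ContDiffOn.exists_contDiff_eqOn {E G : Type*} [NormedAddCommGroup E] [NormedSpace ℝ E]
    [FiniteDimensional ℝ E] [NormedAddCommGroup G] [NormedSpace ℝ G] {f : E → G} {U : Set E}
    (hU : IsOpen U) (hf : ContDiffOn ℝ ∞ f U) {a : E} (ha : a ∈ U) :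
    ∃ (g : E → G) (U' : Set E), ContDiff ℝ ∞ g ∧ IsOpen U' ∧ a ∈ U' ∧ U' ⊆ U ∧ EqOn g f U' := by
  obtain ⟨r, hr, hrU⟩ := Metric.nhds_basis_closedBall.mem_iff.1 (hU.mem_nhds ha)
  let χ : ContDiffBump a := ⟨r / 2, r, half_pos hr, half_lt_self hr⟩
  refine ⟨fun x ↦ χ x • f x, Metric.ball a (r / 2), ?_, Metric.isOpen_ball,
    Metric.mem_ball_self (half_pos hr), ?_, ?_⟩
  · rw [contDiff_iff_contDiffAt]
    intro x
    by_cases hx : x ∈ U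
    · exact χ.contDiffAt.smul (hf.contDiffAt (hU.mem_nhds hx))
    · have hx' : x ∉ tsupport χ := by
        rw [χ.tsupport_eq]
        exact fun h ↦ hx (hrU h)
      refine contDiffAt_const (c := (0 : G)) |>.congr_of_eventuallyEq ?_
      filter_upwards [(isClosed_tsupport χ).isOpen_compl.mem_nhds hx'] with y hy
      rw [image_eq_zero_of_notMem_tsupport hy, zero_smul]
  · exact (Metric.ball_subset_closedBall.trans
      (Metric.closedBall_subset_closedBall (half_le_self hr.le))).trans hrU
  · intro x hx
    change χ x • f x = f x
    rw [χ.one_of_mem_closedBall (Metric.ball_subset_closedBall hx), one_smul]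

/-- **Frobenius' theorem** for the total differential equation `D_x u = A(x, u)`. -/
theorem exists_solution_total_differential_equation {A : X × Y → X →L[ℝ] Y}
    {U : Set (X × Y)} (hU : IsOpen U) (hA : ContDiffOn ℝ ∞ A U) {x₀ : X} {y₀ : Y}
    (h0 : (x₀, y₀) ∈ U)
    (hint : ∀ p ∈ U, ∀ v w, fderiv ℝ A p (v, A p v) w = fderiv ℝ A p (w, A p w) v) :
    ∃ (W : Set (X × Y)) (u : X × Y → Y), IsOpen W ∧ (x₀, y₀) ∈ W ∧ ContDiffOn ℝ ∞ u W ∧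
      (∀ y, (x₀, y) ∈ W → u (x₀, y) = y) ∧
      ∀ p ∈ W, (p.1, u p) ∈ U ∧ HasFDerivAt (fun x ↦ u (x, p.2)) (A (p.1, u p)) p.1 := by
  -- Cutting `A` off makes it globally smooth, and a translation moves the base point to `0`.
  -- Integrability survives on the smaller set `U'`, where the cut-off does nothing.
  obtain ⟨g, U', hg, hU', h0', hU'U, hgA⟩ := hA.exists_contDiff_eqOn hU h0
  let τ : X × Y → X × Y := fun p ↦ (x₀ + p.1, p.2)
  have hτ : ContDiff ℝ ∞ τ := (contDiff_const.add contDiff_fst).prodMk contDiff_snd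
  have hτd : ∀ p, HasFDerivAt τ (ContinuousLinearMap.id ℝ (X × Y)) p := fun p ↦
    ((hasFDerivAt_fst.const_add x₀).prodMk hasFDerivAt_snd).congr_fderiv
      (ContinuousLinearMap.ext fun _ ↦ rfl)
  have hgd : ∀ p ∈ U', fderiv ℝ g p = fderiv ℝ A p := fun p hp ↦
    Filter.EventuallyEq.fderiv_eq (Filter.eventuallyEq_of_mem (hU'.mem_nhds hp) hgA)
  obtain ⟨W, u, hW, hW0, hu, hu0, hud⟩ :=
    exists_solution_total_differential_equation_of_contDiff (A := g ∘ τ) (y₀ := y₀) (hg.comp hτ)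
      (hU'.preimage hτ.continuous) (by simpa [τ] using h0') (by
      intro p hp v w
      have : fderiv ℝ (g ∘ τ) p = fderiv ℝ A (τ p) := by
        rw [((hg.differentiable (by simp) (τ p)).hasFDerivAt.comp p (hτd p)).fderiv, ← hgd _ hp]
        rfl
      rw [this, Function.comp_apply, hgA hp]
      exact hint _ (hU'U hp) v w)
  let σ : X × Y → X × Y := fun p ↦ (p.1 - x₀, p.2)
  have hσ : ContDiff ℝ ∞ σ := (contDiff_fst.sub contDiff_const).prodMk contDiff_snd
  refine ⟨σ ⁻¹' W, u ∘ σ, hW.preimage hσ.continuous, by simpa [σ] using hW0,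
    hu.comp hσ.contDiffOn (fun p hp ↦ hp), ?_, ?_⟩
  · intro y hy
    have hy' : (0, y) ∈ W := by simpa [σ] using hy
    simpa [σ] using hu0 y hy'
  · intro p hp
    obtain ⟨h1, h2⟩ := hud _ hp
    have h3 : τ ((σ p).1, u (σ p)) = (p.1, (u ∘ σ) p) := by simp [τ, σ]
    have h4 : (p.1, (u ∘ σ) p) ∈ U' := by rw [← h3]; exact h1
    refine ⟨hU'U h4, ?_⟩
    rw [Function.comp_apply, h3, hgA h4] at h2
    have h5 : HasFDerivAt (fun x : X ↦ x - x₀) (ContinuousLinearMap.id ℝ X) p.1 :=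
      (hasFDerivAt_id p.1).sub_const x₀
    exact h2.comp p.1 h5

end Frobenius

/-! ### Connections on trivial bundles and the subbundles they preserve -/

section ParallelFrame

/-- The curvature `∂_u (B v) - ∂_v (B u) + [B u, B v]` of the connection `d + B` on a trivial
vector bundle. -/
def connectionCurvature {X G : Type*} [NormedAddCommGroup X] [NormedSpace ℝ X]
    [NormedAddCommGroup G] [NormedSpace ℝ G] (B : X → X →L[ℝ] G →L[ℝ] G) (x u v : X) : G →L[ℝ] G :=
  fderiv ℝ B x u v - fderiv ℝ B x v u + B x u ∘L B x v - B x v ∘L B x u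

variable {X : Type*} [NormedAddCommGroup X] [NormedSpace ℝ X]
  {K : Type*} [NormedAddCommGroup K] [NormedSpace ℝ K]
  {G : Type*} [NormedAddCommGroup G] [NormedSpace ℝ G]

theorem connectionCurvature_apply (B : X → X →L[ℝ] G →L[ℝ] G) (x u v : X) (g : G) :
    connectionCurvature B x u v g = fderiv ℝ B x u v g - fderiv ℝ B x v u g +
      B x u (B x v g) - B x v (B x u g) := rfl

theorem connectionCurvature_swap (B : X → X →L[ℝ] G →L[ℝ] G) (x u v : X) :
    connectionCurvature B x v u = -connectionCurvature B x u v := by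
  simp only [connectionCurvature]; abel

theorem connectionCurvature_add_left (B : X → X →L[ℝ] G →L[ℝ] G) (x u u' v : X) :
    connectionCurvature B x (u + u') v =
      connectionCurvature B x u v + connectionCurvature B x u' v := by
  ext g; simp only [connectionCurvature_apply, map_add, add_apply]; abel

/-- An injective smooth family of linear maps has, locally, a smooth family of left inverses. -/
theorem ContDiffOn.exists_leftInverse [FiniteDimensional ℝ K] [FiniteDimensional ℝ G]
    {s : X → K →L[ℝ] G} {O : Set X} (hO : IsOpen O) (hs : ContDiffOn ℝ ∞ s O) {x₀ : X}
    (hx₀ : x₀ ∈ O) (hinj : Function.Injective (s x₀)) :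
    ∃ (O' : Set X) (Λ : X → G →L[ℝ] K), IsOpen O' ∧ x₀ ∈ O' ∧ O' ⊆ O ∧ ContDiffOn ℝ ∞ Λ O' ∧
      ∀ x ∈ O', ∀ k, Λ x (s x k) = k := by
  obtain ⟨L, hL⟩ := LinearMap.exists_leftInverse_of_injective (s x₀ : K →ₗ[ℝ] G)
    (LinearMap.ker_eq_bot.2 hinj)
  let L₀ : G →L[ℝ] K := LinearMap.toContinuousLinearMap L
  have hT : ContDiffOn ℝ ∞ (fun x ↦ L₀ ∘L s x) O := contDiffOn_const.clm_comp hs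
  have hT0 : L₀ ∘L s x₀ = ContinuousLinearMap.id ℝ K := by
    ext k; exact congrArg (fun T : K →ₗ[ℝ] K ↦ T k) hL
  -- A left inverse `L₀` at `x₀` makes `L₀ ∘ s x` invertible for nearby `x`, and `(L₀ ∘ s x)⁻¹ ∘ L₀`
  -- is then a left inverse of `s x`.
  refine ⟨O ∩ (fun x ↦ L₀ ∘L s x) ⁻¹' (range ((↑) : (K ≃L[ℝ] K) → K →L[ℝ] K)),
    fun x ↦ (L₀ ∘L s x).inverse ∘L L₀,
    hT.continuousOn.isOpen_inter_preimage hO ContinuousLinearEquiv.isOpen,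
    ⟨hx₀, ContinuousLinearEquiv.refl ℝ K, hT0.symm⟩, inter_subset_left, ?_, ?_⟩
  · rintro x ⟨hx, e, he⟩
    refine ContDiffWithinAt.clm_comp ?_ contDiffWithinAt_const
    have h1 : ContDiffAt ℝ ∞ ContinuousLinearMap.inverse (L₀ ∘L s x) := by
      have := contDiffAt_map_inverse (𝕜 := ℝ) (n := ∞) e
      rwa [he] at this
    exact h1.comp_contDiffWithinAt x ((hT x hx).mono inter_subset_left)
  · rintro x ⟨hx, e, he⟩ k
    change (L₀ ∘L s x).inverse ((L₀ ∘L s x) k) = k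
    simp only at he
    rw [← he]
    simp

/-- The connection form induced on a subbundle preserved by the connection `d + B`, with respect
to a frame `s` of this subbundle. -/
theorem exists_inducedConnectionForm [FiniteDimensional ℝ K] [FiniteDimensional ℝ G]
    {B : X → X →L[ℝ] G →L[ℝ] G} {s : X → K →L[ℝ] G} {O : Set X} (hO : IsOpen O)
    (hB : ContDiffOn ℝ ∞ B O) (hs : ContDiffOn ℝ ∞ s O) {x₀ : X}
    (hx₀ : x₀ ∈ O) (hinj : Function.Injective (s x₀))
    (hpres : ∀ x ∈ O, ∀ u k, ∃ k', fderiv ℝ s x u k + B x u (s x k) = s x k') :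
    ∃ (O' : Set X) (γ : X → X →L[ℝ] K →L[ℝ] K), IsOpen O' ∧ x₀ ∈ O' ∧ O' ⊆ O ∧
      ContDiffOn ℝ ∞ γ O' ∧
      ∀ x ∈ O', ∀ u k, fderiv ℝ s x u k + B x u (s x k) = s x (γ x u k) := by
  obtain ⟨O', Λ, hO', hx₀', hO'O, hΛ, hΛs⟩ := hs.exists_leftInverse hO hx₀ hinj
  refine ⟨O', fun x ↦ ContinuousLinearMap.compL ℝ K G K (Λ x) ∘L
    (fderiv ℝ s x + (ContinuousLinearMap.compL ℝ K G G).flip (s x) ∘L B x), hO', hx₀', hO'O, ?_, ?_⟩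
  · refine ((ContinuousLinearMap.compL ℝ K G K).contDiff.comp_contDiffOn hΛ).clm_comp
      (ContDiffOn.add ?_ (ContDiffOn.clm_comp ?_ (hB.mono hO'O)))
    · exact (hs.mono hO'O).fderiv_of_isOpen hO' (by simp)
    · exact (ContinuousLinearMap.compL ℝ K G G).flip.contDiff.comp_contDiffOn (hs.mono hO'O)
  · intro x hx u k
    obtain ⟨k', hk'⟩ := hpres x (hO'O hx) u k
    rw [hk']
    congr 1
    have : ((ContinuousLinearMap.compL ℝ K G K (Λ x) ∘L (fderiv ℝ s x +
      (ContinuousLinearMap.compL ℝ K G G).flip (s x) ∘L B x)) u) k =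
      Λ x (fderiv ℝ s x u k + B x u (s x k)) := rfl
    rw [this, hk', hΛs x hx]

/-- The curvature of the connection induced on a subbundle is the restriction of the curvature. -/
theorem apply_connectionCurvature
    {B : X → X →L[ℝ] G →L[ℝ] G} {s : X → K →L[ℝ] G} {γ : X → X →L[ℝ] K →L[ℝ] K}
    {O : Set X} (hO : IsOpen O)
    (hB : ContDiffOn ℝ ∞ B O) (hs : ContDiffOn ℝ ∞ s O) (hγ : ContDiffOn ℝ ∞ γ O)
    (h : ∀ x ∈ O, ∀ u k, fderiv ℝ s x u k + B x u (s x k) = s x (γ x u k))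
    {x : X} (hx : x ∈ O) (u v : X) (k : K) :
    s x (connectionCurvature γ x u v k) = connectionCurvature B x u v (s x k) := by
  have hsd : HasFDerivAt s (fderiv ℝ s x) x :=
    ((hs.contDiffAt (hO.mem_nhds hx)).differentiableAt (by simp)).hasFDerivAt
  have hBd : HasFDerivAt B (fderiv ℝ B x) x :=
    ((hB.contDiffAt (hO.mem_nhds hx)).differentiableAt (by simp)).hasFDerivAt
  have hγd : HasFDerivAt γ (fderiv ℝ γ x) x :=
    ((hγ.contDiffAt (hO.mem_nhds hx)).differentiableAt (by simp)).hasFDerivAt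
  have hfd : HasFDerivAt (fderiv ℝ s) (fderiv ℝ (fderiv ℝ s) x) x :=
    (((hs.fderiv_of_isOpen (m := ∞) hO (by simp)).contDiffAt
      (hO.mem_nhds hx)).differentiableAt (by simp)).hasFDerivAt
  have hsymm : ∀ w u, fderiv ℝ (fderiv ℝ s) x w u = fderiv ℝ (fderiv ℝ s) x u w :=
    (hs.contDiffAt (hO.mem_nhds hx)).isSymmSndFDerivAt
      (by simpa using ENat.LEInfty.out)
  -- The relation `ds + B s = s γ` is differentiated once more. Antisymmetrizing in the two
  -- directions removes the second derivative of `s` and leaves the two curvatures.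
  have key : ∀ w u, fderiv ℝ (fderiv ℝ s) x w u k =
      fderiv ℝ s x w (γ x u k) + s x (fderiv ℝ γ x w u k) - (fderiv ℝ B x w u (s x k) +
        B x u (fderiv ℝ s x w k)) := by
    intro w u
    have h1 : HasFDerivAt (fun y ↦ fderiv ℝ s y u k) _ x :=
      (hfd.clm_apply (hasFDerivAt_const u x)).clm_apply (hasFDerivAt_const k x)
    have h2 : HasFDerivAt (fun y ↦ s y (γ y u k)) _ x :=
      hsd.clm_apply ((hγd.clm_apply (hasFDerivAt_const u x)).clm_apply (hasFDerivAt_const k x))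
    have h3 : HasFDerivAt (fun y ↦ B y u (s y k)) _ x :=
      (hBd.clm_apply (hasFDerivAt_const u x)).clm_apply (hsd.clm_apply (hasFDerivAt_const k x))
    have h4 : (fun y ↦ fderiv ℝ s y u k) =ᶠ[𝓝 x] fun y ↦ s y (γ y u k) - B y u (s y k) := by
      filter_upwards [hO.mem_nhds hx] with y hy
      rw [← h y hy]; abel
    have h5 := congrArg (fun T : X →L[ℝ] G ↦ T w)
      ((h1.congr_of_eventuallyEq h4.symm).unique (h2.sub h3))
    simp only [add_apply, sub_apply, ContinuousLinearMap.comp_apply,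
      ContinuousLinearMap.flip_apply, zero_apply, map_zero, zero_add] at h5
    rw [h5]
    abel
  have e1 := key u v
  have e2 := key v u
  rw [hsymm v u, e1] at e2
  have a1 := h x hx u (γ x v k)
  have a2 := h x hx v (γ x u k)
  have b1 : fderiv ℝ s x u k = s x (γ x u k) - B x u (s x k) := by rw [← h x hx]; abel
  have b2 : fderiv ℝ s x v k = s x (γ x v k) - B x v (s x k) := by rw [← h x hx]; abel
  rw [b1, b2] at e2
  simp only [connectionCurvature_apply, map_add, map_sub]
  rw [← a1, ← a2]
  simp only [map_sub] at e2
  rw [← sub_eq_zero] at e2 ⊢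
  rw [← e2]
  abel

end ParallelFrame

/-! ### Flat connections and parallel frames -/

section FlatFrame

variable {X : Type} [NormedAddCommGroup X] [NormedSpace ℝ X] [FiniteDimensional ℝ X]
  {K : Type} [NormedAddCommGroup K] [NormedSpace ℝ K] [FiniteDimensional ℝ K]
  {G : Type*} [NormedAddCommGroup G] [NormedSpace ℝ G] [FiniteDimensional ℝ G]

/-- A flat connection on a trivial bundle is, locally, gauge equivalent to the trivial one. -/
theorem exists_gauge_of_connectionCurvature_eq_zero {γ : X → X →L[ℝ] K →L[ℝ] K} {O : Set X}
    (hO : IsOpen O) (hγ : ContDiffOn ℝ ∞ γ O) {x₀ : X} (hx₀ : x₀ ∈ O)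
    (hflat : ∀ x ∈ O, ∀ u v, connectionCurvature γ x u v = 0) :
    ∃ (O' : Set X) (c : X → K →L[ℝ] K), IsOpen O' ∧ x₀ ∈ O' ∧ O' ⊆ O ∧ ContDiffOn ℝ ∞ c O' ∧
      c x₀ = ContinuousLinearMap.id ℝ K ∧
      (∀ x ∈ O', ∃ e : K ≃L[ℝ] K, c x = e) ∧
      ∀ x ∈ O', HasFDerivAt c (-((ContinuousLinearMap.compL ℝ K K K).flip (c x) ∘L γ x)) x := by
  -- The gauge solves `dc = -γ c`, whose integrability condition is the vanishing of the curvature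
  -- of `γ`.
  let A : X × (K →L[ℝ] K) → X →L[ℝ] (K →L[ℝ] K) := fun p ↦
    -((ContinuousLinearMap.compL ℝ K K K).flip p.2 ∘L γ p.1)
  have hA : ContDiffOn ℝ ∞ A (O ×ˢ univ) := by
    refine (ContDiffOn.clm_comp ?_ ?_).neg
    · exact ((ContinuousLinearMap.compL ℝ K K K).flip.contDiff.comp contDiff_snd).contDiffOn
    · exact hγ.comp contDiffOn_fst (fun p hp ↦ hp.1)
  obtain ⟨W, c, hW, hxW, hc, hc0, hcd⟩ := exists_solution_total_differential_equation
    (hO.prod isOpen_univ) hA (x₀ := x₀) (y₀ := ContinuousLinearMap.id ℝ K) ⟨hx₀, mem_univ _⟩ (by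
      rintro ⟨x, y⟩ ⟨hx, -⟩ v w
      have hγd : HasFDerivAt γ (fderiv ℝ γ x) x :=
        ((hγ.contDiffAt (hO.mem_nhds hx)).differentiableAt (by simp)).hasFDerivAt
      have hd : ∀ d w, fderiv ℝ A (x, y) d w = -(fderiv ℝ γ x d.1 w ∘L y + γ x w ∘L d.2) := by
        intro d w
        have h1 : HasFDerivAt (fun p : X × (K →L[ℝ] K) ↦ γ p.1)
            (fderiv ℝ γ x ∘L ContinuousLinearMap.fst ℝ X (K →L[ℝ] K)) (x, y) :=
          HasFDerivAt.comp (x, y) (g := γ) hγd hasFDerivAt_fst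
        have h2 : HasFDerivAt (fun p : X × (K →L[ℝ] K) ↦
            (ContinuousLinearMap.compL ℝ K K K).flip p.2)
            ((ContinuousLinearMap.compL ℝ K K K).flip ∘L
              ContinuousLinearMap.snd ℝ X (K →L[ℝ] K)) (x, y) :=
          ((ContinuousLinearMap.compL ℝ K K K).flip ∘L
            ContinuousLinearMap.snd ℝ X (K →L[ℝ] K)).hasFDerivAt
        have h3 : HasFDerivAt A _ (x, y) := (h2.clm_comp h1).neg
        rw [h3.fderiv]
        ext k
        simp
      rw [hd, hd]
      simp only [A]
      ext k
      have hk := congrArg (fun T : K →L[ℝ] K ↦ T (y k)) (hflat x hx v w)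
      simp only [connectionCurvature_apply, zero_apply] at hk
      simp only [neg_apply, add_apply, ContinuousLinearMap.comp_apply,
        ContinuousLinearMap.flip_apply, ContinuousLinearMap.compL_apply, map_neg]
      rw [← sub_eq_zero]
      rw [← neg_eq_zero, ← hk]
      abel)
  let i : X → X × (K →L[ℝ] K) := fun x ↦ (x, ContinuousLinearMap.id ℝ K)
  have hi : ContDiff ℝ ∞ i := contDiff_id.prodMk contDiff_const
  have hcont : ContDiffOn ℝ ∞ (fun x ↦ c (i x)) (i ⁻¹' W) := hc.comp hi.contDiffOn (fun p hp ↦ hp)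
  -- The solution starts at the identity, so it is invertible after shrinking.
  refine ⟨i ⁻¹' W ∩ (fun x ↦ c (i x)) ⁻¹' (range ((↑) : (K ≃L[ℝ] K) → K →L[ℝ] K)),
    fun x ↦ c (i x), hcont.continuousOn.isOpen_inter_preimage (hW.preimage hi.continuous)
      ContinuousLinearEquiv.isOpen, ⟨hxW, ?_⟩, ?_, hcont.mono inter_subset_left, hc0 _ hxW, ?_, ?_⟩
  · exact ⟨ContinuousLinearEquiv.refl ℝ K, (hc0 _ hxW).symm⟩
  · exact fun x hx ↦ (hcd _ hx.1).1.1
  · rintro x ⟨_, e, he⟩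
    exact ⟨e, he.symm⟩
  · rintro x ⟨hx, -⟩
    exact (hcd _ hx).2

/-- A subbundle which is preserved by a connection, and on which the curvature vanishes, admits
local parallel frames. -/
theorem exists_parallel_frame {B : X → X →L[ℝ] G →L[ℝ] G} {s : X → K →L[ℝ] G} {O : Set X}
    (hO : IsOpen O) (hB : ContDiffOn ℝ ∞ B O) (hs : ContDiffOn ℝ ∞ s O) {x₀ : X}
    (hx₀ : x₀ ∈ O) (hinj : ∀ x ∈ O, Function.Injective (s x))
    (hpres : ∀ x ∈ O, ∀ u k, ∃ k', fderiv ℝ s x u k + B x u (s x k) = s x k')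
    (hflat : ∀ x ∈ O, ∀ u v k, connectionCurvature B x u v (s x k) = 0) :
    ∃ (O' : Set X) (σ : X → K →L[ℝ] G), IsOpen O' ∧ x₀ ∈ O' ∧ O' ⊆ O ∧ ContDiffOn ℝ ∞ σ O' ∧
      σ x₀ = s x₀ ∧ (∀ x ∈ O', ∃ e : K ≃L[ℝ] K, σ x = s x ∘L e) ∧
      ∀ x ∈ O', ∀ u k, fderiv ℝ σ x u k = -B x u (σ x k) := by
  obtain ⟨O₁, γ, hO₁, hx₁, hO₁O, hγ, hγs⟩ :=
    exists_inducedConnectionForm hO hB hs hx₀ (hinj x₀ hx₀) hpres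
  obtain ⟨O₂, c, hO₂, hx₂, hO₂O, hc, hc0, hce, hcd⟩ :=
    exists_gauge_of_connectionCurvature_eq_zero hO₁ hγ hx₁ (by
      intro x hx u v
      ext k
      apply hinj x (hO₁O hx)
      rw [apply_connectionCurvature hO₁ (hB.mono hO₁O) (hs.mono hO₁O) hγ hγs hx,
        hflat x (hO₁O hx), zero_apply, map_zero])
  refine ⟨O₂, fun x ↦ s x ∘L c x, hO₂, hx₂, hO₂O.trans hO₁O,
    (hs.mono (hO₂O.trans hO₁O)).clm_comp hc, by simp [hc0], ?_, ?_⟩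
  · intro x hx
    obtain ⟨e, he⟩ := hce x hx
    exact ⟨e, congrArg (s x ∘L ·) he⟩
  · intro x hx u k
    have hsd : HasFDerivAt s (fderiv ℝ s x) x :=
      ((hs.contDiffAt (hO.mem_nhds (hO₁O (hO₂O hx)))).differentiableAt (by simp)).hasFDerivAt
    rw [(hsd.clm_comp (hcd x hx)).fderiv]
    have := hγs x (hO₂O hx) u (c x k)
    rw [← eq_sub_iff_add_eq] at this
    simp [this]
    abel

end FlatFrame

/-! ### Pointwise algebra: the Bianchi identity forces the curvature to be trivial on `V` and `Q` -/

section CurvatureAlgebra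

/-- The pointwise algebraic properties of the curvature `R` of a torsion free connection which is
compatible with an almost `f`-quaternionic structure. -/
structure IsFQuaternionicCurvature {X F : Type*} [AddCommGroup X] [Module ℝ X] [AddCommGroup F]
    [Module ℝ F] (ι : X →ₗ[ℝ] F) (V : Submodule ℝ F) (I J K : F →ₗ[ℝ] F)
    (R : X → X → F →ₗ[ℝ] F) : Prop where
  II : ∀ e, I (I e) = -e
  JJ : ∀ e, J (J e) = -e
  KK : ∀ e, K (K e) = -e
  IJ : ∀ e, I (J e) = K e
  JK : ∀ e, J (K e) = I e
  KI : ∀ e, K (I e) = J e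
  JI : ∀ e, J (I e) = -K e
  KJ : ∀ e, K (J e) = -I e
  IK : ∀ e, I (K e) = -J e
  eq_zero_of_mem : ∀ z ∈ V, ∀ w, z = ι w → z = 0
  exists_add : ∀ e, ∃ z ∈ V, ∃ w, e = z + ι w
  IV : ∀ z ∈ V, ∃ w, I z = ι w
  JV : ∀ z ∈ V, ∃ w, J z = ι w
  KV : ∀ z ∈ V, ∃ w, K z = ι w
  add_left : ∀ u u' v e, R (u + u') v e = R u v e + R u' v e
  swap : ∀ u v e, R v u e = -R u v e
  RV : ∀ u v, ∀ z ∈ V, R u v z ∈ V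
  RT : ∀ u v w, ∃ w', R u v (ι w) = ι w'
  RQ : ∀ u v, ∃ a b c : ℝ, ∀ e, R u v (I e) = I (R u v e) + c • J e - b • K e ∧
    R u v (J e) = J (R u v e) + a • K e - c • I e ∧ R u v (K e) = K (R u v e) + b • I e - a • J e
  bianchi : ∀ u v w, R u v (ι w) + R v w (ι u) + R w u (ι v) = 0

namespace IsFQuaternionicCurvature

variable {X F : Type*} [AddCommGroup X] [Module ℝ X] [AddCommGroup F]
    [Module ℝ F] {ι : X →ₗ[ℝ] F} {V : Submodule ℝ F} {I J K : F →ₗ[ℝ] F}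
    {R : X → X → F →ₗ[ℝ] F} (h : IsFQuaternionicCurvature ι V I J K R)

include h

/-- The hypotheses are invariant under cyclic permutation of the units, so later arguments need only
single out `I`. -/
theorem rotate : IsFQuaternionicCurvature ι V J K I R where
  II := h.JJ
  JJ := h.KK
  KK := h.II
  IJ := h.JK
  JK := h.KI
  KI := h.IJ
  JI := h.KJ
  KJ := h.IK
  IK := h.JI
  eq_zero_of_mem := h.eq_zero_of_mem
  exists_add := h.exists_add
  IV := h.JV
  JV := h.KV
  KV := h.IV
  add_left := h.add_left
  swap := h.swap
  RV := h.RV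
  RT := h.RT
  RQ := fun u v ↦ by
    obtain ⟨a, b, c, H⟩ := h.RQ u v
    exact ⟨b, c, a, fun e ↦ ⟨(H e).2.1, (H e).2.2, (H e).1⟩⟩
  bianchi := h.bianchi

/-- Membership in the largest quaternionic subspace of `range ι`. -/
def IsQuatTangent (ι : X →ₗ[ℝ] F) (I J K : F →ₗ[ℝ] F) (e : F) : Prop :=
  e ∈ LinearMap.range ι ∧ I e ∈ LinearMap.range ι ∧ J e ∈ LinearMap.range ι ∧
    K e ∈ LinearMap.range ι

/-- Applying `I` sends `I z₁` to `-z₁ ∈ V` and the other terms to `K z₂`, `-J z₃` and `I e`, all of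
which lie in the range of `ι`; and `V` meets that range only in `0`. -/
theorem eq_zero_fst {z₁ z₂ z₃ e : F} (h₁ : z₁ ∈ V) (h₂ : z₂ ∈ V) (h₃ : z₃ ∈ V)
    (he : IsQuatTangent ι I J K e) (H : I z₁ + J z₂ + K z₃ + e = 0) : z₁ = 0 := by
  have H' := congrArg I H
  simp only [map_add, map_zero, h.II, h.IJ, h.IK] at H'
  obtain ⟨w₂, hw₂⟩ := h.KV z₂ h₂
  obtain ⟨w₃, hw₃⟩ := h.JV z₃ h₃
  obtain ⟨w, hw⟩ := he.2.1
  refine h.eq_zero_of_mem z₁ h₁ (w₂ - w₃ + w) ?_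
  rw [map_add, map_sub, ← hw₂, ← hw₃, hw, ← sub_eq_zero, ← neg_eq_zero, ← H']
  abel

/-- Directness of the sum `IV + JV + KV + W`, with `W` the largest quaternionic subspace of the
tangent space. Every use of the Bianchi identity below is split into components by this lemma. -/
theorem eq_zero_of_add_eq_zero {z₁ z₂ z₃ e : F} (h₁ : z₁ ∈ V) (h₂ : z₂ ∈ V) (h₃ : z₃ ∈ V)
    (he : IsQuatTangent ι I J K e) (H : I z₁ + J z₂ + K z₃ + e = 0) :
    z₁ = 0 ∧ z₂ = 0 ∧ z₃ = 0 ∧ e = 0 := by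
  have e₁ := h.eq_zero_fst h₁ h₂ h₃ he H
  have e₂ := h.rotate.eq_zero_fst h₂ h₃ h₁ (e := e) ⟨he.1, he.2.2.1, he.2.2.2, he.2.1⟩
    (by rw [← H]; abel)
  have e₃ := h.rotate.rotate.eq_zero_fst h₃ h₁ h₂ (e := e) ⟨he.1, he.2.2.2, he.2.1, he.2.2.1⟩
    (by rw [← H]; abel)
  subst e₁ e₂ e₃
  simpa using H

omit h in
theorem isQuatTangent_zero : IsQuatTangent ι I J K 0 := by
  simp [IsQuatTangent]

omit h in
theorem IsQuatTangent.add {e e' : F} (he : IsQuatTangent ι I J K e)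
    (he' : IsQuatTangent ι I J K e') : IsQuatTangent ι I J K (e + e') := by
  simp only [IsQuatTangent, map_add]
  exact ⟨add_mem he.1 he'.1, add_mem he.2.1 he'.2.1, add_mem he.2.2.1 he'.2.2.1,
    add_mem he.2.2.2 he'.2.2.2⟩

theorem isQuatTangent_I {e : F} (he : IsQuatTangent ι I J K e) :
    IsQuatTangent ι I J K (I e) := by
  simp only [IsQuatTangent, h.II, h.JI, h.KI, neg_mem_iff]
  exact ⟨he.2.1, he.1, he.2.2.2, he.2.2.1⟩

/-- `R u v` preserves the tangent space, and its commutators with `I`, `J`, `K` stay in their span,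
so it preserves the largest quaternionic subspace. -/
theorem isQuatTangent_R (u v : X) {e : F} (he : IsQuatTangent ι I J K e) :
    IsQuatTangent ι I J K (R u v e) := by
  have hR : ∀ e ∈ LinearMap.range ι, R u v e ∈ LinearMap.range ι := by
    rintro e ⟨w, rfl⟩
    obtain ⟨w', hw'⟩ := h.RT u v w
    exact ⟨w', hw'.symm⟩
  obtain ⟨a, b, c, H⟩ := h.RQ u v
  obtain ⟨H1, H2, H3⟩ := H e
  refine ⟨hR _ he.1, ?_, ?_, ?_⟩
  · have : I (R u v e) = R u v (I e) - c • J e + b • K e := by rw [H1]; abel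
    rw [this]
    exact add_mem (sub_mem (hR _ he.2.1) (Submodule.smul_mem _ _ he.2.2.1))
      (Submodule.smul_mem _ _ he.2.2.2)
  · have : J (R u v e) = R u v (J e) - a • K e + c • I e := by rw [H2]; abel
    rw [this]
    exact add_mem (sub_mem (hR _ he.2.2.1) (Submodule.smul_mem _ _ he.2.2.2))
      (Submodule.smul_mem _ _ he.2.1)
  · have : K (R u v e) = R u v (K e) - b • I e + a • J e := by rw [H3]; abel
    rw [this]
    exact add_mem (sub_mem (hR _ he.2.2.2) (Submodule.smul_mem _ _ he.2.1))
      (Submodule.smul_mem _ _ he.2.2.1)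

/-- The components in `V` of `I w`, `J w`, `K w` measure how far `w` is from being quaternionic.
Adding `I`, `J`, `K` of these components to `w` cancels them. -/
theorem exists_decomposition (w : X) : ∃ z₁ ∈ V, ∃ z₂ ∈ V, ∃ z₃ ∈ V, ∃ e,
    IsQuatTangent ι I J K e ∧ ι w = I z₁ + J z₂ + K z₃ + e := by
  obtain ⟨z₁, h₁, w₁, e₁⟩ := h.exists_add (I (ι w))
  obtain ⟨z₂, h₂, w₂, e₂⟩ := h.exists_add (J (ι w))
  obtain ⟨z₃, h₃, w₃, e₃⟩ := h.exists_add (K (ι w))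
  have m : ∀ z ∈ V, I z ∈ LinearMap.range ι ∧ J z ∈ LinearMap.range ι ∧
      K z ∈ LinearMap.range ι := by
    intro z hz
    obtain ⟨a, ha⟩ := h.IV z hz
    obtain ⟨b, hb⟩ := h.JV z hz
    obtain ⟨c, hc⟩ := h.KV z hz
    exact ⟨⟨a, ha.symm⟩, ⟨b, hb.symm⟩, ⟨c, hc.symm⟩⟩
  have r : ∀ w, ι w ∈ LinearMap.range ι := fun w ↦ ⟨w, rfl⟩
  refine ⟨-z₁, neg_mem h₁, -z₂, neg_mem h₂, -z₃, neg_mem h₃,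
    ι w + I z₁ + J z₂ + K z₃, ⟨?_, ?_, ?_, ?_⟩, by simp only [map_neg]; abel⟩
  · exact add_mem (add_mem (add_mem (r w) (m z₁ h₁).1) (m z₂ h₂).2.1) (m z₃ h₃).2.2
  · simp only [map_add, h.II, h.IJ, h.IK, e₁]
    have : z₁ + ι w₁ + -z₁ + K z₂ + -J z₃ = ι w₁ + K z₂ - J z₃ := by abel
    rw [this]
    exact sub_mem (add_mem (r _) (m z₂ h₂).2.2) (m z₃ h₃).2.1
  · simp only [map_add, h.JI, h.JJ, h.JK, e₂]
    have : z₂ + ι w₂ + -K z₁ + -z₂ + I z₃ = ι w₂ - K z₁ + I z₃ := by abel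
    rw [this]
    exact add_mem (sub_mem (r _) (m z₁ h₁).2.2) (m z₃ h₃).1
  · simp only [map_add, h.KI, h.KJ, h.KK, e₃]
    have : z₃ + ι w₃ + J z₁ + -I z₂ + -z₃ = ι w₃ + J z₁ - I z₂ := by abel
    rw [this]
    exact sub_mem (add_mem (r _) (m z₁ h₁).2.1) (m z₂ h₂).1

omit h in
/-- `R u v` vanishes on `V` and commutes with `I, J, K`. -/
def IsTrivialAt (V : Submodule ℝ F) (I J K : F →ₗ[ℝ] F) (R : X → X → F →ₗ[ℝ] F) (u v : X) : Prop :=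
  (∀ z ∈ V, R u v z = 0) ∧ ∀ e, R u v (I e) = I (R u v e) ∧ R u v (J e) = J (R u v e) ∧
    R u v (K e) = K (R u v e)

omit h in
theorem IsTrivialAt.rotate {u v : X} (ht : IsTrivialAt V I J K R u v) :
    IsTrivialAt V J K I R u v :=
  ⟨ht.1, fun e ↦ ⟨(ht.2 e).2.1, (ht.2 e).2.2, (ht.2 e).1⟩⟩

theorem isTrivialAt_swap {u v : X} (ht : IsTrivialAt V I J K R u v) :
    IsTrivialAt V I J K R v u := by
  refine ⟨fun z hz ↦ by rw [h.swap, ht.1 z hz, neg_zero], fun e ↦ ?_⟩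
  simp only [h.swap u v, map_neg, neg_inj]
  exact ht.2 e

theorem isTrivialAt_add_left {u u' v : X} (ht : IsTrivialAt V I J K R u v)
    (ht' : IsTrivialAt V I J K R u' v) : IsTrivialAt V I J K R (u + u') v := by
  refine ⟨fun z hz ↦ by rw [h.add_left, ht.1 z hz, ht'.1 z hz, add_zero], fun e ↦ ?_⟩
  simp only [h.add_left, (ht.2 e).1, (ht.2 e).2.1, (ht.2 e).2.2, (ht'.2 e).1, (ht'.2 e).2.1,
    (ht'.2 e).2.2, map_add, and_self]

theorem isTrivialAt_add_right {u v v' : X} (ht : IsTrivialAt V I J K R u v)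
    (ht' : IsTrivialAt V I J K R u v') : IsTrivialAt V I J K R u (v + v') :=
  h.isTrivialAt_swap (h.isTrivialAt_add_left (h.isTrivialAt_swap ht) (h.isTrivialAt_swap ht'))

/-- In the Bianchi identity for `u`, `v` in `W` and a third vector `I z`, two terms lie in `W`. The
remaining one, `I (R u v z) + c J z - b K z`, must then vanish componentwise. The third vector `J
z₀` removes `a` in the same way. -/
theorem isTrivialAt_tangent_tangent {z₀ : F} (hz₀ : z₀ ∈ V) (hz₀' : z₀ ≠ 0) {u v : X}
    (hu : IsQuatTangent ι I J K (ι u)) (hv : IsQuatTangent ι I J K (ι v)) :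
    IsTrivialAt V I J K R u v := by
  obtain ⟨a, b, c, H⟩ := h.RQ u v
  have key : ∀ z ∈ V, R u v z = 0 ∧ c • z = 0 ∧ b • z = 0 := by
    intro z hz
    obtain ⟨w, hw⟩ := h.IV z hz
    have hB := h.bianchi u v w
    rw [← hw, (H z).1, add_assoc] at hB
    obtain ⟨h1, h2, h3, -⟩ := h.eq_zero_of_add_eq_zero (z₁ := R u v z) (z₂ := c • z)
      (z₃ := -b • z) (h.RV u v z hz) (V.smul_mem _ hz) (V.smul_mem _ hz)
      ((h.isQuatTangent_R v w hu).add (h.isQuatTangent_R w u hv))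
      (by rw [← hB]; simp only [map_smul]; module)
    exact ⟨h1, h2, by simpa using h3⟩
  have key' : a • z₀ = 0 := by
    obtain ⟨w, hw⟩ := h.JV z₀ hz₀
    have hB := h.bianchi u v w
    rw [← hw, (H z₀).2.1, add_assoc] at hB
    obtain ⟨h1, h2, h3, -⟩ := h.eq_zero_of_add_eq_zero (z₁ := -c • z₀) (z₂ := R u v z₀)
      (z₃ := a • z₀) (V.smul_mem _ hz₀) (h.RV u v z₀ hz₀) (V.smul_mem _ hz₀)
      ((h.isQuatTangent_R v w hu).add (h.isQuatTangent_R w u hv))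
      (by rw [← hB]; simp only [map_smul]; module)
    exact h3
  have ha : a = 0 := (smul_eq_zero.1 key').resolve_right hz₀'
  have hb : b = 0 := (smul_eq_zero.1 (key z₀ hz₀).2.2).resolve_right hz₀'
  have hc : c = 0 := (smul_eq_zero.1 (key z₀ hz₀).2.1).resolve_right hz₀'
  subst ha hb hc
  exact ⟨fun z hz ↦ (key z hz).1, fun e ↦ by simpa using H e⟩

/-- Membership in the span `I V + J V + K V`. -/
def IsQuatVertical (V : Submodule ℝ F) (I J K : F →ₗ[ℝ] F) (e : F) : Prop :=
  ∃ z₁ ∈ V, ∃ z₂ ∈ V, ∃ z₃ ∈ V, e = I z₁ + J z₂ + K z₃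

omit h in
theorem isQuatVertical_I {z : F} (hz : z ∈ V) : IsQuatVertical V I J K (I z) :=
  ⟨z, hz, 0, V.zero_mem, 0, V.zero_mem, by simp⟩

omit h in
theorem isQuatVertical_J {z : F} (hz : z ∈ V) : IsQuatVertical V I J K (J z) :=
  ⟨0, V.zero_mem, z, hz, 0, V.zero_mem, by simp⟩

omit h in
theorem isQuatVertical_K {z : F} (hz : z ∈ V) : IsQuatVertical V I J K (K z) :=
  ⟨0, V.zero_mem, 0, V.zero_mem, z, hz, by simp⟩

omit h in
theorem IsQuatVertical.add {e e' : F} (he : IsQuatVertical V I J K e)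
    (he' : IsQuatVertical V I J K e') : IsQuatVertical V I J K (e + e') := by
  obtain ⟨z₁, h₁, z₂, h₂, z₃, h₃, rfl⟩ := he
  obtain ⟨y₁, k₁, y₂, k₂, y₃, k₃, rfl⟩ := he'
  exact ⟨z₁ + y₁, add_mem h₁ k₁, z₂ + y₂, add_mem h₂ k₂, z₃ + y₃, add_mem h₃ k₃, by
    simp only [map_add]; abel⟩

theorem isQuatVertical_R (u v : X) {e : F} (he : IsQuatVertical V I J K e) :
    IsQuatVertical V I J K (R u v e) := by
  obtain ⟨z₁, h₁, z₂, h₂, z₃, h₃, rfl⟩ := he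
  obtain ⟨a, b, c, H⟩ := h.RQ u v
  refine ⟨R u v z₁ - c • z₂ + b • z₃, ?_, R u v z₂ + c • z₁ - a • z₃, ?_,
    R u v z₃ - b • z₁ + a • z₂, ?_, ?_⟩
  · exact add_mem (sub_mem (h.RV u v _ h₁) (V.smul_mem _ h₂)) (V.smul_mem _ h₃)
  · exact sub_mem (add_mem (h.RV u v _ h₂) (V.smul_mem _ h₁)) (V.smul_mem _ h₃)
  · exact add_mem (sub_mem (h.RV u v _ h₃) (V.smul_mem _ h₁)) (V.smul_mem _ h₂)
  · simp only [map_add, map_sub, map_smul, (H z₁).1, (H z₂).2.1, (H z₃).2.2]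
    module

theorem eq_zero_of_isQuatVertical_of_isQuatTangent {e e' : F} (he : IsQuatVertical V I J K e)
    (he' : IsQuatTangent ι I J K e') (H : e + e' = 0) : e = 0 ∧ e' = 0 := by
  obtain ⟨z₁, h₁, z₂, h₂, z₃, h₃, rfl⟩ := he
  obtain ⟨rfl, rfl, rfl, rfl⟩ := h.eq_zero_of_add_eq_zero h₁ h₂ h₃ he' H
  simp

/-- The curvature vanishes on quaternionic tangent vectors in vertical directions. -/
theorem commute_of_vertical {w₀ : X} (hw₀ : IsQuatTangent ι I J K (ι w₀)) (hw₀' : ι w₀ ≠ 0)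
    {u v : X} (hu : IsQuatVertical V I J K (ι u)) (hv : IsQuatVertical V I J K (ι v)) (e : F) :
    R u v (I e) = I (R u v e) ∧ R u v (J e) = J (R u v e) ∧ R u v (K e) = K (R u v e) := by
  -- With `u`, `v` vertical and the third vector in `W`, exactly one term of the Bianchi identity
  -- lies in `W` and the other two are vertical.
  have hz : ∀ e, IsQuatTangent ι I J K e → R u v e = 0 := by
    intro e he
    obtain ⟨w, rfl⟩ := he.1
    refine (h.eq_zero_of_isQuatVertical_of_isQuatTangent
      ((h.isQuatVertical_R v w hu).add (h.isQuatVertical_R w u hv)) (h.isQuatTangent_R u v he)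
      ?_).2
    rw [← h.bianchi u v w]; abel
  obtain ⟨a, b, c, H⟩ := h.RQ u v
  set e₀ := ι w₀
  have hI := hz _ (h.isQuatTangent_I hw₀)
  have hJ := hz _ (show IsQuatTangent ι I J K (J e₀) by
    have := h.rotate.isQuatTangent_I (e := e₀) ⟨hw₀.1, hw₀.2.2.1, hw₀.2.2.2, hw₀.2.1⟩
    exact ⟨this.1, this.2.2.2, this.2.1, this.2.2.1⟩)
  rw [(H e₀).1, hz _ hw₀, map_zero, zero_add] at hI
  rw [(H e₀).2.1, hz _ hw₀, map_zero, zero_add] at hJ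
  -- Now `c J e₀ = b K e₀` and `a K e₀ = c I e₀`. Applying units and combining gives sums of squares
  -- times `e₀`, and `e₀ ≠ 0`.
  have h1 : (c * c + b * b) • e₀ = 0 := by
    have hI1 := congrArg J hI
    have hI2 := congrArg K hI
    simp only [map_sub, map_smul, h.JJ, h.JK, h.KJ, h.KK, map_zero] at hI1 hI2
    have : (c * c + b * b) • e₀ = (-c) • (c • -e₀ - b • I e₀) +
      b • (c • -I e₀ - b • -e₀) + (2 * b * c - 2 * b * c) • I e₀ := by module
    rw [this, hI1, hI2]; simp
  have h2 : (a * a + c * c) • e₀ = 0 := by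
    have hI1 := congrArg K hJ
    have hI2 := congrArg I hJ
    simp only [map_sub, map_smul, h.KI, h.IK, h.II, h.KK, map_zero] at hI1 hI2
    have : (a * a + c * c) • e₀ = (-a) • (a • -e₀ - c • J e₀) +
      c • (a • -J e₀ - c • -e₀) := by module
    rw [this, hI1, hI2]; simp
  have h1' := (smul_eq_zero.1 h1).resolve_right hw₀'
  have h2' := (smul_eq_zero.1 h2).resolve_right hw₀'
  have ha : a = 0 := by nlinarith [mul_self_nonneg a, mul_self_nonneg c]
  have hb : b = 0 := by nlinarith [mul_self_nonneg b, mul_self_nonneg c]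
  have hc : c = 0 := by nlinarith [mul_self_nonneg b, mul_self_nonneg c]
  subst ha hb hc
  simpa using H e

/-- Once `R` commutes with the units on vertical pairs, the Bianchi identity for `I z`, `J z'`, `K
z''` reads `I(…) + J(…) + K(R u v z'') = 0`, and its `K` component is the claim. -/
theorem isTrivialAt_I_J {w₀ : X} (hw₀ : IsQuatTangent ι I J K (ι w₀)) (hw₀' : ι w₀ ≠ 0)
    {u v : X} {z z' : F} (hz : z ∈ V) (hz' : z' ∈ V) (hu : ι u = I z) (hv : ι v = J z') :
    IsTrivialAt V I J K R u v := by
  have hu' : IsQuatVertical V I J K (ι u) := hu ▸ isQuatVertical_I hz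
  have hv' : IsQuatVertical V I J K (ι v) := hv ▸ isQuatVertical_J hz'
  refine ⟨fun z'' hz'' ↦ ?_, h.commute_of_vertical hw₀ hw₀' hu' hv'⟩
  obtain ⟨w, hw⟩ := h.KV z'' hz''
  have hw' : IsQuatVertical V I J K (ι w) := hw ▸ isQuatVertical_K hz''
  have hB := h.bianchi u v w
  rw [← hw, hu, hv, (h.commute_of_vertical hw₀ hw₀' hu' hv' z'').2.2,
    (h.commute_of_vertical hw₀ hw₀' hv' hw' z).1,
    (h.commute_of_vertical hw₀ hw₀' hw' hu' z').2.1] at hB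
  exact (h.eq_zero_of_add_eq_zero (h.RV v w z hz) (h.RV w u z' hz') (h.RV u v z'' hz'')
    isQuatTangent_zero (Eq.trans (by abel) hB)).2.2.1

/-- As for a mixed pair, but with the third vector `J z''`: then `R u v z''` is the only
contribution to the `J` component. -/
theorem isTrivialAt_I_I {w₀ : X} (hw₀ : IsQuatTangent ι I J K (ι w₀)) (hw₀' : ι w₀ ≠ 0)
    {u v : X} {z z' : F} (hz : z ∈ V) (hz' : z' ∈ V) (hu : ι u = I z) (hv : ι v = I z') :
    IsTrivialAt V I J K R u v := by
  have hu' : IsQuatVertical V I J K (ι u) := hu ▸ isQuatVertical_I hz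
  have hv' : IsQuatVertical V I J K (ι v) := hv ▸ isQuatVertical_I hz'
  refine ⟨fun z'' hz'' ↦ ?_, h.commute_of_vertical hw₀ hw₀' hu' hv'⟩
  obtain ⟨w, hw⟩ := h.JV z'' hz''
  have hw' : IsQuatVertical V I J K (ι w) := hw ▸ isQuatVertical_J hz''
  have hB := h.bianchi u v w
  rw [← hw, hu, hv, (h.commute_of_vertical hw₀ hw₀' hu' hv' z'').2.1,
    (h.commute_of_vertical hw₀ hw₀' hv' hw' z).1,
    (h.commute_of_vertical hw₀ hw₀' hw' hu' z').1] at hB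
  refine (h.eq_zero_of_add_eq_zero (z₁ := R v w z + R w u z') (z₃ := 0)
    (add_mem (h.RV v w z hz) (h.RV w u z' hz')) (h.RV u v z'' hz'') V.zero_mem
    isQuatTangent_zero (Eq.trans (by simp only [map_add, map_zero]; abel) hB)).2.1

theorem isTrivialAt_I_vertical {w₀ : X} (hw₀ : IsQuatTangent ι I J K (ι w₀)) (hw₀' : ι w₀ ≠ 0)
    (hinj : Function.Injective ι) {u v : X} {z : F} (hz : z ∈ V) (hu : ι u = I z)
    (hv : IsQuatVertical V I J K (ι v)) : IsTrivialAt V I J K R u v := by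
  obtain ⟨z₁, h₁, z₂, h₂, z₃, h₃, hv⟩ := hv
  obtain ⟨w₁, e₁⟩ := h.IV z₁ h₁
  obtain ⟨w₂, e₂⟩ := h.JV z₂ h₂
  obtain ⟨w₃, e₃⟩ := h.KV z₃ h₃
  have : v = w₁ + w₂ + w₃ := hinj (by rw [hv, map_add, map_add, e₁, e₂, e₃])
  rw [this]
  refine h.isTrivialAt_add_right (h.isTrivialAt_add_right ?_ ?_) ?_
  · exact h.isTrivialAt_I_I hw₀ hw₀' hz h₁ hu e₁.symm
  · exact h.isTrivialAt_I_J hw₀ hw₀' hz h₂ hu e₂.symm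
  -- For the twice rotated triple `(K, I, J)` the vectors `K z₃` and `I z` are in the position of an
  -- `I`, `J` pair.
  · have := h.rotate.rotate.isTrivialAt_I_J (w₀ := w₀)
      ⟨hw₀.1, hw₀.2.2.2, hw₀.2.1, hw₀.2.2.1⟩ hw₀' h₃ hz e₃.symm hu
    exact h.isTrivialAt_swap this.rotate

/-- The vertical part of the Bianchi identity for `u`, `y`, `u'`: the term `R u' u y` lies in `W`
and drops out. -/
theorem apply_eq_of_tangent {u u' y : X} (hy : IsQuatTangent ι I J K (ι y))
    (hu : IsQuatVertical V I J K (ι u)) (hu' : IsQuatVertical V I J K (ι u')) :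
    R u y (ι u') = R u' y (ι u) := by
  have := (h.eq_zero_of_isQuatVertical_of_isQuatTangent
    ((h.isQuatVertical_R u y hu').add (h.isQuatVertical_R y u' hu)) (h.isQuatTangent_R u' u hy)
    (h.bianchi u y u')).1
  rw [h.swap u' y, ← sub_eq_add_neg, sub_eq_zero] at this
  exact this

theorem eq_zero_left (hinj : Function.Injective ι) {u : X} (hu : ι u = 0) (y : X) (e : F) :
    R u y e = 0 := by
  have hu0 : u = 0 := hinj (by rw [hu, map_zero])
  have := h.add_left 0 0 y e
  rw [add_zero] at this
  rw [hu0]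
  exact left_eq_add.1 this

/-- Comparing `R u y (I z')` with `R u' y (I z)`, where `u'` corresponds to `I z'`, gives `c z' = c'
z` and `b z' = b' z`. A `z'` independent of `z` kills `b` and `c`, so the action on the units is a
rotation about `I`. This is where `V` of rank one would fail. -/
theorem exists_coeff_of_tangent
    (hV : ∀ z ∈ V, z ≠ 0 → ∃ z' ∈ V, ∀ s t : ℝ, s • z' = t • z → s = 0)
    (hinj : Function.Injective ι) {u y : X} {z : F} (hz : z ∈ V) (hu : ι u = I z)
    (hy : IsQuatTangent ι I J K (ι y)) : ∃ a : ℝ, ∀ e, R u y (I e) = I (R u y e) ∧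
      R u y (J e) = J (R u y e) + a • K e ∧ R u y (K e) = K (R u y e) - a • J e := by
  by_cases hz0 : z = 0
  · have hR0 := h.eq_zero_left hinj (u := u) (by rw [hu, hz0, map_zero]) y
    exact ⟨0, fun e ↦ by simp [hR0]⟩
  obtain ⟨z', hz', hzz'⟩ := hV z hz hz0
  obtain ⟨u', hu'⟩ := h.IV z' hz'
  obtain ⟨a, b, c, H⟩ := h.RQ u y
  obtain ⟨a', b', c', H'⟩ := h.RQ u' y
  have hB := h.apply_eq_of_tangent hy (u := u) (u' := u') (hu ▸ isQuatVertical_I hz)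
    (hu' ▸ isQuatVertical_I hz')
  rw [hu, ← hu', (H z').1, (H' z).1, ← sub_eq_zero] at hB
  obtain ⟨-, hc, hb, -⟩ := h.eq_zero_of_add_eq_zero (z₁ := R u y z' - R u' y z)
    (z₂ := c • z' - c' • z) (z₃ := b' • z - b • z')
    (sub_mem (h.RV _ _ _ hz') (h.RV _ _ _ hz)) (sub_mem (V.smul_mem _ hz') (V.smul_mem _ hz))
    (sub_mem (V.smul_mem _ hz) (V.smul_mem _ hz')) isQuatTangent_zero
    (Eq.trans (by simp only [map_sub, map_smul]; abel) hB)
  have hc0 : c = 0 := hzz' c c' (sub_eq_zero.1 hc)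
  have hb0 : b = 0 := hzz' b b' (sub_eq_zero.1 hb).symm
  subst hc0 hb0
  exact ⟨a, fun e ↦ by simpa using H e⟩

/-- The previous restriction applies both to `u` and to `u'` with `ι u' = J z'`, where only
rotations about `J` remain. Comparing `R u y (J z')` with `R u' y (I z)` gives `R u y z' = 0` in the
`J` component and `a z' + b' z = 0` in the `K` component; independence removes `a`. -/
theorem isTrivialAt_I_tangent
    (hV : ∀ z ∈ V, z ≠ 0 → ∃ z' ∈ V, ∀ s t : ℝ, s • z' = t • z → s = 0)
    (hinj : Function.Injective ι) {u y : X} {z : F} (hz : z ∈ V) (hu : ι u = I z)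
    (hy : IsQuatTangent ι I J K (ι y)) : IsTrivialAt V I J K R u y := by
  by_cases hz0 : z = 0
  · have hR0 := h.eq_zero_left hinj (u := u) (by rw [hu, hz0, map_zero]) y
    exact ⟨fun _ _ ↦ hR0 _, fun e ↦ by simp [hR0]⟩
  obtain ⟨a, H⟩ := h.exists_coeff_of_tangent hV hinj hz hu hy
  have key : ∀ z' ∈ V, ∃ b' : ℝ, R u y z' = 0 ∧ a • z' + b' • z = 0 := by
    intro z' hz'
    obtain ⟨u', hu'⟩ := h.JV z' hz'
    obtain ⟨b', H'⟩ := h.rotate.exists_coeff_of_tangent hV hinj hz' hu'.symm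
      ⟨hy.1, hy.2.2.1, hy.2.2.2, hy.2.1⟩
    have hB := h.apply_eq_of_tangent hy (u := u) (u' := u') (hu ▸ isQuatVertical_I hz)
      (hu' ▸ isQuatVertical_J hz')
    rw [hu, ← hu', (H z').2.1, (H' z).2.2, ← sub_eq_zero] at hB
    obtain ⟨-, h2, h3, -⟩ := h.eq_zero_of_add_eq_zero (z₁ := -R u' y z) (z₂ := R u y z')
      (z₃ := a • z' + b' • z) (neg_mem (h.RV _ _ _ hz)) (h.RV _ _ _ hz')
      (add_mem (V.smul_mem _ hz') (V.smul_mem _ hz)) isQuatTangent_zero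
      (Eq.trans (by simp only [map_add, map_neg, map_smul]; abel) hB)
    exact ⟨b', h2, h3⟩
  obtain ⟨z', hz', hzz'⟩ := hV z hz hz0
  obtain ⟨b', -, hab⟩ := key z' hz'
  have ha : a = 0 := hzz' a (-b') (by rw [neg_smul, ← sub_eq_zero, sub_neg_eq_add]; exact hab)
  subst ha
  exact ⟨fun z' hz' ↦ (key z' hz').choose_spec.1, fun e ↦ by simpa using H e⟩

/-- Every tangent vector splits, through `ι`, into its components in `I V`, `J V`, `K V` and in the
largest quaternionic subspace. -/
theorem exists_decomposition_domain (hinj : Function.Injective ι) (w : X) :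
    ∃ z₁ ∈ V, ∃ z₂ ∈ V, ∃ z₃ ∈ V, ∃ w₁ w₂ w₃ y, ι w₁ = I z₁ ∧ ι w₂ = J z₂ ∧ ι w₃ = K z₃ ∧
      IsQuatTangent ι I J K (ι y) ∧ w = w₁ + w₂ + w₃ + y := by
  obtain ⟨z₁, h₁, z₂, h₂, z₃, h₃, e, he, hw⟩ := h.exists_decomposition w
  obtain ⟨w₁, e₁⟩ := h.IV z₁ h₁
  obtain ⟨w₂, e₂⟩ := h.JV z₂ h₂
  obtain ⟨w₃, e₃⟩ := h.KV z₃ h₃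
  obtain ⟨y, rfl⟩ := he.1
  exact ⟨z₁, h₁, z₂, h₂, z₃, h₃, w₁, w₂, w₃, y, e₁.symm, e₂.symm, e₃.symm, he,
    hinj (by rw [hw, e₁, e₂, e₃]; simp only [map_add])⟩

theorem isTrivialAt_I
    (hV : ∀ z ∈ V, z ≠ 0 → ∃ z' ∈ V, ∀ s t : ℝ, s • z' = t • z → s = 0)
    (hinj : Function.Injective ι)
    {w₀ : X} (hw₀ : IsQuatTangent ι I J K (ι w₀)) (hw₀' : ι w₀ ≠ 0)
    {u v : X} {z : F} (hz : z ∈ V) (hu : ι u = I z) : IsTrivialAt V I J K R u v := by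
  obtain ⟨z₁, h₁, z₂, h₂, z₃, h₃, w₁, w₂, w₃, y, e₁, e₂, e₃, he, rfl⟩ :=
    h.exists_decomposition_domain hinj v
  refine h.isTrivialAt_add_right (h.isTrivialAt_I_vertical hw₀ hw₀' hinj hz hu ?_)
    (h.isTrivialAt_I_tangent hV hinj hz hu he)
  rw [map_add, map_add, e₁, e₂, e₃]
  exact ((isQuatVertical_I h₁).add (isQuatVertical_J h₂)).add (isQuatVertical_K h₃)

/-- The curvature of a torsion free connection compatible with an almost `f`-quaternionic structure
vanishes on `V` and commutes with the quaternionic structure. -/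
theorem isTrivialAt
    (hV : ∀ z ∈ V, z ≠ 0 → ∃ z' ∈ V, ∀ s t : ℝ, s • z' = t • z → s = 0)
    (hinj : Function.Injective ι) {z₀ : F} (hz₀ : z₀ ∈ V) (hz₀' : z₀ ≠ 0)
    {w₀ : X} (hw₀ : IsQuatTangent ι I J K (ι w₀)) (hw₀' : ι w₀ ≠ 0) (u v : X) :
    IsTrivialAt V I J K R u v := by
  obtain ⟨z₁, h₁, z₂, h₂, z₃, h₃, w₁, w₂, w₃, y, e₁, e₂, e₃, he, rfl⟩ :=
    h.exists_decomposition_domain hinj u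
  have hI : ∀ v, IsTrivialAt V I J K R w₁ v := fun v ↦
    h.isTrivialAt_I hV hinj hw₀ hw₀' h₁ e₁
  have hJ : ∀ v, IsTrivialAt V I J K R w₂ v := fun v ↦
    (h.rotate.isTrivialAt_I hV hinj (w₀ := w₀) ⟨hw₀.1, hw₀.2.2.1, hw₀.2.2.2, hw₀.2.1⟩ hw₀'
      h₂ e₂).rotate.rotate
  have hK : ∀ v, IsTrivialAt V I J K R w₃ v := fun v ↦
    (h.rotate.rotate.isTrivialAt_I hV hinj (w₀ := w₀) ⟨hw₀.1, hw₀.2.2.2, hw₀.2.1, hw₀.2.2.1⟩ hw₀'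
      h₃ e₃).rotate
  refine h.isTrivialAt_add_left (h.isTrivialAt_add_left (h.isTrivialAt_add_left (hI v) (hJ v))
    (hK v)) ?_
  obtain ⟨z₁', h₁', z₂', h₂', z₃', h₃', w₁', w₂', w₃', y', e₁', e₂', e₃', he', rfl⟩ :=
    h.exists_decomposition_domain hinj v
  refine h.isTrivialAt_add_right (h.isTrivialAt_add_right (h.isTrivialAt_add_right ?_ ?_) ?_)
    (h.isTrivialAt_tangent_tangent hz₀ hz₀' he he')
  · exact h.isTrivialAt_swap (h.isTrivialAt_I hV hinj hw₀ hw₀' h₁' e₁')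
  · exact h.isTrivialAt_swap (h.rotate.isTrivialAt_I hV hinj (w₀ := w₀)
      ⟨hw₀.1, hw₀.2.2.1, hw₀.2.2.2, hw₀.2.1⟩ hw₀' h₂' e₂').rotate.rotate
  · exact h.isTrivialAt_swap (h.rotate.rotate.isTrivialAt_I hV hinj (w₀ := w₀)
      ⟨hw₀.1, hw₀.2.2.2, hw₀.2.1, hw₀.2.2.1⟩ hw₀' h₃' e₃').rotate

end IsFQuaternionicCurvature

end CurvatureAlgebra

/-! ### Linear algebra of quaternionic triples -/

section Triple

variable {F : Type*} [NormedAddCommGroup F] [NormedSpace ℝ F] {A : Fin 3 → F →L[ℝ] F}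

namespace IsQuaternionicTriple

variable (h : IsQuaternionicTriple A)

include h

theorem apply_00 (e : F) : A 0 (A 0 e) = -e := congrArg (fun T : F →L[ℝ] F ↦ T e) h.sq_zero

theorem apply_11 (e : F) : A 1 (A 1 e) = -e := congrArg (fun T : F →L[ℝ] F ↦ T e) h.sq_one

theorem apply_01 (e : F) : A 0 (A 1 e) = A 2 e := congrArg (fun T : F →L[ℝ] F ↦ T e) h.zero_one

theorem apply_10 (e : F) : A 1 (A 0 e) = -A 2 e := congrArg (fun T : F →L[ℝ] F ↦ T e) h.one_zero

theorem apply_02 (e : F) : A 0 (A 2 e) = -A 1 e := by rw [← h.apply_01, h.apply_00]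

theorem apply_20 (e : F) : A 2 (A 0 e) = A 1 e := by
  rw [← h.apply_01, h.apply_10, map_neg, h.apply_02, neg_neg]

theorem apply_12 (e : F) : A 1 (A 2 e) = A 0 e := by
  rw [← h.apply_01, h.apply_10, ← h.apply_01, h.apply_11, map_neg, neg_neg]

theorem apply_21 (e : F) : A 2 (A 1 e) = -A 0 e := by rw [← h.apply_01, h.apply_11, map_neg]

theorem apply_22 (e : F) : A 2 (A 2 e) = -e := by rw [← h.apply_01, h.apply_12, h.apply_00]

end IsQuaternionicTriple

/-- The map `c ↦ ∑ j, c j • A j`. -/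
def tripleL (A : Fin 3 → F →L[ℝ] F) : (Fin 3 → ℝ) →L[ℝ] F →L[ℝ] F :=
  ∑ j, (ContinuousLinearMap.proj (R := ℝ) (φ := fun _ : Fin 3 ↦ ℝ) j).smulRight (A j)

theorem tripleL_apply (A : Fin 3 → F →L[ℝ] F) (c : Fin 3 → ℝ) :
    tripleL A c = c 0 • A 0 + c 1 • A 1 + c 2 • A 2 := by
  simp [tripleL, Fin.sum_univ_three]

theorem tripleL_single (A : Fin 3 → F →L[ℝ] F) (i : Fin 3) :
    tripleL A (Pi.single i 1) = A i := by
  rw [tripleL_apply]; fin_cases i <;> simp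

theorem tripleL_mem_span (A : Fin 3 → F →L[ℝ] F) (c : Fin 3 → ℝ) :
    tripleL A c ∈ Submodule.span ℝ (range A) := by
  rw [tripleL_apply]
  have := fun i ↦ Submodule.subset_span (R := ℝ) (mem_range_self (f := A) i)
  exact add_mem (add_mem (Submodule.smul_mem _ _ (this 0)) (Submodule.smul_mem _ _ (this 1)))
    (Submodule.smul_mem _ _ (this 2))

theorem exists_tripleL_of_mem_span {A : Fin 3 → F →L[ℝ] F} {T : F →L[ℝ] F}
    (hT : T ∈ Submodule.span ℝ (range A)) : ∃ c, T = tripleL A c := by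
  obtain ⟨c, rfl⟩ := (Submodule.mem_span_range_iff_exists_fun ℝ).1 hT
  exact ⟨c, by rw [tripleL_apply, Fin.sum_univ_three]⟩

/-- Multiplication of imaginary quaternions: minus the scalar product plus the cross product. -/
theorem IsQuaternionicTriple.tripleL_comp (h : IsQuaternionicTriple A) (a b : Fin 3 → ℝ) (e : F) :
    tripleL A a (tripleL A b e) = -(a 0 * b 0 + a 1 * b 1 + a 2 * b 2) • e +
      tripleL A ![a 1 * b 2 - a 2 * b 1, a 2 * b 0 - a 0 * b 2, a 0 * b 1 - a 1 * b 0] e := by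
  simp only [tripleL_apply, add_apply, smul_apply, map_add, map_smul, h.apply_00, h.apply_01,
    h.apply_02, h.apply_10, h.apply_11, h.apply_12, h.apply_20, h.apply_21, h.apply_22,
    Matrix.cons_val_zero, Matrix.cons_val_one, Matrix.cons_val]
  module

/-- The square of `c 0 A 0 + c 1 A 1 + c 2 A 2` is `-|c|²`, so it vanishes only for `c = 0`. -/
theorem IsQuaternionicTriple.injective_tripleL [Nontrivial F] (h : IsQuaternionicTriple A) :
    Function.Injective (tripleL A) := by
  rw [injective_iff_map_eq_zero]
  intro c hc
  obtain ⟨e, he⟩ := exists_ne (0 : F)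
  have h1 := h.tripleL_comp c c e
  have h2 : (tripleL A ![c 1 * c 2 - c 2 * c 1, c 2 * c 0 - c 0 * c 2, c 0 * c 1 - c 1 * c 0]) e
      = 0 := by
    have : ![c 1 * c 2 - c 2 * c 1, c 2 * c 0 - c 0 * c 2, c 0 * c 1 - c 1 * c 0] = 0 := by
      ext i; fin_cases i <;> simp <;> ring
    rw [this, map_zero, zero_apply]
  rw [h2, hc, zero_apply, add_zero, eq_comm, smul_eq_zero] at h1
  have h3 := h1.resolve_right he
  have h4 : c 0 = 0 := by nlinarith [mul_self_nonneg (c 0), mul_self_nonneg (c 1), mul_self_nonneg (c 2)]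
  have h5 : c 1 = 0 := by nlinarith [mul_self_nonneg (c 0), mul_self_nonneg (c 1), mul_self_nonneg (c 2)]
  have h6 : c 2 = 0 := by nlinarith [mul_self_nonneg (c 0), mul_self_nonneg (c 1), mul_self_nonneg (c 2)]
  ext i; fin_cases i <;> simp [h4, h5, h6]

/-- A quaternionic triple is linearly independent, so its span has dimension three, the largest
possible for the span of `A`. -/
theorem IsQuaternionicTriple.span_eq [Nontrivial F] {A' : Fin 3 → F →L[ℝ] F}
    (h' : IsQuaternionicTriple A')
    (hle : ∀ i, A' i ∈ Submodule.span ℝ (range A)) :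
    Submodule.span ℝ (range A') = Submodule.span ℝ (range A) := by
  have : FiniteDimensional ℝ (Submodule.span ℝ (range A)) :=
    FiniteDimensional.span_of_finite ℝ (finite_range A)
  refine Submodule.eq_of_le_of_finrank_le (Submodule.span_le.2 (range_subset_iff.2 hle)) ?_
  have hli : LinearIndependent ℝ A' := by
    rw [Fintype.linearIndependent_iff]
    intro c hc
    have : tripleL A' c = 0 := by rw [tripleL_apply, ← hc, Fin.sum_univ_three]
    have h0 := h'.injective_tripleL (this.trans (map_zero _).symm)
    intro i; rw [h0]; rfl
  rw [finrank_span_eq_card hli]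
  exact finrank_range_le_card A

theorem ContDiffOn.tripleL {X : Type*} [NormedAddCommGroup X] [NormedSpace ℝ X]
    {A : Fin 3 → X → F →L[ℝ] F} {O : Set X} (hA : ∀ i, ContDiffOn ℝ ∞ (A i) O) :
    ContDiffOn ℝ ∞ (fun x ↦ tripleL fun i ↦ A i x) O := by
  refine ContDiffOn.sum fun i _ ↦ ?_
  exact (ContinuousLinearMap.smulRightL ℝ (Fin 3 → ℝ) (F →L[ℝ] F)
    (ContinuousLinearMap.proj i)).contDiff.comp_contDiffOn (hA i)

theorem hasFDerivAt_tripleL {X : Type*} [NormedAddCommGroup X] [NormedSpace ℝ X]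
    {A : Fin 3 → X → F →L[ℝ] F} {x : X} (hA : ∀ i, DifferentiableAt ℝ (A i) x) (u : X)
    (c : Fin 3 → ℝ) :
    fderiv ℝ (fun x ↦ tripleL fun i ↦ A i x) x u c =
      tripleL (fun i ↦ fderiv ℝ (A i) x u) c := by
  have h1 : HasFDerivAt (fun x ↦ tripleL fun i ↦ A i x)
      (∑ i, (ContinuousLinearMap.smulRightL ℝ (Fin 3 → ℝ) (F →L[ℝ] F)
        (ContinuousLinearMap.proj i)) ∘L fderiv ℝ (A i) x) x := by
    refine HasFDerivAt.fun_sum fun i _ ↦ ?_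
    exact (ContinuousLinearMap.smulRightL ℝ (Fin 3 → ℝ) (F →L[ℝ] F)
      (ContinuousLinearMap.proj i)).hasFDerivAt.comp x (hA i).hasFDerivAt
  rw [h1.fderiv, tripleL_apply]
  simp [Fin.sum_univ_three]

end Triple

/-! ### The induced connection on endomorphisms -/

section AdConnection

variable {X F : Type*} [NormedAddCommGroup X] [NormedSpace ℝ X]
  [NormedAddCommGroup F] [NormedSpace ℝ F]

/-- The bracket of endomorphisms, as a bilinear map. -/
def bracketL (F : Type*) [NormedAddCommGroup F] [NormedSpace ℝ F] :
    (F →L[ℝ] F) →L[ℝ] (F →L[ℝ] F) →L[ℝ] F →L[ℝ] F :=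
  ContinuousLinearMap.compL ℝ F F F - (ContinuousLinearMap.compL ℝ F F F).flip

theorem bracketL_apply (S T : F →L[ℝ] F) (e : F) : bracketL F S T e = S (T e) - T (S e) := rfl

/-- The connection form induced on the endomorphism bundle. -/
def adConnection (Γ : X → X →L[ℝ] F →L[ℝ] F) (x : X) : X →L[ℝ] (F →L[ℝ] F) →L[ℝ] F →L[ℝ] F :=
  bracketL F ∘L Γ x

theorem adConnection_apply (Γ : X → X →L[ℝ] F →L[ℝ] F) (x u : X) (T : F →L[ℝ] F) (e : F) :
    adConnection Γ x u T e = Γ x u (T e) - T (Γ x u e) := rfl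

theorem ContDiffOn.adConnection {Γ : X → X →L[ℝ] F →L[ℝ] F} {O : Set X}
    (hΓ : ContDiffOn ℝ ∞ Γ O) : ContDiffOn ℝ ∞ (adConnection Γ) O :=
  contDiffOn_const.clm_comp hΓ

/-- The curvature on endomorphisms is the commutator with the curvature. Thus, when the curvature
commutes with the quaternionic structure, `Q` is a flat subbundle of the endomorphism bundle. -/
theorem connectionCurvature_adConnection {Γ : X → X →L[ℝ] F →L[ℝ] F} {x : X}
    (hΓ : DifferentiableAt ℝ Γ x) (u v : X) (T : F →L[ℝ] F) (e : F) :
    connectionCurvature (adConnection Γ) x u v T e =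
      connectionCurvature Γ x u v (T e) - T (connectionCurvature Γ x u v e) := by
  have h1 : ∀ u v T e, fderiv ℝ (adConnection Γ) x u v T e =
      fderiv ℝ Γ x u v (T e) - T (fderiv ℝ Γ x u v e) := by
    intro u v T e
    have h2 := (hasFDerivAt_const (bracketL F) x).clm_comp hΓ.hasFDerivAt
    have h3 : fderiv ℝ (adConnection Γ) x = _ := h2.fderiv
    rw [h3]
    simp [bracketL_apply]
  rw [connectionCurvature_apply]
  simp only [connectionCurvature_apply, add_apply, sub_apply, h1, adConnection_apply, map_add,
    map_sub]
  abel

end AdConnection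

/-! ### The local structure on an open set of a vector space, and its parallel frames -/

section Adapted

variable {X : Type} [NormedAddCommGroup X] [NormedSpace ℝ X]
  {F : Type*} [NormedAddCommGroup F] [NormedSpace ℝ F] {l : ℕ}

/-- Local frames of an almost `f`-quaternionic structure, on an open subset of a vector space: `ι` is
the inclusion of the tangent bundle, `s` a frame of `V` and `A` a quaternionic frame. -/
structure IsAdaptedFrame (O : Set X) (ι : X → X →L[ℝ] F) (s : X → (Fin l → ℝ) →L[ℝ] F)
    (A : Fin 3 → X → F →L[ℝ] F) : Prop where
  isOpen : IsOpen O
  contDiffOn_ι : ContDiffOn ℝ ∞ ι O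
  contDiffOn_s : ContDiffOn ℝ ∞ s O
  contDiffOn_A : ∀ i, ContDiffOn ℝ ∞ (A i) O
  triple : ∀ x ∈ O, IsQuaternionicTriple fun i ↦ A i x
  injective_ι : ∀ x ∈ O, Function.Injective (ι x)
  injective_s : ∀ x ∈ O, Function.Injective (s x)
  isCompl : ∀ x ∈ O, IsCompl (LinearMap.range (s x).toLinearMap) (LinearMap.range (ι x).toLinearMap)
  map_s : ∀ x ∈ O, ∀ i k, ∃ w, A i x (s x k) = ι x w

/-- A torsion free connection `d + Γ` compatible with an almost `f`-quaternionic structure. -/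
structure IsAdaptedConnection (O : Set X) (Γ : X → X →L[ℝ] F →L[ℝ] F) (ι : X → X →L[ℝ] F)
    (s : X → (Fin l → ℝ) →L[ℝ] F) (A : Fin 3 → X → F →L[ℝ] F) : Prop
    extends IsAdaptedFrame O ι s A where
  contDiffOn_Γ : ContDiffOn ℝ ∞ Γ O
  torsion : ∀ x ∈ O, ∀ u v, fderiv ℝ ι x u v + Γ x u (ι x v) = fderiv ℝ ι x v u + Γ x v (ι x u)
  preserves_ι : ∀ x ∈ O, ∀ u v, ∃ w, fderiv ℝ ι x u v + Γ x u (ι x v) = ι x w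
  preserves_s : ∀ x ∈ O, ∀ u k, ∃ k', fderiv ℝ s x u k + Γ x u (s x k) = s x k'
  preserves_A : ∀ x ∈ O, ∀ i u, ∃ T ∈ Submodule.span ℝ (range fun i ↦ A i x), ∀ e,
    fderiv ℝ (A i) x u e + Γ x u (A i x e) - A i x (Γ x u e) = T e

/-- An adapted connection for which the frames of `V` and `Q` are parallel. -/
structure IsParallelFrame (O : Set X) (Γ : X → X →L[ℝ] F →L[ℝ] F) (ι : X → X →L[ℝ] F)
    (s : X → (Fin l → ℝ) →L[ℝ] F) (A : Fin 3 → X → F →L[ℝ] F) : Prop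
    extends IsAdaptedFrame O ι s A where
  contDiffOn_Γ : ContDiffOn ℝ ∞ Γ O
  torsion : ∀ x ∈ O, ∀ u v, fderiv ℝ ι x u v + Γ x u (ι x v) = fderiv ℝ ι x v u + Γ x v (ι x u)
  preserves_ι : ∀ x ∈ O, ∀ u v, ∃ w, fderiv ℝ ι x u v + Γ x u (ι x v) = ι x w
  parallel_s : ∀ x ∈ O, ∀ u k, fderiv ℝ s x u k = -Γ x u (s x k)
  parallel_A : ∀ x ∈ O, ∀ i u e, fderiv ℝ (A i) x u e = A i x (Γ x u e) - Γ x u (A i x e)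

variable {O : Set X} {Γ : X → X →L[ℝ] F →L[ℝ] F} {ι : X → X →L[ℝ] F}
    {s : X → (Fin l → ℝ) →L[ℝ] F} {A : Fin 3 → X → F →L[ℝ] F}

theorem IsAdaptedFrame.mono (h : IsAdaptedFrame O ι s A) {O' : Set X} (hO' : IsOpen O')
    (hO : O' ⊆ O) : IsAdaptedFrame O' ι s A where
  isOpen := hO'
  contDiffOn_ι := h.contDiffOn_ι.mono hO
  contDiffOn_s := h.contDiffOn_s.mono hO
  contDiffOn_A i := (h.contDiffOn_A i).mono hO
  triple x hx := h.triple x (hO hx)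
  injective_ι x hx := h.injective_ι x (hO hx)
  injective_s x hx := h.injective_s x (hO hx)
  isCompl x hx := h.isCompl x (hO hx)
  map_s x hx := h.map_s x (hO hx)

theorem IsParallelFrame.mono (h : IsParallelFrame O Γ ι s A) {O' : Set X} (hO' : IsOpen O')
    (hO : O' ⊆ O) : IsParallelFrame O' Γ ι s A where
  toIsAdaptedFrame := h.toIsAdaptedFrame.mono hO' hO
  contDiffOn_Γ := h.contDiffOn_Γ.mono hO
  torsion x hx := h.torsion x (hO hx)
  preserves_ι x hx := h.preserves_ι x (hO hx)
  parallel_s x hx := h.parallel_s x (hO hx)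
  parallel_A x hx := h.parallel_A x (hO hx)

theorem IsAdaptedFrame.exists_add (h : IsAdaptedFrame O ι s A) {x : X} (hx : x ∈ O) (e : F) :
    ∃ k w, e = s x k + ι x w := by
  obtain ⟨-, ⟨k, rfl⟩, -, ⟨w, rfl⟩, hkw⟩ :=
    Submodule.mem_sup.1 ((h.isCompl x hx).sup_eq_top ▸ Submodule.mem_top (x := e))
  exact ⟨k, w, hkw.symm⟩

theorem IsAdaptedFrame.eq_zero_of_eq (h : IsAdaptedFrame O ι s A) {x : X} (hx : x ∈ O)
    {k : Fin l → ℝ} {w : X} (hkw : s x k = ι x w) : s x k = 0 := by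
  have := (h.isCompl x hx).disjoint
  rw [Submodule.disjoint_def] at this
  exact this _ ⟨k, rfl⟩ ⟨w, hkw.symm⟩

/-- The projections of `E` to `V` and `TM` in an adapted frame. -/
theorem IsAdaptedFrame.exists_projections [FiniteDimensional ℝ X] [FiniteDimensional ℝ F]
    (h : IsAdaptedFrame O ι s A) {x₀ : X} (hx₀ : x₀ ∈ O) :
    ∃ (O' : Set X) (η : X → F →L[ℝ] (Fin l → ℝ)) (p : X → F →L[ℝ] X), IsOpen O' ∧ x₀ ∈ O' ∧
      O' ⊆ O ∧ ContDiffOn ℝ ∞ η O' ∧ ContDiffOn ℝ ∞ p O' ∧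
      ∀ x ∈ O', (∀ k, η x (s x k) = k) ∧ (∀ w, η x (ι x w) = 0) ∧ (∀ k, p x (s x k) = 0) ∧
        (∀ w, p x (ι x w) = w) ∧ ∀ e, e = s x (η x e) + ι x (p x e) := by
  let T : X → ((Fin l → ℝ) × X) →L[ℝ] F := fun x ↦
    s x ∘L ContinuousLinearMap.fst ℝ _ _ + ι x ∘L ContinuousLinearMap.snd ℝ _ _
  have hT : ContDiffOn ℝ ∞ T O := (h.contDiffOn_s.clm_comp contDiffOn_const).add
    (h.contDiffOn_ι.clm_comp contDiffOn_const)
  have hTa : ∀ x k w, T x (k, w) = s x k + ι x w := fun x k w ↦ rfl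
  have hinj : Function.Injective (T x₀) := by
    rw [injective_iff_map_eq_zero]
    rintro ⟨k, w⟩ hkw
    rw [hTa, ← eq_neg_iff_add_eq_zero, ← map_neg] at hkw
    have h1 := h.eq_zero_of_eq hx₀ hkw
    have h2 : k = 0 := h.injective_s x₀ hx₀ (h1.trans (map_zero _).symm)
    rw [h1, map_neg, eq_comm, neg_eq_zero] at hkw
    have h3 : w = 0 := h.injective_ι x₀ hx₀ (hkw.trans (map_zero _).symm)
    rw [h2, h3]; rfl
  obtain ⟨O', Λ, hO', hx₀', hO'O, hΛ, hΛT⟩ := hT.exists_leftInverse h.isOpen hx₀ hinj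
  have hs : ∀ x ∈ O', ∀ k, Λ x (s x k) = (k, 0) := fun x hx k ↦ by
    have := hΛT x hx (k, 0)
    rwa [hTa, map_zero, add_zero] at this
  have hι : ∀ x ∈ O', ∀ w, Λ x (ι x w) = (0, w) := fun x hx w ↦ by
    have := hΛT x hx (0, w)
    rwa [hTa, map_zero, zero_add] at this
  refine ⟨O', fun x ↦ ContinuousLinearMap.fst ℝ _ _ ∘L Λ x,
    fun x ↦ ContinuousLinearMap.snd ℝ _ _ ∘L Λ x, hO', hx₀', hO'O,
    contDiffOn_const.clm_comp hΛ, contDiffOn_const.clm_comp hΛ, fun x hx ↦ ⟨?_, ?_, ?_, ?_, ?_⟩⟩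
  · intro k; simp [hs x hx]
  · intro k; simp [hι x hx]
  · intro k; simp [hs x hx]
  · intro k; simp [hι x hx]
  · intro e
    obtain ⟨k, w, rfl⟩ := h.exists_add (hO'O hx) e
    simp [hs x hx, hι x hx]

theorem IsAdaptedConnection.differentiableAt (h : IsAdaptedConnection O Γ ι s A) {x : X}
    (hx : x ∈ O) (i : Fin 3) : DifferentiableAt ℝ (A i) x :=
  ((h.contDiffOn_A i).contDiffAt (h.isOpen.mem_nhds hx)).differentiableAt (by simp)

/-- Linearity in the frame coefficients puts the invariance of `Q` into the form required by
`exists_inducedConnectionForm` and `exists_parallel_frame`. -/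
theorem IsAdaptedConnection.preserves_tripleL (h : IsAdaptedConnection O Γ ι s A) {x : X}
    (hx : x ∈ O) (u : X) (c : Fin 3 → ℝ) :
    ∃ c', fderiv ℝ (fun x ↦ tripleL fun i ↦ A i x) x u c +
      adConnection Γ x u (tripleL (fun i ↦ A i x) c) = tripleL (fun i ↦ A i x) c' := by
  refine exists_tripleL_of_mem_span ?_
  choose T hT hTe using fun i ↦ h.preserves_A x hx i u
  have : fderiv ℝ (fun x ↦ tripleL fun i ↦ A i x) x u c +
      adConnection Γ x u (tripleL (fun i ↦ A i x) c) = tripleL T c := by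
    rw [hasFDerivAt_tripleL (h.differentiableAt hx)]
    ext e
    simp only [tripleL_apply, add_apply, smul_apply, adConnection_apply, map_add, map_smul,
      ← hTe]
    module
  rw [this, tripleL_apply]
  exact add_mem (add_mem (Submodule.smul_mem _ _ (hT 0)) (Submodule.smul_mem _ _ (hT 1)))
    (Submodule.smul_mem _ _ (hT 2))

/-- A derivation of the span of a quaternionic triple is inner. -/
theorem IsQuaternionicTriple.exists_derivation_coeff [Nontrivial F] {A : Fin 3 → F →L[ℝ] F}
    (h : IsQuaternionicTriple A) {R : F →L[ℝ] F}
    (hR : ∀ i, ∃ c, ∀ e, R (A i e) - A i (R e) = tripleL A c e) :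
    ∃ a b c : ℝ, ∀ e, R (A 0 e) = A 0 (R e) + c • A 1 e - b • A 2 e ∧
      R (A 1 e) = A 1 (R e) + a • A 2 e - c • A 0 e ∧
      R (A 2 e) = A 2 (R e) + b • A 0 e - a • A 1 e := by
  choose c hc using hR
  have h0 : ∀ e, R (A 0 e) = A 0 (R e) + (c 0 0 • A 0 e + c 0 1 • A 1 e + c 0 2 • A 2 e) := by
    intro e
    have := hc 0 e
    rw [sub_eq_iff_eq_add'] at this
    simpa [tripleL_apply] using this
  have h1 : ∀ e, R (A 1 e) = A 1 (R e) + (c 1 0 • A 0 e + c 1 1 • A 1 e + c 1 2 • A 2 e) := by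
    intro e
    have := hc 1 e
    rw [sub_eq_iff_eq_add'] at this
    simpa [tripleL_apply] using this
  obtain ⟨e₀, he₀⟩ := exists_ne (0 : F)
  -- The commutator with `R` is a derivation. Applied to `A 0 ∘ A 0 = -1` it kills the diagonal
  -- coefficient, and likewise for `A 1`.
  have k0 : c 0 0 = 0 := by
    have := h0 (A 0 e₀)
    simp only [h0, h.apply_00, h.apply_10, h.apply_20, map_neg, map_add, map_smul, h.apply_01,
      h.apply_02] at this
    have h2 : (2 * c 0 0) • e₀ = 0 := by
      rw [← sub_eq_zero] at this; rw [← neg_eq_zero, ← neg_eq_zero, ← this]; module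
    simpa [he₀] using h2
  have k1 : c 1 1 = 0 := by
    have := h1 (A 1 e₀)
    simp only [h1, h.apply_11, h.apply_10, h.apply_21, map_neg, map_add, map_smul, h.apply_01,
      h.apply_12] at this
    have h2 : (2 * c 1 1) • e₀ = 0 := by
      rw [← sub_eq_zero] at this; rw [← neg_eq_zero, ← neg_eq_zero, ← this]; module
    simpa [he₀] using h2
  -- The derivation applied to `A 0 ∘ A 1 + A 1 ∘ A 0 = 0` gives antisymmetry. The row of `A 2`
  -- needs no separate treatment, since `A 2 = A 0 ∘ A 1`.
  have k2 : c 1 0 = -c 0 1 := by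
    have e1 := h0 (A 1 e₀)
    have e2 := h1 (A 0 e₀)
    rw [h.apply_01, h1] at e1
    rw [h.apply_10, map_neg, h0] at e2
    have := congrArg₂ (· + ·) e1 e2
    simp only [k0, k1, h.apply_11, h.apply_20, h.apply_21, h.apply_00, h.apply_01, h.apply_10,
      h.apply_02, h.apply_12, map_add, map_smul, zero_smul, add_zero, zero_add, add_neg_cancel]
      at this
    have h2 : (c 1 0 + c 0 1) • e₀ = 0 := by
      have h3 : (2 : ℝ) • ((c 1 0 + c 0 1) • e₀) = 0 := by
        rw [← sub_eq_zero] at this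
        rw [← this]; module
      simpa using h3
    have := (smul_eq_zero.1 h2).resolve_right he₀
    linarith
  refine ⟨c 1 2, -c 0 2, c 0 1, fun e ↦ ⟨?_, ?_, ?_⟩⟩
  · rw [h0, k0]; module
  · rw [h1, k1, k2]; module
  · rw [← h.apply_01 e, h0, h1, k0, k1, k2]
    simp only [map_add, map_smul, h.apply_00, h.apply_01, h.apply_02, h.apply_11, h.apply_21]
    module

/-- The curvature of an adapted connection has the algebraic properties collected in
`IsFQuaternionicCurvature`. -/
theorem IsAdaptedConnection.isFQuaternionicCurvature [FiniteDimensional ℝ X]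
    [FiniteDimensional ℝ F] [Nontrivial F] (h : IsAdaptedConnection O Γ ι s A) {x : X}
    (hx : x ∈ O) :
    IsFQuaternionicCurvature (ι x : X →ₗ[ℝ] F) (LinearMap.range (s x).toLinearMap)
      (A 0 x : F →ₗ[ℝ] F) (A 1 x : F →ₗ[ℝ] F) (A 2 x : F →ₗ[ℝ] F)
      (fun u v ↦ (connectionCurvature Γ x u v : F →ₗ[ℝ] F)) := by
  have ht := h.triple x hx
  -- The forms `γ₁`, `γ₂`, `γ₃` are those induced on the tangent bundle, on `V` and on `Q`. The
  -- curvature restricts to their curvatures, hence preserves these subbundles.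
  obtain ⟨O₁, γ₁, hO₁, hx₁, hO₁O, hγ₁, hι⟩ := exists_inducedConnectionForm h.isOpen h.contDiffOn_Γ
    h.contDiffOn_ι hx (h.injective_ι x hx) h.preserves_ι
  have Cι := apply_connectionCurvature hO₁ (h.contDiffOn_Γ.mono hO₁O) (h.contDiffOn_ι.mono hO₁O)
    hγ₁ hι hx₁
  obtain ⟨O₂, γ₂, hO₂, hx₂, hO₂O, hγ₂, hs⟩ := exists_inducedConnectionForm h.isOpen h.contDiffOn_Γ
    h.contDiffOn_s hx (h.injective_s x hx) h.preserves_s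
  have Cs := apply_connectionCurvature hO₂ (h.contDiffOn_Γ.mono hO₂O) (h.contDiffOn_s.mono hO₂O)
    hγ₂ hs hx₂
  have hA := ContDiffOn.tripleL h.contDiffOn_A
  obtain ⟨O₃, γ₃, hO₃, hx₃, hO₃O, hγ₃, hq⟩ := exists_inducedConnectionForm h.isOpen
    h.contDiffOn_Γ.adConnection hA hx ht.injective_tripleL (fun x hx ↦ h.preserves_tripleL hx)
  have CA := apply_connectionCurvature hO₃ (h.contDiffOn_Γ.adConnection.mono hO₃O)
    (hA.mono hO₃O) hγ₃ hq hx₃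
  have hΓd : DifferentiableAt ℝ Γ x :=
    (h.contDiffOn_Γ.contDiffAt (h.isOpen.mem_nhds hx)).differentiableAt (by simp)
  -- Torsion freeness is the symmetry of the Christoffel form `γ₁`. Together with the symmetry of
  -- its derivatives it gives the Bianchi identity.
  have hγsymm : ∀ y ∈ O₁, ∀ u v, γ₁ y u v = γ₁ y v u := fun y hy u v ↦
    h.injective_ι y (hO₁O hy) (by rw [← hι y hy, ← hι y hy, h.torsion y (hO₁O hy)])
  have hγd : HasFDerivAt γ₁ (fderiv ℝ γ₁ x) x :=
    ((hγ₁.contDiffAt (hO₁.mem_nhds hx₁)).differentiableAt (by simp)).hasFDerivAt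
  have hdsymm : ∀ w u v, fderiv ℝ γ₁ x w u v = fderiv ℝ γ₁ x w v u := by
    intro w u v
    have e1 := (hγd.clm_apply (hasFDerivAt_const u x)).clm_apply (hasFDerivAt_const v x)
    have e2 := (hγd.clm_apply (hasFDerivAt_const v x)).clm_apply (hasFDerivAt_const u x)
    have e3 : (fun y ↦ γ₁ y u v) =ᶠ[𝓝 x] fun y ↦ γ₁ y v u := by
      filter_upwards [hO₁.mem_nhds hx₁] with y hy
      exact hγsymm y hy u v
    have e4 := congrArg (fun T : X →L[ℝ] X ↦ T w) ((e1.congr_of_eventuallyEq e3.symm).unique e2)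
    simpa using e4
  exact
  { II := ht.apply_00
    JJ := ht.apply_11
    KK := ht.apply_22
    IJ := ht.apply_01
    JK := ht.apply_12
    KI := ht.apply_20
    JI := ht.apply_10
    KJ := ht.apply_21
    IK := ht.apply_02
    eq_zero_of_mem := by
      rintro - ⟨k, rfl⟩ w hw
      exact h.eq_zero_of_eq hx hw
    exists_add := fun e ↦ by
      obtain ⟨k, w, he⟩ := h.exists_add hx e
      exact ⟨_, ⟨k, rfl⟩, w, he⟩
    IV := by rintro - ⟨k, rfl⟩; exact h.map_s x hx 0 k
    JV := by rintro - ⟨k, rfl⟩; exact h.map_s x hx 1 k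
    KV := by rintro - ⟨k, rfl⟩; exact h.map_s x hx 2 k
    add_left := fun u u' v e ↦ congrArg (fun T : F →L[ℝ] F ↦ T e)
      (connectionCurvature_add_left Γ x u u' v)
    swap := fun u v e ↦ congrArg (fun T : F →L[ℝ] F ↦ T e) (connectionCurvature_swap Γ x u v)
    RV := by
      rintro u v - ⟨k, rfl⟩
      exact ⟨_, Cs u v k⟩
    RT := fun u v w ↦ ⟨_, (Cι u v w).symm⟩
    RQ := fun u v ↦ by
      refine ht.exists_derivation_coeff fun i ↦
        ⟨connectionCurvature γ₃ x u v (Pi.single i 1), fun e ↦ ?_⟩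
      rw [CA, connectionCurvature_adConnection hΓd, tripleL_single]
    bianchi := fun u v w ↦ by
      change connectionCurvature Γ x u v (ι x w) + connectionCurvature Γ x v w (ι x u) +
        connectionCurvature Γ x w u (ι x v) = 0
      rw [← Cι, ← Cι, ← Cι, ← map_add, ← map_add]
      convert map_zero (ι x)
      simp only [connectionCurvature_apply]
      rw [hdsymm u v w, hdsymm v w u, hdsymm w u v, hγsymm x hx₁ v w, hγsymm x hx₁ w u,
        hγsymm x hx₁ u v]
      abel }

/-- The curvature of an adapted connection vanishes on `V` and on `Q`. -/
theorem IsAdaptedConnection.curvature_eq_zero [FiniteDimensional ℝ X]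
    [FiniteDimensional ℝ F] (h : IsAdaptedConnection O Γ ι s A) {x : X}
    (hx : x ∈ O) (hrank : 4 * l < finrank ℝ F) (hl : 2 ≤ l) (u v : X) :
    (∀ k, connectionCurvature Γ x u v (s x k) = 0) ∧
      ∀ i e, connectionCurvature Γ x u v (A i x e) = A i x (connectionCurvature Γ x u v e) := by
  have : Nontrivial F := nontrivial_of_finrank_pos (R := ℝ) (by omega)
  obtain ⟨O₁, η, p, -, hx₁, -, -, -, hηp⟩ := h.exists_projections hx
  obtain ⟨hηs, hηι, -, -, he⟩ := hηp x hx₁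
  have hmem : ∀ e, η x e = 0 → e ∈ LinearMap.range (ι x).toLinearMap := fun e h0 ↦
    ⟨p x e, by conv_rhs => rw [he e, h0, map_zero, zero_add]
               rfl⟩
  -- The kernel consists of the `e` for which `e`, `A 0 e`, `A 1 e`, `A 2 e` have no component in
  -- `V`, that is, of the largest quaternionic tangent subspace. The target has dimension `4 l`,
  -- less than that of `F`.
  let L : F →ₗ[ℝ] (Fin 4 → Fin l → ℝ) := LinearMap.pi
    ![(η x).toLinearMap, (η x ∘L A 0 x).toLinearMap, (η x ∘L A 1 x).toLinearMap,
      (η x ∘L A 2 x).toLinearMap]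
  have hL := L.ker_ne_bot_of_finrank_lt (by rw [finrank_pi_fintype]; simpa using hrank)
  obtain ⟨e₀, he₀, he₀'⟩ := Submodule.exists_mem_ne_zero_of_ne_bot hL
  rw [LinearMap.mem_ker] at he₀
  have hq : IsFQuaternionicCurvature.IsQuatTangent (ι x).toLinearMap (A 0 x : F →ₗ[ℝ] F)
      (A 1 x : F →ₗ[ℝ] F) (A 2 x : F →ₗ[ℝ] F) e₀ :=
    ⟨hmem _ (congrFun he₀ 0), hmem _ (congrFun he₀ 1), hmem _ (congrFun he₀ 2),
      hmem _ (congrFun he₀ 3)⟩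
  obtain ⟨w₀, hw₀⟩ := hq.1
  have : Nontrivial (Fin l) := Fin.nontrivial_iff_two_le.2 hl
  obtain ⟨i₀⟩ : Nonempty (Fin l) := inferInstance
  have := (h.isFQuaternionicCurvature hx).isTrivialAt ?_ (h.injective_ι x hx)
    (z₀ := s x (Pi.single i₀ 1)) ⟨_, rfl⟩ ?_ (w₀ := w₀) (by rw [hw₀]; exact hq)
    (by rw [hw₀]; exact he₀') u v
  · refine ⟨fun k ↦ this.1 _ ⟨k, rfl⟩, fun i e ↦ ?_⟩
    fin_cases i
    · exact (this.2 e).1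
    · exact (this.2 e).2.1
    · exact (this.2 e).2.2
  -- The independent partner of `s x k` comes from a basis vector `j` other than an index `i` with
  -- `k i ≠ 0`; it exists because `2 ≤ l`.
  · rintro - ⟨k, rfl⟩ hk
    have hk0 : k ≠ 0 := by rintro rfl; exact hk (map_zero _)
    obtain ⟨i, hi⟩ := Function.ne_iff.1 hk0
    obtain ⟨j, hj⟩ := exists_ne i
    refine ⟨s x (Pi.single j 1), ⟨_, rfl⟩, fun a t hat ↦ ?_⟩
    have h1 : a • Pi.single j 1 = t • k := h.injective_s x hx (by simpa using hat)
    have h2 := congrFun h1 i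
    have h3 := congrFun h1 j
    simp [hj.symm] at h2 h3
    have ht : t = 0 := h2.resolve_right hi
    simpa [ht] using h3
  · intro h0
    have := h.injective_s x hx (h0.trans (map_zero _).symm)
    simpa using congrFun this i₀

/-- Near any point, an adapted connection admits parallel frames of `V` and `Q`. -/
theorem IsAdaptedConnection.exists_isParallelFrame [FiniteDimensional ℝ X]
    [FiniteDimensional ℝ F] (h : IsAdaptedConnection O Γ ι s A) {x₀ : X}
    (hx₀ : x₀ ∈ O) (hrank : 4 * l < finrank ℝ F) (hl : 2 ≤ l) :
    ∃ (O' : Set X) (s' : X → (Fin l → ℝ) →L[ℝ] F) (A' : Fin 3 → X → F →L[ℝ] F), x₀ ∈ O' ∧ O' ⊆ O ∧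
      IsParallelFrame O' Γ ι s' A' ∧
      (∀ x ∈ O', LinearMap.range (s' x).toLinearMap = LinearMap.range (s x).toLinearMap) ∧
      ∀ x ∈ O', Submodule.span ℝ (range fun i ↦ A' i x) = Submodule.span ℝ (range fun i ↦ A i x) := by
  have : Nontrivial F := nontrivial_of_finrank_pos (R := ℝ) (by omega)
  obtain ⟨O₁, s', hO₁, hx₁, hO₁O, hs', -, hs's, hps⟩ := exists_parallel_frame h.isOpen h.contDiffOn_Γ
    h.contDiffOn_s hx₀ h.injective_s h.preserves_s
    (fun x hx u v ↦ (h.curvature_eq_zero hx hrank hl u v).1)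
  -- The same construction for `Q`, viewed as a subbundle of the endomorphism bundle with its
  -- induced connection.
  obtain ⟨O₂, σ, hO₂, hx₂, hO₂O, hσ, hσ0, hσq, hpσ⟩ := exists_parallel_frame h.isOpen
    h.contDiffOn_Γ.adConnection (ContDiffOn.tripleL h.contDiffOn_A) hx₀
    (fun x hx ↦ (h.triple x hx).injective_tripleL) (fun x hx ↦ h.preserves_tripleL hx)
    (fun x hx u v c ↦ by
      ext e
      have hΓd : DifferentiableAt ℝ Γ x :=
        (h.contDiffOn_Γ.contDiffAt (h.isOpen.mem_nhds hx)).differentiableAt (by simp)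
      have := (h.curvature_eq_zero hx hrank hl u v).2
      rw [connectionCurvature_adConnection hΓd]
      simp only [tripleL_apply, add_apply, smul_apply, map_add, map_smul, this, sub_self,
        zero_apply])
  have hO₁₂ : IsOpen (O₁ ∩ O₂) := hO₁.inter hO₂
  -- A ball is connected, which will turn vanishing derivatives into constancy.
  obtain ⟨r, hr, hball⟩ := Metric.isOpen_iff.1 hO₁₂ x₀ ⟨hx₁, hx₂⟩
  set O' := Metric.ball x₀ r
  have hO' : IsOpen O' := Metric.isOpen_ball
  have hx' : x₀ ∈ O' := Metric.mem_ball_self hr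
  have m1 : O' ⊆ O₁ := fun x hx ↦ (hball hx).1
  have m2 : O' ⊆ O₂ := fun x hx ↦ (hball hx).2
  have m : O' ⊆ O := m1.trans hO₁O
  have hσd : ∀ x ∈ O', ∀ c, HasFDerivAt (fun x ↦ σ x c) ((fderiv ℝ σ x).flip c) x := by
    intro x hx c
    have h1 : HasFDerivAt σ (fderiv ℝ σ x) x :=
      ((hσ.contDiffAt (hO₂.mem_nhds (m2 hx))).differentiableAt (by simp)).hasFDerivAt
    exact (h1.clm_apply (hasFDerivAt_const c x)).congr_fderiv (by ext; simp)
  have hσpar : ∀ x ∈ O', ∀ u c e, fderiv ℝ σ x u c e = σ x c (Γ x u e) - Γ x u (σ x c e) := by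
    intro x hx u c e
    rw [hpσ x (m2 hx), neg_apply, adConnection_apply, neg_sub]
  -- Anticommutators of elements of `Q` are scalars, by the multiplication rule for imaginary
  -- quaternions.
  have hsc : ∀ x ∈ O', ∀ a b, ∃ r : ℝ, ∀ e, σ x a (σ x b e) + σ x b (σ x a e) = r • e := by
    intro x hx a b
    obtain ⟨g, hg⟩ := hσq x (m2 hx)
    refine ⟨-2 * (g a 0 * g b 0 + g a 1 * g b 1 + g a 2 * g b 2), fun e ↦ ?_⟩
    have h1 := (h.triple x (m hx)).tripleL_comp (g a) (g b) e
    have h2 := (h.triple x (m hx)).tripleL_comp (g b) (g a) e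
    rw [hg]
    simp only [ContinuousLinearMap.comp_apply, ContinuousLinearEquiv.coe_coe, h1, h2]
    rw [tripleL_apply, tripleL_apply]
    simp only [add_apply, smul_apply, Matrix.cons_val_zero, Matrix.cons_val_one, Matrix.cons_val]
    module
  -- The derivative of an anticommutator of parallel sections is its commutator with `Γ`, which is
  -- zero for a scalar. The quaternionic relations thus propagate from `x₀`.
  have hconst : ∀ x ∈ O', ∀ a b, σ x a ∘L σ x b + σ x b ∘L σ x a =
      σ x₀ a ∘L σ x₀ b + σ x₀ b ∘L σ x₀ a := by
    intro x hx a b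
    have hd : ∀ x ∈ O', HasFDerivAt (fun x ↦ σ x a ∘L σ x b + σ x b ∘L σ x a)
        (0 : X →L[ℝ] F →L[ℝ] F) x := by
      intro x hx
      refine (((hσd x hx a).clm_comp (hσd x hx b)).add
        ((hσd x hx b).clm_comp (hσd x hx a))).congr_fderiv ?_
      ext u e
      obtain ⟨r, hr⟩ := hsc x hx a b
      have e1 := hr e
      have e2 := hr (Γ x u e)
      have e3 := congrArg (Γ x u) e1
      rw [map_smul, ← e2, map_add] at e3
      simp only [add_apply, ContinuousLinearMap.comp_apply, ContinuousLinearMap.compL_apply,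
        ContinuousLinearMap.flip_apply, hσpar x hx, map_sub, zero_apply]
      rw [← sub_eq_zero] at e3
      rw [← neg_eq_zero, ← e3]
      abel
    refine hO'.is_const_of_fderiv_eq_zero (𝕜 := ℝ) (convex_ball x₀ r).isPreconnected
      (f := fun x ↦ σ x a ∘L σ x b + σ x b ∘L σ x a)
      (fun y hy ↦ (hd y hy).differentiableAt.differentiableWithinAt) (fun y hy ↦ (hd y hy).fderiv)
      hx hx'
  have hσ0' : ∀ i, σ x₀ (Pi.single i 1) = A i x₀ := fun i ↦ by rw [hσ0, tripleL_single]
  have ht₀ := h.triple x₀ hx₀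
  -- The third unit is taken to be the product of the first two rather than the third parallel
  -- section, so that only squares and anticommutators have to be controlled.
  let A' : Fin 3 → X → F →L[ℝ] F := ![fun x ↦ σ x (Pi.single 0 1), fun x ↦ σ x (Pi.single 1 1),
    fun x ↦ σ x (Pi.single 0 1) ∘L σ x (Pi.single 1 1)]
  have half : ∀ {e f : F}, e + e = -f + -f → e = -f := fun {e f} hef ↦ by
    have : (2 : ℝ) • e = (2 : ℝ) • (-f) := by rw [two_smul, two_smul, hef]
    exact smul_right_injective F two_ne_zero this
  have htriple : ∀ x ∈ O', IsQuaternionicTriple fun i ↦ A' i x := by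
    intro x hx
    refine ⟨?_, ?_, rfl, ?_⟩
    · ext e
      have := congrArg (fun T : F →L[ℝ] F ↦ T e) (hconst x hx (Pi.single 0 1) (Pi.single 0 1))
      simp only [hσ0', add_apply, ContinuousLinearMap.comp_apply, ht₀.apply_00] at this
      exact half this
    · ext e
      have := congrArg (fun T : F →L[ℝ] F ↦ T e) (hconst x hx (Pi.single 1 1) (Pi.single 1 1))
      simp only [hσ0', add_apply, ContinuousLinearMap.comp_apply, ht₀.apply_11] at this
      exact half this
    · ext e
      have := congrArg (fun T : F →L[ℝ] F ↦ T e) (hconst x hx (Pi.single 1 1) (Pi.single 0 1))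
      simp only [hσ0', add_apply, ContinuousLinearMap.comp_apply, ht₀.apply_01, ht₀.apply_10,
        neg_add_cancel] at this
      exact eq_neg_of_add_eq_zero_left this
  have hσspan : ∀ x ∈ O', ∀ c, σ x c ∈ Submodule.span ℝ (range fun i ↦ A i x) := by
    intro x hx c
    obtain ⟨g, hg⟩ := hσq x (m2 hx)
    rw [hg]
    exact tripleL_mem_span _ _
  have hspan : ∀ x ∈ O', ∀ i, A' i x ∈ Submodule.span ℝ (range fun i ↦ A i x) := by
    intro x hx i
    fin_cases i
    · exact hσspan x hx _
    · exact hσspan x hx _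
    · change σ x (Pi.single 0 1) ∘L σ x (Pi.single 1 1) ∈ _
      obtain ⟨g, hg⟩ := hσq x (m2 hx)
      set a := g (Pi.single 0 1) with ha
      set b := g (Pi.single 1 1) with hb
      have e1 : ∀ e, σ x (Pi.single 0 1) (σ x (Pi.single 1 1) e) =
          -(a 0 * b 0 + a 1 * b 1 + a 2 * b 2) • e +
          tripleL (fun i ↦ A i x) ![a 1 * b 2 - a 2 * b 1, a 2 * b 0 - a 0 * b 2,
            a 0 * b 1 - a 1 * b 0] e := by
        intro e
        rw [hg]
        exact (h.triple x (m hx)).tripleL_comp a b e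
      have e2 : ∀ e, σ x (Pi.single 1 1) (σ x (Pi.single 0 1) e) =
          -(b 0 * a 0 + b 1 * a 1 + b 2 * a 2) • e +
          tripleL (fun i ↦ A i x) ![b 1 * a 2 - b 2 * a 1, b 2 * a 0 - b 0 * a 2,
            b 0 * a 1 - b 1 * a 0] e := by
        intro e
        rw [hg]
        exact (h.triple x (m hx)).tripleL_comp b a e
      -- The product of the two units lies in `Q` only up to its scalar part, which vanishes because
      -- they anticommute.
      obtain ⟨e₀, he₀⟩ := exists_ne (0 : F)
      have e3 : σ x (Pi.single 1 1) (σ x (Pi.single 0 1) e₀) =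
          -σ x (Pi.single 0 1) (σ x (Pi.single 1 1) e₀) :=
        congrArg (fun T : F →L[ℝ] F ↦ T e₀) (htriple x hx).one_zero
      rw [e1, e2] at e3
      have e4 : (2 * (a 0 * b 0 + a 1 * b 1 + a 2 * b 2)) • e₀ = 0 := by
        rw [tripleL_apply, tripleL_apply] at e3
        simp only [add_apply, smul_apply, Matrix.cons_val_zero, Matrix.cons_val_one,
          Matrix.cons_val] at e3
        rw [← sub_eq_zero] at e3
        rw [← neg_eq_zero, ← e3]
        module
      have e5 : a 0 * b 0 + a 1 * b 1 + a 2 * b 2 = 0 := by simpa [he₀] using e4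
      have e6 : σ x (Pi.single 0 1) ∘L σ x (Pi.single 1 1) = tripleL (fun i ↦ A i x)
          ![a 1 * b 2 - a 2 * b 1, a 2 * b 0 - a 0 * b 2, a 0 * b 1 - a 1 * b 0] := by
        ext e
        rw [ContinuousLinearMap.comp_apply, e1, e5]
        simp
      rw [e6]
      exact tripleL_mem_span _ _
  have hrange : ∀ x ∈ O', LinearMap.range (s' x).toLinearMap =
      LinearMap.range (s x).toLinearMap := by
    intro x hx
    obtain ⟨g, hg⟩ := hs's x (m1 hx)
    rw [hg]
    exact LinearMap.range_comp_of_range_eq_top _ (LinearEquiv.range g.toLinearEquiv)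
  refine ⟨O', s', A', hx', m, ?_, hrange, fun x hx ↦ (htriple x hx).span_eq (hspan x hx)⟩
  exact
  { isOpen := hO'
    contDiffOn_ι := h.contDiffOn_ι.mono m
    contDiffOn_s := hs'.mono m1
    contDiffOn_A := fun i ↦ by
      have h1 : ∀ c, ContDiffOn ℝ ∞ (fun x ↦ σ x c) O' := fun c ↦
        (hσ.mono m2).clm_apply contDiffOn_const
      fin_cases i
      · exact h1 _
      · exact h1 _
      · exact (h1 _).clm_comp (h1 _)
    triple := htriple
    injective_ι := fun x hx ↦ h.injective_ι x (m hx)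
    injective_s := fun x hx ↦ by
      obtain ⟨g, hg⟩ := hs's x (m1 hx)
      rw [hg]
      exact (h.injective_s x (m hx)).comp g.injective
    isCompl := fun x hx ↦ by
      rw [hrange x hx]
      exact h.isCompl x (m hx)
    map_s := fun x hx i k ↦ by
      obtain ⟨k', hk'⟩ : s' x k ∈ LinearMap.range (s x).toLinearMap := hrange x hx ▸ ⟨k, rfl⟩
      obtain ⟨c, hc⟩ := exists_tripleL_of_mem_span (hspan x hx i)
      choose w hw using h.map_s x (m hx)
      refine ⟨c 0 • w 0 k' + c 1 • w 1 k' + c 2 • w 2 k', ?_⟩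
      rw [← hk', hc, tripleL_apply]
      simp only [map_add, map_smul, ← hw, add_apply, smul_apply]
      rfl
    contDiffOn_Γ := h.contDiffOn_Γ.mono m
    torsion := fun x hx ↦ h.torsion x (m hx)
    preserves_ι := fun x hx ↦ h.preserves_ι x (m hx)
    parallel_s := fun x hx ↦ hps x (m1 hx)
    parallel_A := fun x hx i u e ↦ by
      have h1 : ∀ c, fderiv ℝ (fun x ↦ σ x c) x u e = σ x c (Γ x u e) - Γ x u (σ x c e) := by
        intro c
        rw [(hσd x hx c).fderiv]
        exact hσpar x hx u c e
      fin_cases i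
      · exact h1 _
      · exact h1 _
      · change fderiv ℝ (fun x ↦ σ x (Pi.single 0 1) ∘L σ x (Pi.single 1 1)) x u e =
          σ x (Pi.single 0 1) (σ x (Pi.single 1 1) (Γ x u e)) -
          Γ x u (σ x (Pi.single 0 1) (σ x (Pi.single 1 1) e))
        rw [((hσd x hx _).clm_comp (hσd x hx _)).fderiv]
        simp only [add_apply, ContinuousLinearMap.comp_apply, ContinuousLinearMap.compL_apply,
          ContinuousLinearMap.flip_apply, hσpar x hx, map_sub]
        abel }

end Adapted

/-! ### Poincaré lemma, commuting fields and adapted coordinates -/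

section Coordinates

variable {X T Z : Type} [NormedAddCommGroup X] [NormedSpace ℝ X] [FiniteDimensional ℝ X]
  [NormedAddCommGroup T] [NormedSpace ℝ T] [FiniteDimensional ℝ T]

/-- The Poincaré lemma for `1`-forms. -/
theorem exists_primitive {θ : X → X →L[ℝ] T} {O : Set X} (hO : IsOpen O)
    (hθ : ContDiffOn ℝ ∞ θ O) (hclosed : ∀ x ∈ O, ∀ u v, fderiv ℝ θ x u v = fderiv ℝ θ x v u)
    {x₀ : X} (hx₀ : x₀ ∈ O) :
    ∃ (O' : Set X) (f : X → T), IsOpen O' ∧ x₀ ∈ O' ∧ O' ⊆ O ∧ ContDiffOn ℝ ∞ f O' ∧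
      ∀ x ∈ O', HasFDerivAt f (θ x) x := by
  obtain ⟨W, u, hW, hxW, hu, -, hud⟩ := exists_solution_total_differential_equation
    (hO.prod isOpen_univ) (A := fun p : X × T ↦ θ p.1)
    (hθ.comp contDiffOn_fst (fun p hp ↦ hp.1)) (x₀ := x₀) (y₀ := 0) ⟨hx₀, mem_univ _⟩ (by
      rintro ⟨x, y⟩ ⟨hx, -⟩ v w
      have h1 : HasFDerivAt θ (fderiv ℝ θ x) x :=
        ((hθ.contDiffAt (hO.mem_nhds hx)).differentiableAt (by simp)).hasFDerivAt
      have h2 : HasFDerivAt (fun p : X × T ↦ θ p.1)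
          (fderiv ℝ θ x ∘L ContinuousLinearMap.fst ℝ X T) (x, y) :=
        HasFDerivAt.comp (x, y) (g := θ) h1 hasFDerivAt_fst
      rw [h2.fderiv]
      exact hclosed x hx v w)
  let i : X → X × T := fun x ↦ (x, 0)
  have hi : ContDiff ℝ ∞ i := contDiff_id.prodMk contDiff_const
  exact ⟨i ⁻¹' W, fun x ↦ u (i x), hW.preimage hi.continuous, hxW, fun x hx ↦ (hud _ hx).1.1,
    hu.comp hi.contDiffOn (fun p hp ↦ hp), fun x hx ↦ (hud _ hx).2⟩

/-- Commuting vector fields, indexed by a vector space `T` and transverse to the kernel of `θ`,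
admit a complete set of first integrals. -/
theorem exists_first_integrals [NormedAddCommGroup Z] [NormedSpace ℝ Z] [FiniteDimensional ℝ Z]
    {E : X → T →L[ℝ] X} {O : Set X} (hO : IsOpen O)
    (hE : ContDiffOn ℝ ∞ E O)
    (hcomm : ∀ x ∈ O, ∀ σ τ, fderiv ℝ E x (E x σ) τ = fderiv ℝ E x (E x τ) σ)
    {x₀ : X} (hx₀ : x₀ ∈ O) {θ : X →L[ℝ] T} (hθE : ∀ τ, θ (E x₀ τ) = τ)
    {j : Z →L[ℝ] X} (hj : Function.Injective j) (hjθ : ∀ v, θ v = 0 ↔ v ∈ range j) :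
    ∃ (O' : Set X) (g : X → Z), IsOpen O' ∧ x₀ ∈ O' ∧ O' ⊆ O ∧ ContDiffOn ℝ ∞ g O' ∧
      (∀ x ∈ O', ∀ τ, fderiv ℝ g x (E x τ) = 0) ∧ ∀ ζ, fderiv ℝ g x₀ (j ζ) = ζ := by
  -- The simultaneous flow solves `∂_t u = E (u)` with time in `T`. Integrability says that the
  -- fields commute.
  obtain ⟨W, u, hW, hxW, hu, hu0, hud⟩ := exists_solution_total_differential_equation
    (isOpen_univ.prod hO) (A := fun p : T × X ↦ E p.2)
    (hE.comp contDiffOn_snd (fun p hp ↦ hp.2)) (x₀ := 0) (y₀ := x₀) ⟨mem_univ _, hx₀⟩ (by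
      rintro ⟨t, x⟩ ⟨-, hx⟩ v w
      have h1 : HasFDerivAt E (fderiv ℝ E x) x :=
        ((hE.contDiffAt (hO.mem_nhds hx)).differentiableAt (by simp)).hasFDerivAt
      have h2 : HasFDerivAt (fun p : T × X ↦ E p.2)
          (fderiv ℝ E x ∘L ContinuousLinearMap.snd ℝ T X) (t, x) :=
        HasFDerivAt.comp (t, x) (g := E) h1 hasFDerivAt_snd
      rw [h2.fderiv]
      exact hcomm x hx v w)
  let i : T × Z → T × X := fun q ↦ (q.1, x₀ + j q.2)
  have hi : ContDiff ℝ ∞ i :=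
    contDiff_fst.prodMk (contDiff_const.add (j.contDiff.comp contDiff_snd))
  have hi0 : i 0 = (0, x₀) := by simp [i]
  -- Flowing out of the transversal `x₀ + j Z` straightens the fields to `∂/∂t`. The `Z` component
  -- of the inverse is constant along them.
  let Ψ : T × Z → X := fun q ↦ u (i q)
  have hΨ : ContDiffOn ℝ ∞ Ψ (i ⁻¹' W) := hu.comp hi.contDiffOn (fun p hp ↦ hp)
  have hW' : IsOpen (i ⁻¹' W) := hW.preimage hi.continuous
  have h0W : (0 : T × Z) ∈ i ⁻¹' W := by rw [mem_preimage, hi0]; exact hxW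
  have hΨd : ∀ q ∈ i ⁻¹' W, HasFDerivAt Ψ (fderiv ℝ Ψ q) q := fun q hq ↦
    ((hΨ.contDiffAt (hW'.mem_nhds hq)).differentiableAt (by simp)).hasFDerivAt
  have hΨt : ∀ q ∈ i ⁻¹' W, ∀ τ, fderiv ℝ Ψ q (τ, 0) = E (Ψ q) τ := by
    intro q hq τ
    have h1 : HasFDerivAt (fun t ↦ Ψ (t, q.2)) (E (Ψ q)) q.1 := (hud _ hq).2
    have h2 : HasFDerivAt (fun t ↦ Ψ (t, q.2))
        (fderiv ℝ Ψ q ∘L ContinuousLinearMap.inl ℝ T Z) q.1 :=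
      HasFDerivAt.comp q.1 (g := Ψ) (hΨd q hq) (hasFDerivAt_prodMk_left q.1 q.2)
    rw [h1.unique h2]; rfl
  have hΨ0 : Ψ 0 = x₀ := by
    change u (i 0) = x₀
    rw [hi0]; exact hu0 _ hxW
  have hΨz : ∀ ζ, fderiv ℝ Ψ 0 (0, ζ) = j ζ := by
    intro ζ
    have h1 : HasFDerivAt (fun z ↦ Ψ (0, z))
        (fderiv ℝ Ψ 0 ∘L ContinuousLinearMap.inr ℝ T Z) 0 :=
      HasFDerivAt.comp (0 : Z) (g := Ψ) (hΨd 0 h0W) (hasFDerivAt_prodMk_right (0 : T) (0 : Z))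
    have h2 : HasFDerivAt (fun z : Z ↦ Ψ (0, z)) j 0 := by
      refine (j.hasFDerivAt.const_add x₀).congr_of_eventuallyEq ?_
      have : Continuous fun z : Z ↦ ((0 : T), z) := by fun_prop
      filter_upwards [(hW'.preimage this).mem_nhds h0W] with z hz
      exact hu0 _ hz
    exact congrArg (fun L : Z →L[ℝ] X ↦ L ζ) (h1.unique h2)
  have hbij : Function.Bijective (fderiv ℝ Ψ 0) := by
    have hsplit : ∀ τ ζ, fderiv ℝ Ψ 0 (τ, ζ) = E x₀ τ + j ζ := by
      intro τ ζ
      rw [← hΨz ζ, ← hΨ0, ← hΨt 0 h0W, ← map_add]; simp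
    constructor
    · rw [injective_iff_map_eq_zero]
      rintro ⟨τ, ζ⟩ h
      rw [hsplit] at h
      have h1 := congrArg θ h
      rw [map_add, hθE, (hjθ _).2 ⟨ζ, rfl⟩, add_zero, map_zero] at h1
      rw [h1, map_zero, zero_add] at h
      rw [h1, hj (h.trans (map_zero j).symm)]; rfl
    · intro v
      obtain ⟨ζ, hζ⟩ := (hjθ (v - E x₀ (θ v))).1 (by rw [map_sub, hθE, sub_self])
      exact ⟨(θ v, ζ), by rw [hsplit, hζ]; abel⟩
  let e : (T × Z) ≃L[ℝ] X :=
    (LinearEquiv.ofBijective (fderiv ℝ Ψ 0).toLinearMap hbij).toContinuousLinearEquiv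
  have he : fderiv ℝ Ψ 0 = e := by ext <;> rfl
  obtain ⟨h, h0h, hhW, hhΨ, hsymm, -⟩ := hΨ.exists_openPartialHomeomorph hW' h0W e he
  have hmem : ∀ x ∈ h.target, h.symm x ∈ h.source := fun x hx ↦ h.map_target hx
  have hsd : ∀ x ∈ h.target, HasFDerivAt h.symm (fderiv ℝ h.symm x) x := fun x hx ↦
    ((hsymm.contDiffAt (h.open_target.mem_nhds hx)).differentiableAt (by simp)).hasFDerivAt
  have hinv : ∀ q ∈ h.source, ∀ d, fderiv ℝ h.symm (Ψ q) (fderiv ℝ Ψ q d) = d := by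
    intro q hq d
    have hΨq : Ψ q ∈ h.target := by rw [← hhΨ]; exact h.map_source hq
    have h1 := (hsd _ hΨq).comp q (hΨd q (hhW hq))
    have h2 : HasFDerivAt (h.symm ∘ Ψ) (ContinuousLinearMap.id ℝ (T × Z)) q := by
      refine (hasFDerivAt_id q).congr_of_eventuallyEq ?_
      filter_upwards [h.open_source.mem_nhds hq] with q' hq'
      rw [Function.comp_apply, ← hhΨ, h.left_inv hq']; rfl
    exact congrArg (fun L : (T × Z) →L[ℝ] T × Z ↦ L d) (h1.unique h2)
  have hg : ∀ x ∈ h.target, ∀ v, fderiv ℝ (fun x ↦ (h.symm x).2) x v =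
      (fderiv ℝ h.symm x v).2 := by
    intro x hx v
    rw [(hsd x hx).snd.fderiv]; rfl
  have hxt : x₀ ∈ h.target := by
    rw [← hΨ0, ← hhΨ]; exact h.map_source h0h
  have hright : ∀ x ∈ h.target, Ψ (h.symm x) = x := fun x hx ↦ by
    rw [← hhΨ]; exact h.right_inv hx
  refine ⟨h.target, fun x ↦ (h.symm x).2, h.open_target, hxt, ?_, contDiff_snd.comp_contDiffOn hsymm,
    ?_, ?_⟩
  · intro x hx
    have := (hud _ (hhW (hmem x hx))).1.2
    rw [← hright x hx]; exact this
  · intro x hx τ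
    have h1 := hinv _ (hmem x hx) (τ, 0)
    rw [hΨt _ (hhW (hmem x hx)), hright x hx] at h1
    rw [hg x hx, h1]
  · intro ζ
    have h1 := hinv 0 h0h (0, ζ)
    rw [hΨz, hΨ0] at h1
    rw [hg _ hxt, h1]

variable [NormedAddCommGroup Z] [InnerProductSpace ℝ Z] [FiniteDimensional ℝ Z]

/-- Coordinates adapted to a closed form `θ` and to a dual family `E` of commuting vector fields. -/
theorem exists_coordinates {θ : X → X →L[ℝ] T} {E : X → T →L[ℝ] X} {O : Set X} (hO : IsOpen O)
    (hθ : ContDiffOn ℝ ∞ θ O) (hE : ContDiffOn ℝ ∞ E O)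
    (hclosed : ∀ x ∈ O, ∀ u v, fderiv ℝ θ x u v = fderiv ℝ θ x v u)
    (hcomm : ∀ x ∈ O, ∀ σ τ, fderiv ℝ E x (E x σ) τ = fderiv ℝ E x (E x τ) σ)
    (hθE : ∀ x ∈ O, ∀ τ, θ x (E x τ) = τ) {x₀ : X} (hx₀ : x₀ ∈ O)
    (hdim : finrank ℝ X = finrank ℝ T + finrank ℝ Z) :
    ∃ (φ : OpenPartialHomeomorph X (T × Z)) (t₀ : T) (r : ℝ) (ν : X → Z →L[ℝ] X), 0 < r ∧
      x₀ ∈ φ.source ∧ φ.source ⊆ O ∧ φ.target = Metric.ball t₀ r ×ˢ univ ∧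
      ContDiffOn ℝ ∞ φ φ.source ∧ ContDiffOn ℝ ∞ φ.symm φ.target ∧ ContDiffOn ℝ ∞ ν φ.source ∧
      (∀ x ∈ φ.source, HasFDerivAt (fun y ↦ (φ y).1) (θ x) x) ∧
      (∀ x ∈ φ.source, ∀ τ, fderiv ℝ (fun y ↦ (φ y).2) x (E x τ) = 0) ∧
      (∀ x ∈ φ.source, ∀ ζ, fderiv ℝ (fun y ↦ (φ y).2) x (ν x ζ) = ζ) ∧
      (∀ x ∈ φ.source, ∀ v, v = E x (θ x v) + ν x (fderiv ℝ (fun y ↦ (φ y).2) x v)) ∧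
      ∀ x ∈ φ.source, ∀ τ ζ, fderiv ℝ φ.symm (φ x) (τ, ζ) = E x τ + ν x ζ := by
  classical
  have hfin : finrank ℝ Z = finrank ℝ (LinearMap.ker (θ x₀).toLinearMap) := by
    have h1 := LinearMap.finrank_range_add_finrank_ker (θ x₀).toLinearMap
    have h2 : LinearMap.range (θ x₀).toLinearMap = ⊤ :=
      LinearMap.range_eq_top.2 fun τ ↦ ⟨E x₀ τ, hθE x₀ hx₀ τ⟩
    rw [h2, finrank_top] at h1
    omega
  -- The dimension hypothesis identifies `Z` with the kernel of `θ x₀`, a complement of the span of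
  -- the fields.
  let j₀ : Z ≃ₗ[ℝ] LinearMap.ker (θ x₀).toLinearMap := LinearEquiv.ofFinrankEq _ _ hfin
  let j : Z →L[ℝ] X :=
    ((LinearMap.ker (θ x₀).toLinearMap).subtype ∘ₗ j₀.toLinearMap).toContinuousLinearMap
  have hj : Function.Injective j := Subtype.val_injective.comp j₀.injective
  have hjθ : ∀ v, θ x₀ v = 0 ↔ v ∈ range j := by
    intro v
    constructor
    · intro hv
      exact ⟨j₀.symm ⟨v, hv⟩, congrArg Subtype.val (j₀.apply_symm_apply ⟨v, hv⟩)⟩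
    · rintro ⟨ζ, rfl⟩
      exact (j₀ ζ).2
  obtain ⟨O₁, f, hO₁, hx₁, hOO₁, hf, hfd⟩ := exists_primitive hO hθ hclosed hx₀
  obtain ⟨O₂, g, hO₂, hx₂, hOO₂, hg, hgE, hgj⟩ :=
    exists_first_integrals hO hE hcomm hx₀ (hθE x₀ hx₀) hj hjθ
  have hgd : ∀ x ∈ O₂, HasFDerivAt g (fderiv ℝ g x) x := fun x hx ↦
    ((hg.contDiffAt (hO₂.mem_nhds hx)).differentiableAt (by simp)).hasFDerivAt
  let Φ : X → T × Z := fun x ↦ (f x, g x)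
  have hΦd : ∀ x ∈ O₁ ∩ O₂, HasFDerivAt Φ ((θ x).prod (fderiv ℝ g x)) x := fun x hx ↦
    (hfd x hx.1).prodMk (hgd x hx.2)
  have hbij : Function.Bijective ((θ x₀).prod (fderiv ℝ g x₀)) := by
    constructor
    · rw [injective_iff_map_eq_zero]
      intro v hv
      obtain ⟨hv1, hv2⟩ := Prod.ext_iff.1 hv
      obtain ⟨ζ, rfl⟩ := (hjθ v).1 hv1
      have : ζ = 0 := (hgj ζ).symm.trans hv2
      rw [this, map_zero]
    · rintro ⟨τ, ζ⟩
      refine ⟨E x₀ τ + j ζ, Prod.ext ?_ ?_⟩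
      · change θ x₀ (E x₀ τ + j ζ) = τ
        rw [map_add, hθE x₀ hx₀, (hjθ _).2 ⟨ζ, rfl⟩, add_zero]
      · change fderiv ℝ g x₀ (E x₀ τ + j ζ) = ζ
        rw [map_add, hgE x₀ hx₂, hgj, zero_add]
  obtain ⟨h, hxh, hhO, hhΦ, hsymm, -⟩ :=
    (((hf.mono inter_subset_left).prodMk (hg.mono inter_subset_right)) :
      ContDiffOn ℝ ∞ Φ (O₁ ∩ O₂)).exists_openPartialHomeomorph (hO₁.inter hO₂) ⟨hx₁, hx₂⟩
      (LinearEquiv.ofBijective ((θ x₀).prod (fderiv ℝ g x₀)).toLinearMap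
        hbij).toContinuousLinearEquiv (by rw [(hΦd x₀ ⟨hx₁, hx₂⟩).fderiv]; ext <;> rfl)
  have hΦt : (f x₀, g x₀) ∈ h.target := by
    have := h.map_source hxh
    rwa [hhΦ] at this
  obtain ⟨r, hr, hrt⟩ := Metric.isOpen_iff.1 h.open_target _ hΦt
  rw [← ball_prod_same] at hrt
  -- The ball in `Z` is stretched onto all of `Z`, so that the second factor of the product can be
  -- the whole vector space.
  let b : OpenPartialHomeomorph Z Z := OpenPartialHomeomorph.univBall (g x₀) r
  have hbs : b.source = univ := OpenPartialHomeomorph.univBall_source _ _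
  have hbt : b.target = Metric.ball (g x₀) r := OpenPartialHomeomorph.univBall_target _ hr
  have hb : ContDiff ℝ ∞ b := OpenPartialHomeomorph.contDiff_univBall
  have hbsymm : ContDiffOn ℝ ∞ b.symm (Metric.ball (g x₀) r) :=
    OpenPartialHomeomorph.contDiffOn_univBall_symm
  let k : OpenPartialHomeomorph (T × Z) (T × Z) :=
    (OpenPartialHomeomorph.ofSet (Metric.ball (f x₀) r) Metric.isOpen_ball).prod b.symm
  let φ : OpenPartialHomeomorph X (T × Z) := h.trans k
  have hks : k.source = Metric.ball (f x₀) r ×ˢ Metric.ball (g x₀) r := by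
    rw [← hbt]; rfl
  have hkt : k.target = Metric.ball (f x₀) r ×ˢ univ := by
    rw [← hbs]; rfl
  have hφs : ∀ x, x ∈ φ.source ↔ x ∈ h.source ∧ (f x, g x) ∈
      Metric.ball (f x₀) r ×ˢ Metric.ball (g x₀) r := by
    intro x
    rw [OpenPartialHomeomorph.trans_source, hks, mem_inter_iff, mem_preimage, hhΦ]
  have hφt : φ.target = Metric.ball (f x₀) r ×ˢ univ := by
    rw [OpenPartialHomeomorph.trans_target, hkt, inter_eq_left]
    intro q hq
    rw [mem_preimage]
    apply hrt
    rw [← hks]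
    exact k.map_target (by rwa [hkt])
  have hφ : ∀ x, φ x = (f x, b.symm (g x)) := by
    intro x
    change k (h x) = _
    rw [hhΦ]; rfl
  have hφsymm : ∀ q, φ.symm q = h.symm (q.1, b q.2) := fun q ↦ rfl
  have hsO : ∀ x ∈ φ.source, x ∈ O₁ ∩ O₂ := fun x hx ↦ hhO ((hφs x).1 hx).1
  have hsub : φ.source ⊆ O := fun x hx ↦ hOO₁ (hsO x hx).1
  have hφ1 : (fun y ↦ (φ y).1) = f := funext fun y ↦ by rw [hφ]
  have hφ2 : (fun y ↦ (φ y).2) = fun y ↦ b.symm (g y) := funext fun y ↦ by rw [hφ]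
  have hsmooth2 : ContDiffOn ℝ ∞ (fun y ↦ (φ y).2) φ.source := by
    rw [hφ2]
    exact hbsymm.comp (hg.mono fun x hx ↦ (hsO x hx).2) fun x hx ↦ ((hφs x).1 hx).2.2
  have hsmooth : ContDiffOn ℝ ∞ φ φ.source := by
    have h1 : ContDiffOn ℝ ∞ (fun y ↦ (φ y).1) φ.source := by
      rw [hφ1]; exact hf.mono fun x hx ↦ (hsO x hx).1
    exact h1.prodMk hsmooth2
  have hsmooth' : ContDiffOn ℝ ∞ φ.symm φ.target := by
    have h1 : ContDiffOn ℝ ∞ (fun q : T × Z ↦ (q.1, b q.2)) φ.target :=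
      (contDiff_fst.prodMk (hb.comp contDiff_snd)).contDiffOn
    refine hsymm.comp h1 fun q hq ↦ ?_
    apply hrt
    rw [← hks]
    exact k.map_target (by rw [hkt, ← hφt]; exact hq)
  have hd1 : ∀ x ∈ φ.source, HasFDerivAt (fun y ↦ (φ y).1) (θ x) x := fun x hx ↦ by
    rw [hφ1]; exact hfd x (hsO x hx).1
  have hd2 : ∀ x ∈ φ.source, HasFDerivAt (fun y ↦ (φ y).2) (fderiv ℝ (fun y ↦ (φ y).2) x) x :=
    fun x hx ↦ ((hsmooth2.contDiffAt (φ.open_source.mem_nhds hx)).differentiableAt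
      (by simp)).hasFDerivAt
  have hd : ∀ x ∈ φ.source, HasFDerivAt φ ((θ x).prod (fderiv ℝ (fun y ↦ (φ y).2) x)) x :=
    fun x hx ↦ (hd1 x hx).prodMk (hd2 x hx)
  have hd' : ∀ x ∈ φ.source, HasFDerivAt φ.symm (fderiv ℝ φ.symm (φ x)) (φ x) := fun x hx ↦
    ((hsmooth'.contDiffAt (φ.open_target.mem_nhds (φ.map_source hx))).differentiableAt
      (by simp)).hasFDerivAt
  have hleft : ∀ x ∈ φ.source, ∀ v,
      fderiv ℝ φ.symm (φ x) (θ x v, fderiv ℝ (fun y ↦ (φ y).2) x v) = v := by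
    intro x hx v
    have h2 : HasFDerivAt (φ.symm ∘ φ) (ContinuousLinearMap.id ℝ X) x := by
      refine (hasFDerivAt_id x).congr_of_eventuallyEq ?_
      filter_upwards [φ.open_source.mem_nhds hx] with y hy
      exact φ.left_inv hy
    exact congrArg (fun L : X →L[ℝ] X ↦ L v) (((hd' x hx).comp x (hd x hx)).unique h2)
  have hright : ∀ x ∈ φ.source, ∀ q, (θ x (fderiv ℝ φ.symm (φ x) q),
      fderiv ℝ (fun y ↦ (φ y).2) x (fderiv ℝ φ.symm (φ x) q)) = q := by
    intro x hx q
    have h2 : HasFDerivAt (φ ∘ φ.symm) (ContinuousLinearMap.id ℝ (T × Z)) (φ x) := by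
      refine (hasFDerivAt_id (φ x)).congr_of_eventuallyEq ?_
      filter_upwards [φ.open_target.mem_nhds (φ.map_source hx)] with y hy
      exact φ.right_inv hy
    have h3 := hd x hx
    rw [← φ.left_inv hx] at h3
    have h4 := congrArg (fun L : (T × Z) →L[ℝ] T × Z ↦ L q)
      ((HasFDerivAt.comp (φ x) h3 (hd' x hx)).unique h2)
    rw [φ.left_inv hx] at h4
    exact h4
  have hgE' : ∀ x ∈ φ.source, ∀ τ, fderiv ℝ (fun y ↦ (φ y).2) x (E x τ) = 0 := by
    intro x hx τ
    have h1 : HasFDerivAt b.symm (fderiv ℝ b.symm (g x)) (g x) :=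
      ((hbsymm.contDiffAt (Metric.isOpen_ball.mem_nhds
        ((hφs x).1 hx).2.2)).differentiableAt (by simp)).hasFDerivAt
    have h2 := h1.comp x (hgd x (hsO x hx).2)
    rw [hφ2]
    have h3 : fderiv ℝ (fun y ↦ b.symm (g y)) x = _ := h2.fderiv
    rw [h3, ContinuousLinearMap.comp_apply, hgE x (hsO x hx).2, map_zero]
  -- In these coordinates the fields `E` are the coordinate fields of the `T` directions.
  have hE' : ∀ x ∈ φ.source, ∀ τ, fderiv ℝ φ.symm (φ x) (τ, 0) = E x τ := by
    intro x hx τ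
    have h1 := hleft x hx (E x τ)
    rwa [hgE' x hx, hθE x (hsub hx)] at h1
  refine ⟨φ, f x₀, r, fun x ↦ fderiv ℝ φ.symm (φ x) ∘L ContinuousLinearMap.inr ℝ T Z, hr, ?_, hsub,
    hφt, hsmooth, hsmooth', ?_, hd1, hgE', ?_, ?_, ?_⟩
  · rw [hφs]
    exact ⟨hxh, Metric.mem_ball_self hr, Metric.mem_ball_self hr⟩
  · exact ((hsmooth'.fderiv_of_isOpen φ.open_target (by simp)).comp hsmooth
      fun x hx ↦ φ.map_source hx).clm_comp contDiffOn_const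
  · intro x hx ζ
    exact congrArg Prod.snd (hright x hx (0, ζ))
  · intro x hx v
    rw [← hE' x hx, ContinuousLinearMap.comp_apply, ContinuousLinearMap.inr_apply, ← map_add,
      Prod.mk_add_mk, add_zero, zero_add, hleft x hx]
  · intro x hx τ ζ
    rw [← hE' x hx, ContinuousLinearMap.comp_apply, ContinuousLinearMap.inr_apply, ← map_add,
      Prod.mk_add_mk, add_zero, zero_add]

end Coordinates

/-! ### Product rules for families of linear maps -/

section Calculus

variable {X F G H : Type*} [NormedAddCommGroup X] [NormedSpace ℝ X] [NormedAddCommGroup F]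
  [NormedSpace ℝ F] [NormedAddCommGroup G] [NormedSpace ℝ G] [NormedAddCommGroup H]
  [NormedSpace ℝ H]

theorem ContDiffOn.hasFDerivAt_of_isOpen {f : X → F} {O : Set X} (hf : ContDiffOn ℝ ∞ f O)
    (hO : IsOpen O) {x : X} (hx : x ∈ O) : HasFDerivAt f (fderiv ℝ f x) x :=
  ((hf.contDiffAt (hO.mem_nhds hx)).differentiableAt (by simp)).hasFDerivAt

theorem fderiv_clm_comp_apply_apply {P : X → G →L[ℝ] H} {Q : X → F →L[ℝ] G} {x : X}
    (hP : DifferentiableAt ℝ P x) (hQ : DifferentiableAt ℝ Q x) (u : X) (e : F) :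
    fderiv ℝ (fun x ↦ P x ∘L Q x) x u e = fderiv ℝ P x u (Q x e) + P x (fderiv ℝ Q x u e) := by
  rw [(hP.hasFDerivAt.clm_comp hQ.hasFDerivAt).fderiv]
  simp [add_comm]

theorem fderiv_const_clm_comp_apply_apply (P : G →L[ℝ] H) {Q : X → F →L[ℝ] G} {x : X}
    (hQ : DifferentiableAt ℝ Q x) (u : X) (e : F) :
    fderiv ℝ (fun x ↦ P ∘L Q x) x u e = P (fderiv ℝ Q x u e) := by
  rw [fderiv_clm_comp_apply_apply (differentiableAt_const P) hQ]
  simp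

theorem fderiv_clm_comp_const_apply_apply {P : X → G →L[ℝ] H} (Q : F →L[ℝ] G) {x : X}
    (hP : DifferentiableAt ℝ P x) (u : X) (e : F) :
    fderiv ℝ (fun x ↦ P x ∘L Q) x u e = fderiv ℝ P x u (Q e) := by
  rw [fderiv_clm_comp_apply_apply hP (differentiableAt_const Q)]
  simp

theorem fderiv_clm_add_add {P Q R : X → F →L[ℝ] G} {x : X} (hP : DifferentiableAt ℝ P x)
    (hQ : DifferentiableAt ℝ Q x) (hR : DifferentiableAt ℝ R x) :
    fderiv ℝ (fun x ↦ P x + Q x + R x) x = fderiv ℝ P x + fderiv ℝ Q x + fderiv ℝ R x := by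
  rw [fderiv_fun_add (hP.fun_add hQ) hR, fderiv_fun_add hP hQ]

theorem fderiv_clm_sub_add_add {S P Q R : X → F →L[ℝ] G} {x : X} (hS : DifferentiableAt ℝ S x)
    (hP : DifferentiableAt ℝ P x) (hQ : DifferentiableAt ℝ Q x) (hR : DifferentiableAt ℝ R x) :
    fderiv ℝ (fun x ↦ S x - (P x + Q x + R x)) x =
      fderiv ℝ S x - (fderiv ℝ P x + fderiv ℝ Q x + fderiv ℝ R x) := by
  rw [fderiv_fun_sub hS ((hP.fun_add hQ).fun_add hR), fderiv_clm_add_add hP hQ hR]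

end Calculus

/-! ### Coordinates on imaginary quaternions -/

section Units

variable {l : ℕ}

/-- The standard units `i, j, k` of `Im ℍ`. -/
def imUnit : Fin 3 → ImH :=
  ![⟨⟨0, 1, 0, 0⟩, rfl⟩, ⟨⟨0, 0, 1, 0⟩, rfl⟩, ⟨⟨0, 0, 0, 1⟩, rfl⟩]

theorem re_imUnit (i : Fin 3) : (imUnit i : ℍ[ℝ]).re = 0 := (imUnit i).2

theorem imI_imUnit (i : Fin 3) : (imUnit i : ℍ[ℝ]).imI = (![1, 0, 0] : Fin 3 → ℝ) i := by
  fin_cases i <;> rfl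

theorem imJ_imUnit (i : Fin 3) : (imUnit i : ℍ[ℝ]).imJ = (![0, 1, 0] : Fin 3 → ℝ) i := by
  fin_cases i <;> rfl

theorem imK_imUnit (i : Fin 3) : (imUnit i : ℍ[ℝ]).imK = (![0, 0, 1] : Fin 3 → ℝ) i := by
  fin_cases i <;> rfl

/-- The coordinates of an imaginary quaternion. -/
def imCoord (u : ImH) : Fin 3 → ℝ := ![(u : ℍ[ℝ]).imI, (u : ℍ[ℝ]).imJ, (u : ℍ[ℝ]).imK]

theorem ImH.re_eq_zero (u : ImH) : (u : ℍ[ℝ]).re = 0 := u.2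

theorem sum_imCoord_smul (u : ImH) :
    imCoord u 0 • imUnit 0 + imCoord u 1 • imUnit 1 + imCoord u 2 • imUnit 2 = u := by
  apply Subtype.ext
  have := ImH.re_eq_zero u
  apply Quaternion.ext <;> simp [re_imUnit, imI_imUnit, imJ_imUnit, imK_imUnit, imCoord, this]

/-- The linear map `k ↦ (k a • w)_a`. -/
def smulL (l : ℕ) {W : Type*} [NormedAddCommGroup W] [NormedSpace ℝ W] (w : W) :
    (Fin l → ℝ) →L[ℝ] Fin l → W :=
  ContinuousLinearMap.pi fun a ↦ (ContinuousLinearMap.proj a).smulRight w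

theorem smulL_apply {W : Type*} [NormedAddCommGroup W] [NormedSpace ℝ W] (w : W)
    (k : Fin l → ℝ) (a : Fin l) : smulL l w k a = k a • w := rfl

/-- The coordinates of a vector of imaginary quaternions. -/
def coordL (l : ℕ) (i : Fin 3) : (Fin l → ImH) →L[ℝ] Fin l → ℝ :=
  LinearMap.toContinuousLinearMap
    { toFun := fun τ a ↦ imCoord (τ a) i
      map_add' := fun σ τ ↦ by ext a; fin_cases i <;> simp [imCoord]
      map_smul' := fun c τ ↦ by ext a; fin_cases i <;> simp [imCoord] }

theorem coordL_apply (i : Fin 3) (τ : Fin l → ImH) (a : Fin l) :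
    coordL l i τ a = imCoord (τ a) i := rfl

end Units

/-! ### The parallel projection to `ℍˡ`, the closed form `θ` and the commuting fields -/

section Split

variable {X : Type} [NormedAddCommGroup X] [NormedSpace ℝ X]
  {F : Type*} [NormedAddCommGroup F] [NormedSpace ℝ F] {l : ℕ}

/-- A parallel frame, together with the projections of `E` to `V` and `TM`. -/
structure IsSplitFrame (O : Set X) (Γ : X → X →L[ℝ] F →L[ℝ] F) (ι : X → X →L[ℝ] F)
    (s : X → (Fin l → ℝ) →L[ℝ] F) (A : Fin 3 → X → F →L[ℝ] F) (η : X → F →L[ℝ] (Fin l → ℝ))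
    (p : X → F →L[ℝ] X) : Prop extends IsParallelFrame O Γ ι s A where
  contDiffOn_η : ContDiffOn ℝ ∞ η O
  contDiffOn_p : ContDiffOn ℝ ∞ p O
  η_s : ∀ x ∈ O, ∀ k, η x (s x k) = k
  η_ι : ∀ x ∈ O, ∀ w, η x (ι x w) = 0
  p_s : ∀ x ∈ O, ∀ k, p x (s x k) = 0
  p_ι : ∀ x ∈ O, ∀ w, p x (ι x w) = w
  eq_add : ∀ x ∈ O, ∀ e, e = s x (η x e) + ι x (p x e)

/-- The projection of `E` to `ℍˡ`. -/
def alphaForm (η : X → F →L[ℝ] (Fin l → ℝ)) (A : Fin 3 → X → F →L[ℝ] F) (x : X) :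
    F →L[ℝ] Fin l → ℍ[ℝ] :=
  smulL l (1 : ℍ[ℝ]) ∘L η x - (smulL l (imUnit 0 : ℍ[ℝ]) ∘L (η x ∘L A 0 x) +
    smulL l (imUnit 1 : ℍ[ℝ]) ∘L (η x ∘L A 1 x) + smulL l (imUnit 2 : ℍ[ℝ]) ∘L (η x ∘L A 2 x))

/-- The projection of `TM` to `(Im ℍ)ˡ`. -/
def thetaForm (ι : X → X →L[ℝ] F) (η : X → F →L[ℝ] (Fin l → ℝ)) (A : Fin 3 → X → F →L[ℝ] F)
    (x : X) : X →L[ℝ] Fin l → ImH :=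
  (-(smulL l (imUnit 0) ∘L (η x ∘L A 0 x) +
    smulL l (imUnit 1) ∘L (η x ∘L A 1 x) + smulL l (imUnit 2) ∘L (η x ∘L A 2 x))) ∘L ι x

/-- The embedding of `(Im ℍ)ˡ` into `E`. -/
def rhoMap (s : X → (Fin l → ℝ) →L[ℝ] F) (A : Fin 3 → X → F →L[ℝ] F) (x : X) :
    (Fin l → ImH) →L[ℝ] F :=
  A 0 x ∘L (s x ∘L coordL l 0) + A 1 x ∘L (s x ∘L coordL l 1) + A 2 x ∘L (s x ∘L coordL l 2)

variable {O : Set X} {Γ : X → X →L[ℝ] F →L[ℝ] F} {ι : X → X →L[ℝ] F}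
    {s : X → (Fin l → ℝ) →L[ℝ] F} {A : Fin 3 → X → F →L[ℝ] F} {η : X → F →L[ℝ] (Fin l → ℝ)}
    {p : X → F →L[ℝ] X}

theorem IsParallelFrame.exists_isSplitFrame [FiniteDimensional ℝ X] [FiniteDimensional ℝ F]
    (h : IsParallelFrame O Γ ι s A) {x₀ : X} (hx₀ : x₀ ∈ O) :
    ∃ O' η p, x₀ ∈ O' ∧ O' ⊆ O ∧ IsSplitFrame O' Γ ι s A η p := by
  obtain ⟨O', η, p, hO', hx, hO, hη, hp, hall⟩ := h.exists_projections hx₀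
  exact ⟨O', η, p, hx, hO, h.mono hO' hO, hη, hp, fun x hx ↦ (hall x hx).1,
    fun x hx ↦ (hall x hx).2.1, fun x hx ↦ (hall x hx).2.2.1, fun x hx ↦ (hall x hx).2.2.2.1,
    fun x hx ↦ (hall x hx).2.2.2.2⟩

namespace IsSplitFrame

variable (h : IsSplitFrame O Γ ι s A η p)

include h

theorem differentiableAt {G : Type*} [NormedAddCommGroup G] [NormedSpace ℝ G] {f : X → G}
    (hf : ContDiffOn ℝ ∞ f O) {x : X} (hx : x ∈ O) : DifferentiableAt ℝ f x :=
  (hf.hasFDerivAt_of_isOpen h.isOpen hx).differentiableAt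

theorem fderiv_of_eqOn {G : Type*} [NormedAddCommGroup G] [NormedSpace ℝ G] {f g : X → G}
    (hfg : EqOn f g O) {x : X} (hx : x ∈ O) : fderiv ℝ f x = fderiv ℝ g x :=
  (hfg.eventuallyEq_of_mem (h.isOpen.mem_nhds hx)).fderiv_eq

theorem η_A_s {x : X} (hx : x ∈ O) (i : Fin 3) (k : Fin l → ℝ) : η x (A i x (s x k)) = 0 := by
  obtain ⟨w, hw⟩ := h.map_s x hx i k
  rw [hw, h.η_ι x hx]

/-- The projection to `V` is parallel. -/
theorem fderiv_η {x : X} (hx : x ∈ O) (u : X) (e : F) :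
    fderiv ℝ η x u e = η x (Γ x u e) := by
  have hη := h.differentiableAt h.contDiffOn_η hx
  -- On `V` the frame is parallel. On the tangent bundle the covariant derivative stays tangent,
  -- where `η` vanishes. The two span `E`.
  have h1 : ∀ k, fderiv ℝ η x u (s x k) = η x (Γ x u (s x k)) := by
    intro k
    have h2 := fderiv_clm_comp_apply_apply hη (h.differentiableAt h.contDiffOn_s hx) u k
    rw [h.fderiv_of_eqOn (g := fun _ ↦ ContinuousLinearMap.id ℝ (Fin l → ℝ))
      (fun y hy ↦ ContinuousLinearMap.ext fun k ↦ h.η_s y hy k) hx, fderiv_const_apply,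
      h.parallel_s x hx, map_neg] at h2
    exact (add_neg_eq_zero.1 h2.symm)
  have h3 : ∀ w, fderiv ℝ η x u (ι x w) = η x (Γ x u (ι x w)) := by
    intro w
    have h2 := fderiv_clm_comp_apply_apply hη (h.differentiableAt h.contDiffOn_ι hx) u w
    rw [h.fderiv_of_eqOn (g := fun _ ↦ (0 : X →L[ℝ] (Fin l → ℝ)))
      (fun y hy ↦ ContinuousLinearMap.ext fun k ↦ h.η_ι y hy k) hx, fderiv_const_apply] at h2
    obtain ⟨w', hw'⟩ := h.preserves_ι x hx u w
    have h4 := h.η_ι x hx w'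
    rw [← hw', map_add] at h4
    have h5 : fderiv ℝ η x u (ι x w) + η x (fderiv ℝ ι x u w) = 0 := h2.symm
    rw [eq_neg_of_add_eq_zero_left h5, eq_neg_of_add_eq_zero_right h4]
  rw [h.eq_add x hx e, map_add, map_add, map_add, h1, h3]

theorem contDiffOn_ηA (i : Fin 3) : ContDiffOn ℝ ∞ (fun x ↦ η x ∘L A i x) O :=
  h.contDiffOn_η.clm_comp (h.contDiffOn_A i)

theorem fderiv_ηA {x : X} (hx : x ∈ O) (i : Fin 3) (u : X) (e : F) :
    fderiv ℝ (fun x ↦ η x ∘L A i x) x u e = η x (A i x (Γ x u e)) := by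
  rw [fderiv_clm_comp_apply_apply (h.differentiableAt h.contDiffOn_η hx)
    (h.differentiableAt (h.contDiffOn_A i) hx), h.fderiv_η hx, h.parallel_A x hx, map_sub]
  abel

theorem contDiffOn_alphaForm : ContDiffOn ℝ ∞ (alphaForm η A) O :=
  (contDiffOn_const.clm_comp h.contDiffOn_η).sub
    (((contDiffOn_const.clm_comp (h.contDiffOn_ηA 0)).add
      (contDiffOn_const.clm_comp (h.contDiffOn_ηA 1))).add
      (contDiffOn_const.clm_comp (h.contDiffOn_ηA 2)))

/-- `η` and the `A i` are parallel, so the projection built from them intertwines `d + Γ` with the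
trivial connection. -/
theorem fderiv_alphaForm {x : X} (hx : x ∈ O) (u : X) (e : F) :
    fderiv ℝ (alphaForm η A) x u e = alphaForm η A x (Γ x u e) := by
  have hc : ∀ (q : ℍ[ℝ]) {f : X → F →L[ℝ] Fin l → ℝ} (hf : ContDiffOn ℝ ∞ f O),
      DifferentiableAt ℝ (fun x ↦ smulL l q ∘L f x) x := fun q f hf ↦
    h.differentiableAt (contDiffOn_const.clm_comp hf) hx
  have h0 := hc 1 h.contDiffOn_η
  have h1 := fun i ↦ hc (imUnit i) (h.contDiffOn_ηA i)
  have h2 := fderiv_clm_sub_add_add h0 (h1 0) (h1 1) (h1 2)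
  unfold alphaForm
  rw [h2]
  simp only [sub_apply, add_apply, ContinuousLinearMap.comp_apply]
  rw [fderiv_const_clm_comp_apply_apply _ (h.differentiableAt h.contDiffOn_η hx),
    fderiv_const_clm_comp_apply_apply _ (h.differentiableAt (h.contDiffOn_ηA 0) hx),
    fderiv_const_clm_comp_apply_apply _ (h.differentiableAt (h.contDiffOn_ηA 1) hx),
    fderiv_const_clm_comp_apply_apply _ (h.differentiableAt (h.contDiffOn_ηA 2) hx),
    h.fderiv_η hx, h.fderiv_ηA hx, h.fderiv_ηA hx, h.fderiv_ηA hx]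

-- The signs reflect that the coefficient of `A i s` in `e` is recovered as `-η (A i e)`, since `A
-- i` squares to `-1`.
omit h [NormedAddCommGroup X] [NormedSpace ℝ X] in
theorem alphaForm_components (η : X → F →L[ℝ] (Fin l → ℝ)) (A : Fin 3 → X → F →L[ℝ] F) (x : X)
    (e : F) (a : Fin l) : (alphaForm η A x e a).re = η x e a ∧
      (alphaForm η A x e a).imI = -η x (A 0 x e) a ∧
      (alphaForm η A x e a).imJ = -η x (A 1 x e) a ∧
      (alphaForm η A x e a).imK = -η x (A 2 x e) a := by
  simp only [alphaForm, sub_apply, add_apply, ContinuousLinearMap.comp_apply, Pi.sub_apply,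
    Pi.add_apply]
  simp [smulL_apply, re_imUnit, imI_imUnit, imJ_imUnit, imK_imUnit]

/-- In each real coordinate this is the multiplication table of the triple against that of the
quaternions. -/
theorem alphaForm_A {x : X} (hx : x ∈ O) (i : Fin 3) (e : F) (a : Fin l) :
    alphaForm η A x (A i x e) a = (imUnit i : ℍ[ℝ]) * alphaForm η A x e a := by
  have ht := h.triple x hx
  obtain ⟨h1, h2, h3, h4⟩ := alphaForm_components η A x e a
  obtain ⟨k1, k2, k3, k4⟩ := alphaForm_components η A x (A i x e) a
  apply Quaternion.ext
  · rw [k1, Quaternion.re_mul, h1, h2, h3, h4]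
    fin_cases i <;> simp [re_imUnit, imI_imUnit, imJ_imUnit, imK_imUnit]
  · rw [k2, Quaternion.imI_mul, h1, h2, h3, h4]
    fin_cases i <;> simp [re_imUnit, imI_imUnit, imJ_imUnit, imK_imUnit, ht.apply_00, ht.apply_01,
      ht.apply_02]
  · rw [k3, Quaternion.imJ_mul, h1, h2, h3, h4]
    fin_cases i <;> simp [re_imUnit, imI_imUnit, imJ_imUnit, imK_imUnit, ht.apply_10, ht.apply_11,
      ht.apply_12]
  · rw [k4, Quaternion.imK_mul, h1, h2, h3, h4]
    fin_cases i <;> simp [re_imUnit, imI_imUnit, imJ_imUnit, imK_imUnit, ht.apply_20, ht.apply_21,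
      ht.apply_22]

theorem alphaForm_s {x : X} (hx : x ∈ O) (k : Fin l → ℝ) (a : Fin l) :
    alphaForm η A x (s x k) a = (k a : ℝ) := by
  obtain ⟨h1, h2, h3, h4⟩ := alphaForm_components η A x (s x k) a
  apply Quaternion.ext
  · rw [h1, h.η_s x hx]; rfl
  · rw [h2, h.η_A_s hx]; exact neg_zero
  · rw [h3, h.η_A_s hx]; exact neg_zero
  · rw [h4, h.η_A_s hx]; exact neg_zero

theorem alphaForm_ι {x : X} (hx : x ∈ O) (v : X) (a : Fin l) :
    alphaForm η A x (ι x v) a = thetaForm ι η A x v a := by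
  simp only [alphaForm, thetaForm, sub_apply, neg_apply, add_apply,
    ContinuousLinearMap.comp_apply, Pi.sub_apply, Pi.neg_apply, Pi.add_apply, smulL_apply,
    Submodule.coe_neg, Submodule.coe_add, Submodule.coe_smul, h.η_ι x hx, Pi.zero_apply, zero_smul,
    zero_sub]

theorem contDiffOn_thetaForm : ContDiffOn ℝ ∞ (thetaForm ι η A) O :=
  ContDiffOn.clm_comp (((contDiffOn_const.clm_comp (h.contDiffOn_ηA 0)).add
      (contDiffOn_const.clm_comp (h.contDiffOn_ηA 1))).add
      (contDiffOn_const.clm_comp (h.contDiffOn_ηA 2))).neg h.contDiffOn_ι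

/-- `θ` is a parallel projection composed with `ι`, so its derivative is that projection applied to
the covariant derivative of `ι`, which is symmetric by torsion freeness. Thus `θ` is closed. -/
theorem fderiv_thetaForm {x : X} (hx : x ∈ O) (u v : X) :
    fderiv ℝ (thetaForm ι η A) x u v = fderiv ℝ (thetaForm ι η A) x v u := by
  have hc : ∀ (q : ImH) (i : Fin 3),
      DifferentiableAt ℝ (fun x ↦ smulL l q ∘L (η x ∘L A i x)) x := fun q i ↦
    h.differentiableAt (contDiffOn_const.clm_comp (h.contDiffOn_ηA i)) hx
  have key : ∀ u v, fderiv ℝ (thetaForm ι η A) x u v =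
      -(smulL l (imUnit 0) ∘L (η x ∘L A 0 x) + smulL l (imUnit 1) ∘L (η x ∘L A 1 x) +
        smulL l (imUnit 2) ∘L (η x ∘L A 2 x)) (fderiv ℝ ι x u v + Γ x u (ι x v)) := by
    intro u v
    have h2 := fderiv_clm_add_add (hc (imUnit 0) 0) (hc (imUnit 1) 1) (hc (imUnit 2) 2)
    have h3 := fderiv_clm_comp_apply_apply
      (((hc (imUnit 0) 0).fun_add (hc (imUnit 1) 1)).fun_add (hc (imUnit 2) 2)).fun_neg
      (h.differentiableAt h.contDiffOn_ι hx) u v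
    unfold thetaForm
    rw [h3, fderiv_fun_neg, h2]
    simp only [neg_apply, add_apply, ContinuousLinearMap.comp_apply]
    rw [fderiv_const_clm_comp_apply_apply _ (h.differentiableAt (h.contDiffOn_ηA 0) hx),
      fderiv_const_clm_comp_apply_apply _ (h.differentiableAt (h.contDiffOn_ηA 1) hx),
      fderiv_const_clm_comp_apply_apply _ (h.differentiableAt (h.contDiffOn_ηA 2) hx),
      h.fderiv_ηA hx, h.fderiv_ηA hx, h.fderiv_ηA hx]
    simp only [map_add]
    abel
  rw [key, key, h.torsion x hx]

theorem contDiffOn_rhoMap : ContDiffOn ℝ ∞ (rhoMap s A) O :=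
  (((h.contDiffOn_A 0).clm_comp (h.contDiffOn_s.clm_comp contDiffOn_const)).add
    ((h.contDiffOn_A 1).clm_comp (h.contDiffOn_s.clm_comp contDiffOn_const))).add
    ((h.contDiffOn_A 2).clm_comp (h.contDiffOn_s.clm_comp contDiffOn_const))

omit h [NormedAddCommGroup X] [NormedSpace ℝ X] in
theorem rhoMap_apply (s : X → (Fin l → ℝ) →L[ℝ] F) (A : Fin 3 → X → F →L[ℝ] F) (x : X)
    (τ : Fin l → ImH) : rhoMap s A x τ = A 0 x (s x (coordL l 0 τ)) +
      A 1 x (s x (coordL l 1 τ)) + A 2 x (s x (coordL l 2 τ)) := rfl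

theorem exists_rhoMap_eq {x : X} (hx : x ∈ O) (τ : Fin l → ImH) : ∃ w, rhoMap s A x τ = ι x w := by
  obtain ⟨w₀, h₀⟩ := h.map_s x hx 0 (coordL l 0 τ)
  obtain ⟨w₁, h₁⟩ := h.map_s x hx 1 (coordL l 1 τ)
  obtain ⟨w₂, h₂⟩ := h.map_s x hx 2 (coordL l 2 τ)
  exact ⟨w₀ + w₁ + w₂, by rw [rhoMap_apply, h₀, h₁, h₂, map_add, map_add]⟩

theorem ι_p_rhoMap {x : X} (hx : x ∈ O) (τ : Fin l → ImH) :
    ι x (p x (rhoMap s A x τ)) = rhoMap s A x τ := by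
  obtain ⟨w, hw⟩ := h.exists_rhoMap_eq hx τ
  rw [hw, h.p_ι x hx]

omit h [NormedAddCommGroup X] [NormedSpace ℝ X] in
theorem A_s_eq_rhoMap (i : Fin 3) (x : X) (k : Fin l → ℝ) :
    A i x (s x k) = rhoMap s A x (smulL l (imUnit i) k) := by
  have h1 : ∀ j, coordL l j (smulL l (imUnit i) k) = if j = i then k else 0 := by
    intro j
    ext a
    rw [coordL_apply, smulL_apply]
    fin_cases i <;> fin_cases j <;> simp [imCoord, imI_imUnit, imJ_imUnit, imK_imUnit]
  rw [rhoMap_apply, h1, h1, h1]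
  fin_cases i <;> simp

/-- The sections are fixed combinations of `A i s`, with both `A i` and `s` parallel. -/
theorem fderiv_rhoMap {x : X} (hx : x ∈ O) (u : X) (τ : Fin l → ImH) :
    fderiv ℝ (rhoMap s A) x u τ = -Γ x u (rhoMap s A x τ) := by
  have hs := h.differentiableAt h.contDiffOn_s hx
  have hsc : ∀ i, DifferentiableAt ℝ (fun x ↦ s x ∘L coordL l i) x := fun i ↦
    h.differentiableAt (h.contDiffOn_s.clm_comp contDiffOn_const) hx
  have hA := fun i ↦ h.differentiableAt (h.contDiffOn_A i) hx
  have hc : ∀ i, DifferentiableAt ℝ (fun x ↦ A i x ∘L (s x ∘L coordL l i)) x := fun i ↦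
    (hA i).clm_comp (hsc i)
  have key : ∀ i, fderiv ℝ (fun x ↦ A i x ∘L (s x ∘L coordL l i)) x u τ =
      -Γ x u (A i x (s x (coordL l i τ))) := by
    intro i
    rw [fderiv_clm_comp_apply_apply (hA i) (hsc i), fderiv_clm_comp_const_apply_apply _ hs,
      h.parallel_A x hx, h.parallel_s x hx, map_neg]
    simp only [ContinuousLinearMap.comp_apply]
    abel
  have h2 := fderiv_clm_add_add (hc 0) (hc 1) (hc 2)
  unfold rhoMap
  rw [h2]
  simp only [add_apply, ContinuousLinearMap.comp_apply]
  rw [key, key, key]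
  simp only [map_add]
  abel

theorem alphaForm_rhoMap {x : X} (hx : x ∈ O) (τ : Fin l → ImH) (a : Fin l) :
    alphaForm η A x (rhoMap s A x τ) a = τ a := by
  rw [rhoMap_apply, map_add, map_add, Pi.add_apply, Pi.add_apply, h.alphaForm_A hx,
    h.alphaForm_A hx, h.alphaForm_A hx, h.alphaForm_s hx, h.alphaForm_s hx, h.alphaForm_s hx]
  simp only [coordL_apply, ← Quaternion.coe_commutes, Quaternion.coe_mul_eq_smul]
  exact congrArg Subtype.val (sum_imCoord_smul (τ a))

theorem thetaForm_p_rhoMap {x : X} (hx : x ∈ O) (τ : Fin l → ImH) :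
    thetaForm ι η A x (p x (rhoMap s A x τ)) = τ := by
  ext a : 2
  rw [← h.alphaForm_ι hx, h.ι_p_rhoMap hx, h.alphaForm_rhoMap hx]

theorem contDiffOn_pRho : ContDiffOn ℝ ∞ (fun x ↦ p x ∘L rhoMap s A x) O :=
  h.contDiffOn_p.clm_comp h.contDiffOn_rhoMap

/-- Differentiating `p ∘ ι = id` trades the derivative of `p` for that of `ι`, and the covariant
derivative of `ι` appears. -/
theorem fderiv_pRho {x : X} (hx : x ∈ O) (u : X) (τ : Fin l → ImH) :
    fderiv ℝ (fun x ↦ p x ∘L rhoMap s A x) x u τ =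
      -p x (fderiv ℝ ι x u (p x (rhoMap s A x τ)) + Γ x u (ι x (p x (rhoMap s A x τ)))) := by
  have hp := h.differentiableAt h.contDiffOn_p hx
  have h1 : ∀ w, fderiv ℝ p x u (ι x w) = -p x (fderiv ℝ ι x u w) := by
    intro w
    have h2 := fderiv_clm_comp_apply_apply hp (h.differentiableAt h.contDiffOn_ι hx) u w
    rw [h.fderiv_of_eqOn (g := fun _ ↦ ContinuousLinearMap.id ℝ X)
      (fun y hy ↦ ContinuousLinearMap.ext fun k ↦ h.p_ι y hy k) hx, fderiv_const_apply] at h2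
    exact eq_neg_of_add_eq_zero_left h2.symm
  rw [fderiv_clm_comp_apply_apply hp (h.differentiableAt h.contDiffOn_rhoMap hx),
    h.fderiv_rhoMap hx]
  nth_rw 1 [← h.ι_p_rhoMap hx]
  rw [h1, h.ι_p_rhoMap hx, map_add, map_neg, neg_add]

/-- The bracket of two parallel vector fields is minus their torsion, hence zero. -/
theorem fderiv_pRho_comm {x : X} (hx : x ∈ O) (σ τ : Fin l → ImH) :
    fderiv ℝ (fun x ↦ p x ∘L rhoMap s A x) x (p x (rhoMap s A x σ)) τ =
      fderiv ℝ (fun x ↦ p x ∘L rhoMap s A x) x (p x (rhoMap s A x τ)) σ := by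
  rw [h.fderiv_pRho hx, h.fderiv_pRho hx, h.torsion x hx]

end IsSplitFrame

end Split

/-! ### Dimension of quaternionic spaces and uniqueness of the Obata connection -/

/-- A vector space with a quaternionic triple is a module over the quaternions. -/
theorem IsQuaternionicTriple.four_dvd_finrank {F : Type*} [NormedAddCommGroup F] [NormedSpace ℝ F]
    {A : Fin 3 → F →L[ℝ] F} (h : IsQuaternionicTriple A) : 4 ∣ finrank ℝ F := by
  let q : QuaternionAlgebra.Basis (Module.End ℝ F) (-1 : ℝ) 0 (-1) :=
    { i := (A 0).toLinearMap
      j := (A 1).toLinearMap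
      k := (A 2).toLinearMap
      i_mul_i := by ext e; simp [h.apply_00]
      j_mul_j := by ext e; simp [h.apply_11]
      i_mul_j := by ext e; simp [h.apply_01]
      j_mul_i := by ext e; simp [h.apply_10] }
  let L : ℍ[ℝ] →ₐ[ℝ] Module.End ℝ F := q.liftHom
  let _ : Module ℍ[ℝ] F := Module.compHom F L.toRingHom
  have : IsScalarTower ℝ ℍ[ℝ] F := ⟨fun c y e ↦ by
    change L (c • y) e = c • L y e
    rw [map_smul]; rfl⟩
  rw [← Module.finrank_mul_finrank ℝ ℍ[ℝ] F, Quaternion.finrank_eq_four]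
  exact dvd_mul_right _ _

/-- By symmetry `Δ` is `J`-linear in both arguments, so `Δ (J 0 ζ) (J 1 ζ')` equals both `J 0 J 1 Δ
ζ ζ'` and `J 1 J 0 Δ ζ ζ'`. As `J 0` and `J 1` anticommute, this is zero. Applied to the difference
of two torsion free connections, it is the uniqueness of the Obata connection. -/
theorem IsQuaternionicTriple.eq_zero_of_symmetric {Z : Type*} [NormedAddCommGroup Z]
    [NormedSpace ℝ Z] {J : Fin 3 → Z →L[ℝ] Z} (hJ : IsQuaternionicTriple J)
    {Δ : Z →L[ℝ] Z →L[ℝ] Z} (hΔ : ∀ ζ ζ', Δ ζ ζ' = Δ ζ' ζ)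
    (hΔJ : ∀ i ζ ζ', Δ ζ (J i ζ') = J i (Δ ζ ζ')) : Δ = 0 := by
  ext ζ ζ'
  have h1 : Δ (J 0 ζ) (J 1 ζ') = J 1 (J 0 (Δ ζ ζ')) := by
    rw [hΔJ, hΔ, hΔJ, hΔ]
  have h2 : Δ (J 0 ζ) (J 1 ζ') = J 0 (J 1 (Δ ζ ζ')) := by
    rw [hΔ, hΔJ, hΔ, hΔJ]
  rw [hJ.apply_10] at h1
  rw [hJ.apply_01, h1, neg_eq_iff_add_eq_zero, ← two_smul ℝ, smul_eq_zero] at h2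
  have h3 : J 2 (Δ ζ ζ') = 0 := h2.resolve_left two_ne_zero
  have h4 := hJ.apply_22 (Δ ζ ζ')
  rw [h3, map_zero, eq_comm, neg_eq_zero] at h4
  exact h4

/-! ### The transverse hypercomplex structure and the local product -/

section Chart

variable {X Z : Type} [NormedAddCommGroup X] [NormedSpace ℝ X] [NormedAddCommGroup Z]
  [NormedSpace ℝ Z] {F : Type*} [NormedAddCommGroup F] [NormedSpace ℝ F] {l : ℕ}

/-- A chart, with values in `(Im ℍ)ˡ × Z`, in which `(M, E, V, ∇)` is the product of `(Im ℍ)ˡ` with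
the open subset `Z` of a vector space, endowed with a quaternionic triple `J` that is parallel for
the torsion free connection `d + C`. -/
structure IsProductChart (φ : OpenPartialHomeomorph X ((Fin l → ImH) × Z))
    (Γ : X → X →L[ℝ] F →L[ℝ] F) (ι : X → X →L[ℝ] F) (s : X → (Fin l → ℝ) →L[ℝ] F)
    (A : Fin 3 → X → F →L[ℝ] F) (J : Fin 3 → Z → Z →L[ℝ] Z) (C : Z → Z →L[ℝ] Z →L[ℝ] Z)
    (α : X → F →L[ℝ] Fin l → ℍ[ℝ]) (β : X → F →L[ℝ] Z) : Prop where
  contDiffOn_φ : ContDiffOn ℝ ∞ φ φ.source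
  contDiffOn_φ_symm : ContDiffOn ℝ ∞ φ.symm φ.target
  contDiffOn_α : ContDiffOn ℝ ∞ α φ.source
  contDiffOn_β : ContDiffOn ℝ ∞ β φ.source
  contDiff_J : ∀ i, ContDiff ℝ ∞ (J i)
  contDiff_C : ContDiff ℝ ∞ C
  triple : ∀ z, IsQuaternionicTriple fun i ↦ J i z
  C_symm : ∀ z ζ ζ', C z ζ ζ' = C z ζ' ζ
  fderiv_J : ∀ i z ζ ζ', fderiv ℝ (J i) z ζ ζ' = J i z (C z ζ ζ') - C z ζ (J i z ζ')
  bijective : ∀ x ∈ φ.source, Function.Bijective fun e ↦ (α x e, β x e)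
  α_ι : ∀ x ∈ φ.source, ∀ v a, α x (ι x v) a = (fderiv ℝ (fun y ↦ (φ y).1) x v a : ImH)
  β_ι : ∀ x ∈ φ.source, ∀ v, β x (ι x v) = fderiv ℝ (fun y ↦ (φ y).2) x v
  mem_range_s : ∀ x ∈ φ.source, ∀ e,
    (∃ k, s x k = e) ↔ (∀ a, ∃ r : ℝ, α x e a = (r : ℍ[ℝ])) ∧ β x e = 0
  α_A : ∀ x ∈ φ.source, ∀ i e a, α x (A i x e) a = (imUnit i : ℍ[ℝ]) * α x e a
  β_A : ∀ x ∈ φ.source, ∀ i e, β x (A i x e) = J i (φ x).2 (β x e)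
  fderiv_α : ∀ x ∈ φ.source, ∀ u e, fderiv ℝ α x u e = α x (Γ x u e)
  fderiv_β : ∀ x ∈ φ.source, ∀ u e, fderiv ℝ β x u e =
    β x (Γ x u e) - C (φ x).2 (fderiv ℝ (fun y ↦ (φ y).2) x u) (β x e)

/-- A parallel frame, on the domain of coordinates adapted to the form `thetaForm` and to the
commuting vector fields `p ∘ rhoMap`. -/
structure IsFoliatedChart (φ : OpenPartialHomeomorph X ((Fin l → ImH) × Z)) (t₀ : Fin l → ImH)
    (r : ℝ) (ν : X → Z →L[ℝ] X) (Γ : X → X →L[ℝ] F →L[ℝ] F) (ι : X → X →L[ℝ] F)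
    (s : X → (Fin l → ℝ) →L[ℝ] F) (A : Fin 3 → X → F →L[ℝ] F) (η : X → F →L[ℝ] (Fin l → ℝ))
    (p : X → F →L[ℝ] X) : Prop extends IsSplitFrame φ.source Γ ι s A η p where
  pos : 0 < r
  target_eq : φ.target = Metric.ball t₀ r ×ˢ univ
  contDiffOn_φ : ContDiffOn ℝ ∞ φ φ.source
  contDiffOn_φ_symm : ContDiffOn ℝ ∞ φ.symm φ.target
  contDiffOn_ν : ContDiffOn ℝ ∞ ν φ.source
  hasFDerivAt_fst : ∀ x ∈ φ.source, HasFDerivAt (fun y ↦ (φ y).1) (thetaForm ι η A x) x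
  snd_ρ : ∀ x ∈ φ.source, ∀ τ, fderiv ℝ (fun y ↦ (φ y).2) x (p x (rhoMap s A x τ)) = 0
  snd_ν : ∀ x ∈ φ.source, ∀ ζ, fderiv ℝ (fun y ↦ (φ y).2) x (ν x ζ) = ζ
  eq_add_ν : ∀ x ∈ φ.source, ∀ v, v = p x (rhoMap s A x (thetaForm ι η A x v)) +
    ν x (fderiv ℝ (fun y ↦ (φ y).2) x v)
  fderiv_symm : ∀ x ∈ φ.source, ∀ τ ζ,
    fderiv ℝ φ.symm (φ x) (τ, ζ) = p x (rhoMap s A x τ) + ν x ζ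

/-- The projection of `E` to the transverse space. -/
def betaForm (φ : OpenPartialHomeomorph X ((Fin l → ImH) × Z)) (p : X → F →L[ℝ] X) (x : X) :
    F →L[ℝ] Z :=
  fderiv ℝ (fun y ↦ (φ y).2) x ∘L p x

/-- The transverse quaternionic triple. -/
def transverseTriple (φ : OpenPartialHomeomorph X ((Fin l → ImH) × Z)) (ν : X → Z →L[ℝ] X)
    (ι : X → X →L[ℝ] F) (A : Fin 3 → X → F →L[ℝ] F) (p : X → F →L[ℝ] X) (i : Fin 3) (x : X) :
    Z →L[ℝ] Z :=
  betaForm φ p x ∘L (A i x ∘L (ι x ∘L ν x))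

/-- The transverse connection. -/
def transverseConnection (φ : OpenPartialHomeomorph X ((Fin l → ImH) × Z)) (ν : X → Z →L[ℝ] X)
    (Γ : X → X →L[ℝ] F →L[ℝ] F) (ι : X → X →L[ℝ] F) (p : X → F →L[ℝ] X) (x : X) :
    Z →L[ℝ] Z →L[ℝ] Z :=
  (ContinuousLinearMap.compL ℝ Z F Z).flip (ι x ∘L ν x) ∘L
    ((ContinuousLinearMap.compL ℝ F F Z (betaForm φ p x) ∘L Γ x - fderiv ℝ (betaForm φ p) x) ∘L
      ν x)

variable {φ : OpenPartialHomeomorph X ((Fin l → ImH) × Z)} {t₀ : Fin l → ImH}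
    {r : ℝ} {ν : X → Z →L[ℝ] X} {Γ : X → X →L[ℝ] F →L[ℝ] F} {ι : X → X →L[ℝ] F}
    {s : X → (Fin l → ℝ) →L[ℝ] F} {A : Fin 3 → X → F →L[ℝ] F} {η : X → F →L[ℝ] (Fin l → ℝ)}
    {p : X → F →L[ℝ] X}

theorem transverseConnection_apply (x : X) (ζ ζ' : Z) : transverseConnection φ ν Γ ι p x ζ ζ' =
    betaForm φ p x (Γ x (ν x ζ) (ι x (ν x ζ'))) -
      fderiv ℝ (betaForm φ p) x (ν x ζ) (ι x (ν x ζ')) := rfl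

theorem IsParallelFrame.exists_isFoliatedChart {O : Set X} [FiniteDimensional ℝ X]
    [FiniteDimensional ℝ F] {Z : Type} [NormedAddCommGroup Z] [InnerProductSpace ℝ Z]
    [FiniteDimensional ℝ Z] (h : IsParallelFrame O Γ ι s A) {x₀ : X} (hx₀ : x₀ ∈ O)
    (hdim : finrank ℝ X = finrank ℝ (Fin l → ImH) + finrank ℝ Z) :
    ∃ (φ : OpenPartialHomeomorph X ((Fin l → ImH) × Z)) (t₀ : Fin l → ImH) (r : ℝ)
      (ν : X → Z →L[ℝ] X) (η : X → F →L[ℝ] (Fin l → ℝ)) (p : X → F →L[ℝ] X),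
      x₀ ∈ φ.source ∧ φ.source ⊆ O ∧ IsFoliatedChart φ t₀ r ν Γ ι s A η p := by
  obtain ⟨O', η, p, hx, hO', hs⟩ := h.exists_isSplitFrame hx₀
  obtain ⟨φ, t₀, r, ν, hr, hxφ, hφO, ht, hφ, hφ', hν, h1, h2, h3, h4, h5⟩ :=
    exists_coordinates (Z := Z) hs.isOpen hs.contDiffOn_thetaForm hs.contDiffOn_pRho
      (fun x hx ↦ hs.fderiv_thetaForm hx) (fun x hx ↦ hs.fderiv_pRho_comm hx)
      (fun x hx ↦ hs.thetaForm_p_rhoMap hx) hx hdim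
  refine ⟨φ, t₀, r, ν, η, p, hxφ, hφO.trans hO', ?_⟩
  exact
    { toIsParallelFrame := hs.toIsParallelFrame.mono φ.open_source hφO
      contDiffOn_η := hs.contDiffOn_η.mono hφO
      contDiffOn_p := hs.contDiffOn_p.mono hφO
      η_s := fun x hx ↦ hs.η_s x (hφO hx)
      η_ι := fun x hx ↦ hs.η_ι x (hφO hx)
      p_s := fun x hx ↦ hs.p_s x (hφO hx)
      p_ι := fun x hx ↦ hs.p_ι x (hφO hx)
      eq_add := fun x hx ↦ hs.eq_add x (hφO hx)
      pos := hr
      target_eq := ht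
      contDiffOn_φ := hφ
      contDiffOn_φ_symm := hφ'
      contDiffOn_ν := hν
      hasFDerivAt_fst := h1
      snd_ρ := h2
      snd_ν := h3
      eq_add_ν := h4
      fderiv_symm := h5 }

namespace IsFoliatedChart

variable (h : IsFoliatedChart φ t₀ r ν Γ ι s A η p)

include h

theorem contDiffOn_snd : ContDiffOn ℝ ∞ (fun y ↦ (φ y).2) φ.source :=
  contDiff_snd.comp_contDiffOn h.contDiffOn_φ

theorem contDiffOn_fderiv_snd : ContDiffOn ℝ ∞ (fderiv ℝ fun y ↦ (φ y).2) φ.source :=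
  h.contDiffOn_snd.fderiv_of_isOpen h.isOpen (by simp)

theorem contDiffOn_betaForm : ContDiffOn ℝ ∞ (betaForm φ p) φ.source :=
  h.contDiffOn_fderiv_snd.clm_comp h.contDiffOn_p

theorem contDiffOn_transverseTriple (i : Fin 3) :
    ContDiffOn ℝ ∞ (transverseTriple φ ν ι A p i) φ.source :=
  h.contDiffOn_betaForm.clm_comp ((h.contDiffOn_A i).clm_comp
    (h.contDiffOn_ι.clm_comp h.contDiffOn_ν))

theorem contDiffOn_transverseConnection :
    ContDiffOn ℝ ∞ (transverseConnection φ ν Γ ι p) φ.source :=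
  ((ContinuousLinearMap.compL ℝ Z F Z).flip.contDiff.comp_contDiffOn
    (h.contDiffOn_ι.clm_comp h.contDiffOn_ν)).clm_comp
    (((((ContinuousLinearMap.compL ℝ F F Z).contDiff.comp_contDiffOn
      h.contDiffOn_betaForm).clm_comp h.contDiffOn_Γ).sub
      (h.contDiffOn_betaForm.fderiv_of_isOpen h.isOpen (by simp))).clm_comp h.contDiffOn_ν)

variable {x : X} (hx : x ∈ φ.source)

include hx

theorem betaForm_s (k : Fin l → ℝ) : betaForm φ p x (s x k) = 0 := by
  rw [betaForm, ContinuousLinearMap.comp_apply, h.p_s x hx, map_zero]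

theorem betaForm_ι (v : X) : betaForm φ p x (ι x v) = fderiv ℝ (fun y ↦ (φ y).2) x v := by
  rw [betaForm, ContinuousLinearMap.comp_apply, h.p_ι x hx]

theorem betaForm_ι_ν (ζ : Z) : betaForm φ p x (ι x (ν x ζ)) = ζ := by
  rw [h.betaForm_ι hx, h.snd_ν x hx]

theorem betaForm_ρ (τ : Fin l → ImH) : betaForm φ p x (rhoMap s A x τ) = 0 :=
  h.snd_ρ x hx τ

theorem eq_add_add (e : F) : e = s x (η x e) + rhoMap s A x (thetaForm ι η A x (p x e)) +
    ι x (ν x (betaForm φ p x e)) := by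
  rw [← h.ι_p_rhoMap hx, add_assoc, ← map_add]
  change e = s x (η x e) + ι x (_ + ν x (fderiv ℝ (fun y ↦ (φ y).2) x (p x e)))
  rw [← h.eq_add_ν x hx, ← h.eq_add x hx]

theorem betaForm_A_s (i : Fin 3) (k : Fin l → ℝ) : betaForm φ p x (A i x (s x k)) = 0 := by
  rw [IsSplitFrame.A_s_eq_rhoMap, h.betaForm_ρ hx]

/-- The relations of the triple send each `A j (s k)` to `± s k` or to `± A j' (s k)`. So the kernel
`V + IV + JV + KV` of the projection is quaternionic. -/
theorem betaForm_A_ρ (i : Fin 3) (τ : Fin l → ImH) :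
    betaForm φ p x (A i x (rhoMap s A x τ)) = 0 := by
  have ht := h.triple x hx
  have h1 := h.betaForm_A_s hx
  have h2 := h.betaForm_s hx
  rw [IsSplitFrame.rhoMap_apply]
  fin_cases i <;> simp [ht.apply_00, ht.apply_01, ht.apply_02, ht.apply_10, ht.apply_11,
    ht.apply_12, ht.apply_20, ht.apply_21, ht.apply_22, h1, h2]

/-- The kernel of the projection is stable under `A i`, so `A i` descends to the transverse space.
-/
theorem betaForm_A (i : Fin 3) (e : F) :
    betaForm φ p x (A i x e) = transverseTriple φ ν ι A p i x (betaForm φ p x e) := by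
  conv_lhs => rw [h.eq_add_add hx e]
  rw [map_add, map_add, map_add, map_add, h.betaForm_A_s hx, h.betaForm_A_ρ hx, add_zero, zero_add]
  rfl

theorem isQuaternionicTriple_transverseTriple :
    IsQuaternionicTriple fun i ↦ transverseTriple φ ν ι A p i x := by
  have ht := h.triple x hx
  have key : ∀ i j ζ, transverseTriple φ ν ι A p i x (transverseTriple φ ν ι A p j x ζ) =
      betaForm φ p x (A i x (A j x (ι x (ν x ζ)))) := by
    intro i j ζ
    rw [h.betaForm_A hx]; rfl
  refine ⟨?_, ?_, ?_, ?_⟩ <;> ext ζ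
  · refine (key 0 0 ζ).trans ?_
    rw [ht.apply_00, map_neg, h.betaForm_ι_ν hx]; rfl
  · refine (key 1 1 ζ).trans ?_
    rw [ht.apply_11, map_neg, h.betaForm_ι_ν hx]; rfl
  · refine (key 0 1 ζ).trans ?_
    rw [ht.apply_01]; rfl
  · refine (key 1 0 ζ).trans ?_
    rw [ht.apply_10, map_neg]; rfl

theorem fderiv_betaForm_s (u : X) (k : Fin l → ℝ) :
    fderiv ℝ (betaForm φ p) x u (s x k) = betaForm φ p x (Γ x u (s x k)) := by
  have h2 := fderiv_clm_comp_apply_apply (h.differentiableAt h.contDiffOn_betaForm hx)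
    (h.differentiableAt h.contDiffOn_s hx) u k
  rw [h.fderiv_of_eqOn (g := fun _ ↦ (0 : (Fin l → ℝ) →L[ℝ] Z))
    (fun y hy ↦ ContinuousLinearMap.ext fun k ↦ h.betaForm_s hy k) hx, fderiv_const_apply,
    h.parallel_s x hx, map_neg] at h2
  exact add_neg_eq_zero.1 h2.symm

theorem fderiv_betaForm_ρ (u : X) (τ : Fin l → ImH) :
    fderiv ℝ (betaForm φ p) x u (rhoMap s A x τ) = betaForm φ p x (Γ x u (rhoMap s A x τ)) := by
  have h2 := fderiv_clm_comp_apply_apply (h.differentiableAt h.contDiffOn_betaForm hx)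
    (h.differentiableAt h.contDiffOn_rhoMap hx) u τ
  rw [h.fderiv_of_eqOn (g := fun _ ↦ (0 : (Fin l → ImH) →L[ℝ] Z))
    (fun y hy ↦ ContinuousLinearMap.ext fun k ↦ h.betaForm_ρ hy k) hx, fderiv_const_apply,
    h.fderiv_rhoMap hx, map_neg] at h2
  exact add_neg_eq_zero.1 h2.symm

/-- The expression `β Γ - dβ` vanishes on the parallel sections `s` and `ρ`, which `β` annihilates
identically; only the transverse component of `e` matters. -/
theorem betaForm_Γ_sub_eq (u : X) (e : F) :
    betaForm φ p x (Γ x u e) - fderiv ℝ (betaForm φ p) x u e =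
      betaForm φ p x (Γ x u (ι x (ν x (betaForm φ p x e)))) -
        fderiv ℝ (betaForm φ p) x u (ι x (ν x (betaForm φ p x e))) := by
  conv_lhs => rw [h.eq_add_add hx e]
  simp only [map_add]
  rw [h.fderiv_betaForm_s hx, h.fderiv_betaForm_ρ hx]
  abel

/-- On the tangent bundle `β` is the differential of the `z` coordinate. The symmetry of second
derivatives and the vanishing torsion give the symmetry in `u` and `v`. -/
theorem betaForm_Γ_sub_symm (u v : X) :
    betaForm φ p x (Γ x u (ι x v)) - fderiv ℝ (betaForm φ p) x u (ι x v) =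
      betaForm φ p x (Γ x v (ι x u)) - fderiv ℝ (betaForm φ p) x v (ι x u) := by
  have key : ∀ u v, fderiv ℝ (betaForm φ p) x u (ι x v) =
      fderiv ℝ (fderiv ℝ fun y ↦ (φ y).2) x u v - betaForm φ p x (fderiv ℝ ι x u v) := by
    intro u v
    have h2 := fderiv_clm_comp_apply_apply (h.differentiableAt h.contDiffOn_betaForm hx)
      (h.differentiableAt h.contDiffOn_ι hx) u v
    rw [h.fderiv_of_eqOn (g := fderiv ℝ fun y ↦ (φ y).2)
      (fun y hy ↦ ContinuousLinearMap.ext fun k ↦ h.betaForm_ι hy k) hx] at h2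
    rw [h2, add_sub_cancel_right]
  have hsymm : fderiv ℝ (fderiv ℝ fun y ↦ (φ y).2) x u v =
      fderiv ℝ (fderiv ℝ fun y ↦ (φ y).2) x v u :=
    (h.contDiffOn_snd.contDiffAt (h.isOpen.mem_nhds hx)).isSymmSndFDerivAt
      (by rw [minSmoothness_of_isRCLikeNormedField]; exact ENat.LEInfty.out) u v
  have ht := congrArg (betaForm φ p x) (h.torsion x hx u v)
  rw [map_add, map_add] at ht
  rw [key, key, hsymm, sub_sub_eq_add_sub, sub_sub_eq_add_sub, add_comm, ht, add_comm]

theorem transverseConnection_symm (ζ ζ' : Z) : transverseConnection φ ν Γ ι p x ζ ζ' =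
    transverseConnection φ ν Γ ι p x ζ' ζ :=
  h.betaForm_Γ_sub_symm hx _ _

/-- `β Γ - dβ` depends on its bundle argument only through `β`. By symmetry it depends on its
direction only transversally, too, and so it is the pullback of the transverse connection. -/
theorem fderiv_betaForm (u : X) (e : F) : fderiv ℝ (betaForm φ p) x u e =
    betaForm φ p x (Γ x u e) - transverseConnection φ ν Γ ι p x
      (fderiv ℝ (fun y ↦ (φ y).2) x u) (betaForm φ p x e) := by
  rw [eq_sub_iff_add_eq, ← eq_sub_iff_add_eq', h.betaForm_Γ_sub_eq hx, h.betaForm_Γ_sub_symm hx,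
    h.betaForm_Γ_sub_eq hx, h.betaForm_ι hx, transverseConnection_apply,
    h.betaForm_Γ_sub_symm hx]

/-- Obtained by differentiating `β A = J β` with `A` parallel. The direction enters only through the
`z` coordinate, so the triple does not change along the leaves. -/
theorem fderiv_transverseTriple (i : Fin 3) (u : X) (ζ : Z) :
    fderiv ℝ (transverseTriple φ ν ι A p i) x u ζ =
      transverseTriple φ ν ι A p i x (transverseConnection φ ν Γ ι p x
        (fderiv ℝ (fun y ↦ (φ y).2) x u) ζ) -
      transverseConnection φ ν Γ ι p x (fderiv ℝ (fun y ↦ (φ y).2) x u)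
        (transverseTriple φ ν ι A p i x ζ) := by
  have hβ := h.differentiableAt h.contDiffOn_betaForm hx
  have h1 := fderiv_clm_comp_apply_apply hβ (h.differentiableAt (h.contDiffOn_A i) hx) u
    (ι x (ν x ζ))
  rw [h.fderiv_of_eqOn (g := fun x ↦ transverseTriple φ ν ι A p i x ∘L betaForm φ p x)
      (fun y hy ↦ ContinuousLinearMap.ext fun e ↦ h.betaForm_A hy i e) hx,
    fderiv_clm_comp_apply_apply (h.differentiableAt (h.contDiffOn_transverseTriple i) hx) hβ,
    h.fderiv_betaForm hx, h.fderiv_betaForm hx, h.parallel_A x hx, h.betaForm_ι_ν hx, map_sub,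
    map_sub, h.betaForm_A hx, h.betaForm_A hx, h.betaForm_ι_ν hx] at h1
  rw [eq_sub_of_add_eq h1]
  abel

omit hx in
theorem mk_mem_target (z : Z) : (t₀, z) ∈ φ.target := by
  rw [h.target_eq]
  exact ⟨Metric.mem_ball_self h.pos, mem_univ _⟩

omit hx in
theorem hasFDerivAt_symm {q : (Fin l → ImH) × Z} (hq : q ∈ φ.target) :
    HasFDerivAt φ.symm (fderiv ℝ φ.symm q) q :=
  h.contDiffOn_φ_symm.hasFDerivAt_of_isOpen φ.open_target hq

/-- A function whose derivative vanishes along the leaves factors through `φ.2`. -/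
theorem eq_of_fderiv_eq_zero {W : Type*} [NormedAddCommGroup W] [NormedSpace ℝ W] {f : X → W}
    (hf : ContDiffOn ℝ ∞ f φ.source)
    (hf' : ∀ y ∈ φ.source, ∀ τ, fderiv ℝ f y (p y (rhoMap s A y τ)) = 0) :
    f x = f (φ.symm (t₀, (φ x).2)) := by
  have htx := φ.map_source hx
  rw [h.target_eq] at htx
  have hmem : ∀ t ∈ Metric.ball t₀ r, (t, (φ x).2) ∈ φ.target := fun t ht ↦ by
    rw [h.target_eq]; exact ⟨ht, mem_univ _⟩
  have hd : ∀ t ∈ Metric.ball t₀ r,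
      HasFDerivAt (fun t ↦ f (φ.symm (t, (φ x).2))) (0 : (Fin l → ImH) →L[ℝ] W) t := by
    intro t ht
    have hy := φ.map_target (hmem t ht)
    have h1 : HasFDerivAt f _ (φ.symm (t, (φ x).2)) := hf.hasFDerivAt_of_isOpen h.isOpen hy
    have h2 := h1.comp (t, (φ x).2) (h.hasFDerivAt_symm (hmem t ht))
    have h3 := HasFDerivAt.comp t (g := f ∘ φ.symm) h2
      (hasFDerivAt_prodMk_left (𝕜 := ℝ) t (φ x).2)
    refine h3.congr_fderiv (ContinuousLinearMap.ext fun τ ↦ ?_)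
    have h4 := h.fderiv_symm _ hy τ 0
    rw [φ.right_inv (hmem t ht), map_zero, add_zero] at h4
    change fderiv ℝ f _ (fderiv ℝ φ.symm (t, (φ x).2) (τ, 0)) = 0
    rw [h4, hf' _ hy]
  -- The target is a ball times `Z`, so each leaf is a ball, hence connected.
  have h5 := Metric.isOpen_ball.is_const_of_fderiv_eq_zero (𝕜 := ℝ)
    (convex_ball t₀ r).isPreconnected
    (fun t ht ↦ (hd t ht).differentiableAt.differentiableWithinAt) (fun t ht ↦ (hd t ht).fderiv)
    htx.1 (Metric.mem_ball_self h.pos)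
  have h6 : φ.symm ((φ x).1, (φ x).2) = x := φ.left_inv hx
  rwa [h6] at h5

omit hx in
theorem contDiff_slice {W : Type*} [NormedAddCommGroup W] [NormedSpace ℝ W] {f : X → W}
    (hf : ContDiffOn ℝ ∞ f φ.source) : ContDiff ℝ ∞ fun z ↦ f (φ.symm (t₀, z)) := by
  rw [← contDiffOn_univ]
  exact hf.comp (h.contDiffOn_φ_symm.comp (contDiff_const.prodMk contDiff_id).contDiffOn
    fun z _ ↦ h.mk_mem_target z) fun z _ ↦ φ.map_target (h.mk_mem_target z)

omit hx in
theorem fderiv_slice {W : Type*} [NormedAddCommGroup W] [NormedSpace ℝ W] {f : X → W}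
    (hf : ContDiffOn ℝ ∞ f φ.source) (z ζ : Z) : fderiv ℝ (fun z ↦ f (φ.symm (t₀, z))) z ζ =
      fderiv ℝ f (φ.symm (t₀, z)) (ν (φ.symm (t₀, z)) ζ) := by
  have hz := h.mk_mem_target z
  have hy := φ.map_target hz
  have h1 : HasFDerivAt f _ (φ.symm (t₀, z)) := hf.hasFDerivAt_of_isOpen h.isOpen hy
  have h2 := h1.comp (t₀, z) (h.hasFDerivAt_symm hz)
  have h3 := HasFDerivAt.comp z (g := f ∘ φ.symm) h2 (hasFDerivAt_prodMk_right t₀ z)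
  have h4 := h.fderiv_symm _ hy 0 ζ
  rw [φ.right_inv hz, map_zero, map_zero, zero_add] at h4
  rw [← h4]
  exact congrArg (fun L : Z →L[ℝ] W ↦ L ζ) h3.fderiv

theorem transverseTriple_eq_slice (i : Fin 3) : transverseTriple φ ν ι A p i x =
    transverseTriple φ ν ι A p i (φ.symm (t₀, (φ x).2)) :=
  h.eq_of_fderiv_eq_zero hx (h.contDiffOn_transverseTriple i) fun y hy τ ↦ by
    ext ζ
    rw [h.fderiv_transverseTriple hy, h.snd_ρ y hy, map_zero]
    simp

omit hx in
theorem fderiv_transverseTriple_slice (i : Fin 3) (z ζ ζ' : Z) :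
    fderiv ℝ (fun z ↦ transverseTriple φ ν ι A p i (φ.symm (t₀, z))) z ζ ζ' =
      transverseTriple φ ν ι A p i (φ.symm (t₀, z))
        (transverseConnection φ ν Γ ι p (φ.symm (t₀, z)) ζ ζ') -
      transverseConnection φ ν Γ ι p (φ.symm (t₀, z)) ζ
        (transverseTriple φ ν ι A p i (φ.symm (t₀, z)) ζ') := by
  have hy := φ.map_target (h.mk_mem_target z)
  rw [h.fderiv_slice (h.contDiffOn_transverseTriple i), h.fderiv_transverseTriple hy,
    h.snd_ν _ hy]

/-- The transverse connection is the Obata connection of the transverse triple. In particular, it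
is constant along the leaves. -/
theorem transverseConnection_eq_slice : transverseConnection φ ν Γ ι p x =
    transverseConnection φ ν Γ ι p (φ.symm (t₀, (φ x).2)) := by
  have hy := φ.map_target (h.mk_mem_target (φ x).2)
  rw [← sub_eq_zero]
  -- Both connection forms are symmetric and satisfy `dJ = [J, C]` with the same `J`, as is seen by
  -- differentiating along `ν ζ` the equality of `J` at `x` and at its slice point. Hence their
  -- difference commutes with `J`.
  refine (h.isQuaternionicTriple_transverseTriple hx).eq_zero_of_symmetric (fun ζ ζ' ↦ ?_)
    fun i ζ ζ' ↦ ?_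
  · simp only [sub_apply]
    rw [h.transverseConnection_symm hx, h.transverseConnection_symm hy]
  · have hd := (h.contDiff_slice (h.contDiffOn_transverseTriple i)).differentiable
      (by simp) (φ x).2
    have h1 := hd.hasFDerivAt.comp x
      (h.contDiffOn_snd.hasFDerivAt_of_isOpen h.isOpen hx)
    have h2 := h.fderiv_of_eqOn (fun y hy ↦ h.transverseTriple_eq_slice hy i) hx
    have h3 : fderiv ℝ (fun y ↦ transverseTriple φ ν ι A p i (φ.symm (t₀, (φ y).2))) x = _ :=
      h1.fderiv
    have h4 := congrArg (fun L : X →L[ℝ] Z →L[ℝ] Z ↦ L (ν x ζ) ζ') (h2.trans h3)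
    simp only [ContinuousLinearMap.comp_apply] at h4
    rw [h.fderiv_transverseTriple hx, h.fderiv_transverseTriple_slice, h.snd_ν x hx,
      ← h.transverseTriple_eq_slice hx] at h4
    simp only [sub_apply, map_sub]
    rw [sub_eq_sub_iff_add_eq_add] at h4 ⊢
    rw [add_comm, ← h4, add_comm]

theorem bijective_alphaForm_betaForm :
    Function.Bijective fun e ↦ (alphaForm η A x e, betaForm φ p x e) := by
  constructor
  · intro e e' hee
    obtain ⟨h1, h2⟩ := Prod.ext_iff.1 hee
    dsimp only at h1 h2
    have h3 : η x e = η x e' := by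
      ext a
      rw [← (IsSplitFrame.alphaForm_components η A x e a).1,
        ← (IsSplitFrame.alphaForm_components η A x e' a).1, h1]
    have h4 : thetaForm ι η A x (p x e) = thetaForm ι η A x (p x e') := by
      have h5 : alphaForm η A x (ι x (p x e)) = alphaForm η A x (ι x (p x e')) := by
        rw [← sub_eq_of_eq_add' (h.eq_add x hx e), ← sub_eq_of_eq_add' (h.eq_add x hx e'), map_sub,
          map_sub, h1, h3]
      ext a : 2
      rw [← h.alphaForm_ι hx, h5, h.alphaForm_ι hx]
    rw [h.eq_add_add hx e, h.eq_add_add hx e', h2, h3, h4]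
  · rintro ⟨q, ζ⟩
    let k : Fin l → ℝ := fun a ↦ (q a).re
    let τ : Fin l → ImH := fun a ↦ ⟨⟨0, (q a).imI, (q a).imJ, (q a).imK⟩, rfl⟩
    -- `ν ζ` is its own transverse part, so its component along the leaves is zero.
    have hθ : thetaForm ι η A x (ν x ζ) = 0 := by
      have h1 := h.eq_add_ν x hx (ν x ζ)
      rw [h.snd_ν x hx, right_eq_add] at h1
      rw [← h.thetaForm_p_rhoMap hx (thetaForm ι η A x (ν x ζ)), h1, map_zero]
    refine ⟨s x k + rhoMap s A x τ + ι x (ν x ζ), Prod.ext ?_ ?_⟩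
    · funext a
      change alphaForm η A x _ a = q a
      rw [map_add, map_add, Pi.add_apply, Pi.add_apply, h.alphaForm_s hx, h.alphaForm_rhoMap hx,
        h.alphaForm_ι hx, hθ]
      rw [Pi.zero_apply, ZeroMemClass.coe_zero, add_zero]
      apply Quaternion.ext
      exacts [add_zero _, zero_add _, zero_add _, zero_add _]
    · change betaForm φ p x _ = ζ
      rw [map_add, map_add, h.betaForm_s hx, h.betaForm_ρ hx, h.betaForm_ι_ν hx]
      abel

theorem exists_s_eq_iff (e : F) : (∃ k, s x k = e) ↔
    (∀ a, ∃ r : ℝ, alphaForm η A x e a = (r : ℍ[ℝ])) ∧ betaForm φ p x e = 0 := by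
  constructor
  · rintro ⟨k, rfl⟩
    exact ⟨fun a ↦ ⟨k a, h.alphaForm_s hx k a⟩, h.betaForm_s hx k⟩
  · rintro ⟨h1, h2⟩
    choose k hk using h1
    refine ⟨k, (h.bijective_alphaForm_betaForm hx).1 (Prod.ext ?_ ?_)⟩
    · funext a
      change alphaForm η A x (s x k) a = alphaForm η A x e a
      rw [h.alphaForm_s hx, hk]
    · exact (h.betaForm_s hx k).trans h2.symm

-- The structure on the second factor is read off on the slice `t = t₀`. This loses nothing because
-- the triple and the connection are constant along the leaves.
omit hx in
theorem isProductChart : IsProductChart φ Γ ι s A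
    (fun i z ↦ transverseTriple φ ν ι A p i (φ.symm (t₀, z)))
    (fun z ↦ transverseConnection φ ν Γ ι p (φ.symm (t₀, z))) (alphaForm η A) (betaForm φ p) where
  contDiffOn_φ := h.contDiffOn_φ
  contDiffOn_φ_symm := h.contDiffOn_φ_symm
  contDiffOn_α := h.contDiffOn_alphaForm
  contDiffOn_β := h.contDiffOn_betaForm
  contDiff_J i := h.contDiff_slice (h.contDiffOn_transverseTriple i)
  contDiff_C := h.contDiff_slice h.contDiffOn_transverseConnection
  triple z := h.isQuaternionicTriple_transverseTriple (φ.map_target (h.mk_mem_target z))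
  C_symm z := h.transverseConnection_symm (φ.map_target (h.mk_mem_target z))
  fderiv_J := h.fderiv_transverseTriple_slice
  bijective x hx := h.bijective_alphaForm_betaForm hx
  α_ι x hx v a := by rw [h.alphaForm_ι hx, (h.hasFDerivAt_fst x hx).fderiv]
  β_ι x hx := h.betaForm_ι hx
  mem_range_s x hx := h.exists_s_eq_iff hx
  α_A x hx := h.alphaForm_A hx
  β_A x hx i e := by rw [h.betaForm_A hx, h.transverseTriple_eq_slice hx]
  fderiv_α x hx := h.fderiv_alphaForm hx
  fderiv_β x hx u e := by rw [h.fderiv_betaForm hx, h.transverseConnection_eq_slice hx]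

end IsFoliatedChart

end Chart

/-! ### Dimension count and local normal form -/

theorem finrank_ImH : finrank ℝ ImH = 3 := by
  have h1 := LinearMap.finrank_range_add_finrank_ker
    (QuaternionAlgebra.reₗ (-1 : ℝ) (0 : ℝ) (-1 : ℝ))
  have h2 : LinearMap.range (QuaternionAlgebra.reₗ (-1 : ℝ) (0 : ℝ) (-1 : ℝ)) = ⊤ :=
    LinearMap.range_eq_top.2 fun r ↦ ⟨⟨r, 0, 0, 0⟩, rfl⟩
  rw [h2, finrank_top, finrank_self] at h1
  have h3 : finrank ℝ ℍ[ℝ] = 4 := Quaternion.finrank_eq_four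
  have h4 : finrank ℝ ImH = finrank ℝ (LinearMap.ker
    (QuaternionAlgebra.reₗ (-1 : ℝ) (0 : ℝ) (-1 : ℝ))) := rfl
  have h5 : finrank ℝ (QuaternionAlgebra ℝ (-1) 0 (-1)) = 4 := h3
  omega

/-- The local form of the almost `f`-quaternionic structures with compatible torsion free
connections. -/
theorem IsParallelFrame.exists_isProductChart {X : Type} [NormedAddCommGroup X] [NormedSpace ℝ X]
    [FiniteDimensional ℝ X] {F : Type*} [NormedAddCommGroup F] [NormedSpace ℝ F]
    [FiniteDimensional ℝ F] {l : ℕ} {O : Set X} {Γ : X → X →L[ℝ] F →L[ℝ] F} {ι : X → X →L[ℝ] F}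
    {s : X → (Fin l → ℝ) →L[ℝ] F} {A : Fin 3 → X → F →L[ℝ] F} (h : IsParallelFrame O Γ ι s A)
    {x₀ : X} (hx₀ : x₀ ∈ O) (hrank : 4 * l < finrank ℝ F) :
    ∃ (m : ℕ) (φ : OpenPartialHomeomorph X ((Fin l → ImH) × EuclideanSpace ℝ (Fin (4 * m))))
      (J : Fin 3 → EuclideanSpace ℝ (Fin (4 * m)) →
        EuclideanSpace ℝ (Fin (4 * m)) →L[ℝ] EuclideanSpace ℝ (Fin (4 * m)))
      (C : EuclideanSpace ℝ (Fin (4 * m)) → EuclideanSpace ℝ (Fin (4 * m)) →L[ℝ]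
        EuclideanSpace ℝ (Fin (4 * m)) →L[ℝ] EuclideanSpace ℝ (Fin (4 * m)))
      (α : X → F →L[ℝ] Fin l → ℍ[ℝ]) (β : X → F →L[ℝ] EuclideanSpace ℝ (Fin (4 * m))),
      x₀ ∈ φ.source ∧ φ.source ⊆ O ∧ IsProductChart φ Γ ι s A J C α β := by
  obtain ⟨k, hk⟩ := (h.triple x₀ hx₀).four_dvd_finrank
  have h1 : finrank ℝ X + l = finrank ℝ F := by
    have h2 := Submodule.finrank_add_eq_of_isCompl (h.isCompl x₀ hx₀)
    rw [LinearMap.finrank_range_of_inj (h.injective_s x₀ hx₀),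
      LinearMap.finrank_range_of_inj (h.injective_ι x₀ hx₀), finrank_fin_fun] at h2
    omega
  -- If `F` has dimension `4 k`, the base has dimension `4 k - l = 3 l + 4 (k - l)`. The rank
  -- hypothesis gives `l < k`, so the subtraction does not truncate.
  obtain ⟨φ, t₀, r, ν, η, p, hxφ, hφ, hc⟩ :=
    h.exists_isFoliatedChart (Z := EuclideanSpace ℝ (Fin (4 * (k - l)))) hx₀ (by
      rw [finrank_euclideanSpace_fin, finrank_pi_fintype]
      simp only [finrank_ImH, Finset.sum_const, Finset.card_univ, Fintype.card_fin, smul_eq_mul]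
      omega)
  exact ⟨k - l, φ, _, _, _, _, hxφ, hφ, hc.isProductChart⟩

/-! ### Functions on a manifold read in a chart -/

section ChartRep

variable {n : ℕ} {M : Type*} [TopologicalSpace M] [ChartedSpace (EuclideanSpace ℝ (Fin n)) M]
  [IsManifold (𝓡 n) ∞ M] {W : Type*} [NormedAddCommGroup W] [NormedSpace ℝ W] {f : M → W}
  {x₀ y : M}

theorem contMDiffAt_iff_contDiffAt_comp_chartAt_symm
    (hy : y ∈ (chartAt (EuclideanSpace ℝ (Fin n)) x₀).source) :
    ContMDiffAt (𝓡 n) 𝓘(ℝ, W) ∞ f y ↔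
      ContDiffAt ℝ ∞ (f ∘ (chartAt (EuclideanSpace ℝ (Fin n)) x₀).symm)
        (chartAt (EuclideanSpace ℝ (Fin n)) x₀ y) := by
  set c := chartAt (EuclideanSpace ℝ (Fin n)) x₀
  have h1 : ContMDiffAt (𝓡 n) (𝓡 n) ∞ c.symm (c y) :=
    (contMDiffOn_chart_symm (x := x₀)).contMDiffAt (c.open_target.mem_nhds (c.map_source hy))
  have h2 : ContMDiffAt (𝓡 n) (𝓡 n) ∞ c y :=
    (contMDiffOn_chart (x := x₀)).contMDiffAt (c.open_source.mem_nhds hy)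
  constructor
  · intro h
    rw [← c.left_inv hy] at h
    exact (ContMDiffAt.comp (c y) h h1).contDiffAt
  · intro h
    refine (ContMDiffAt.comp y h.contMDiffAt h2).congr_of_eventuallyEq ?_
    filter_upwards [c.open_source.mem_nhds hy] with z hz
    simp [c.left_inv hz]

theorem mdifferentiableAt_iff_differentiableAt_comp_chartAt_symm
    (hy : y ∈ (chartAt (EuclideanSpace ℝ (Fin n)) x₀).source) :
    MDifferentiableAt (𝓡 n) 𝓘(ℝ, W) f y ↔
      DifferentiableAt ℝ (f ∘ (chartAt (EuclideanSpace ℝ (Fin n)) x₀).symm)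
        (chartAt (EuclideanSpace ℝ (Fin n)) x₀ y) := by
  set c := chartAt (EuclideanSpace ℝ (Fin n)) x₀
  have h1 : MDifferentiableAt (𝓡 n) (𝓡 n) c.symm (c y) :=
    ((contMDiffOn_chart_symm (x := x₀) (n := ∞)).contMDiffAt
      (c.open_target.mem_nhds (c.map_source hy))).mdifferentiableAt (by simp)
  have h2 : MDifferentiableAt (𝓡 n) (𝓡 n) c y :=
    ((contMDiffOn_chart (x := x₀) (n := ∞)).contMDiffAt (c.open_source.mem_nhds hy)).mdifferentiableAt
      (by simp)
  constructor
  · intro h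
    rw [← c.left_inv hy] at h
    exact (MDifferentiableAt.comp (c y) h h1).differentiableAt
  · intro h
    refine (MDifferentiableAt.comp y h.mdifferentiableAt h2).congr_of_eventuallyEq ?_
    filter_upwards [c.open_source.mem_nhds hy] with z hz
    simp [c.left_inv hz]

/-- The trivialization of the tangent bundle at `x₀` is the differential of the chart at `x₀`. -/
theorem hasMFDerivAt_chartAt (hy : y ∈ (chartAt (EuclideanSpace ℝ (Fin n)) x₀).source) :
    HasMFDerivAt (𝓡 n) (𝓡 n) (chartAt (EuclideanSpace ℝ (Fin n)) x₀) y
      ((trivializationAt (EuclideanSpace ℝ (Fin n)) (TangentSpace (𝓡 n)) x₀).continuousLinearMapAt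
        ℝ y) := by
  have h2 : MDifferentiableAt (𝓡 n) (𝓡 n) (chartAt (EuclideanSpace ℝ (Fin n)) x₀) y :=
    ((contMDiffOn_chart (x := x₀) (n := ∞)).contMDiffAt ((chartAt _ x₀).open_source.mem_nhds
      hy)).mdifferentiableAt (by simp)
  rw [TangentBundle.continuousLinearMapAt_trivializationAt hy]
  exact h2.hasMFDerivAt

theorem mvfderiv_eq_fderiv_comp_chartAt_symm
    (hy : y ∈ (chartAt (EuclideanSpace ℝ (Fin n)) x₀).source)
    (hf : MDifferentiableAt (𝓡 n) 𝓘(ℝ, W) f y) (v : TangentSpace (𝓡 n) y) :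
    mvfderiv (𝓡 n) f y v = fderiv ℝ (f ∘ (chartAt (EuclideanSpace ℝ (Fin n)) x₀).symm)
        (chartAt (EuclideanSpace ℝ (Fin n)) x₀ y)
      ((trivializationAt (EuclideanSpace ℝ (Fin n)) (TangentSpace (𝓡 n)) x₀).continuousLinearMapAt
        ℝ y v) := by
  have h1 := (mdifferentiableAt_iff_differentiableAt_comp_chartAt_symm hy).1 hf
  have h2 := HasMFDerivAt.comp y h1.hasFDerivAt.hasMFDerivAt (hasMFDerivAt_chartAt hy)
  have h3 := h2.congr_of_eventuallyEq (f₁ := f) (by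
    filter_upwards [(chartAt (EuclideanSpace ℝ (Fin n)) x₀).open_source.mem_nhds hy] with z hz
    simp [(chartAt (EuclideanSpace ℝ (Fin n)) x₀).left_inv hz])
  exact congrArg (fun L : TangentSpace (𝓡 n) y →L[ℝ] W ↦ L v) h3.mfderiv

end ChartRep

/-! ### Sections and bundle morphisms read in trivializations -/

section BundleRep

variable {n : ℕ} {M : Type*} [TopologicalSpace M] [ChartedSpace (EuclideanSpace ℝ (Fin n)) M]
  [IsManifold (𝓡 n) ∞ M]
  {F : Type*} [NormedAddCommGroup F] [NormedSpace ℝ F]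
  {E : M → Type*} [TopologicalSpace (TotalSpace F E)]
  [∀ x, AddCommGroup (E x)] [∀ x, Module ℝ (E x)] [∀ x, TopologicalSpace (E x)]
  [FiberBundle F E] [VectorBundle ℝ F E] [ContMDiffVectorBundle ∞ F E (𝓡 n)]
  {x₀ y : M} {s : ∀ x, E x}

omit [IsManifold (𝓡 n) ∞ M] in
theorem contMDiffAt_section_iff_continuousLinearMapAt
    (hy : y ∈ (trivializationAt F E x₀).baseSet) :
    ContMDiffAt (𝓡 n) ((𝓡 n).prod 𝓘(ℝ, F)) ∞ (fun x ↦ TotalSpace.mk' F x (s x)) y ↔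
      ContMDiffAt (𝓡 n) 𝓘(ℝ, F) ∞
        (fun x ↦ (trivializationAt F E x₀).continuousLinearMapAt ℝ x (s x)) y := by
  rw [(trivializationAt F E x₀).contMDiffAt_section_iff hy]
  apply Filter.EventuallyEq.contMDiffAt_iff
  filter_upwards [(trivializationAt F E x₀).open_baseSet.mem_nhds hy] with z hz
  exact (Trivialization.continuousLinearMapAt_apply_of_mem (R := ℝ) _ hz _).symm

omit [IsManifold (𝓡 n) ∞ M] in
theorem mdifferentiableAt_section_iff_continuousLinearMapAt
    (hy : y ∈ (trivializationAt F E x₀).baseSet) :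
    MDifferentiableAt (𝓡 n) ((𝓡 n).prod 𝓘(ℝ, F)) (fun x ↦ TotalSpace.mk' F x (s x)) y ↔
      MDifferentiableAt (𝓡 n) 𝓘(ℝ, F)
        (fun x ↦ (trivializationAt F E x₀).continuousLinearMapAt ℝ x (s x)) y := by
  have : ContMDiffVectorBundle 1 F E (𝓡 n) := ContMDiffVectorBundle.of_le (n := ∞) (by simp)
  rw [(trivializationAt F E x₀).mdifferentiableAt_section_iff (𝓡 n) s hy]
  apply Filter.EventuallyEq.mdifferentiableAt_iff
  filter_upwards [(trivializationAt F E x₀).open_baseSet.mem_nhds hy] with z hz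
  exact (Trivialization.continuousLinearMapAt_apply_of_mem (R := ℝ) _ hz _).symm


omit [IsManifold (𝓡 n) ∞ M] in
theorem mdifferentiableAt_symmL (hy : y ∈ (trivializationAt F E x₀).baseSet) {f : M → F}
    (hf : MDifferentiableAt (𝓡 n) 𝓘(ℝ, F) f y) :
    MDifferentiableAt (𝓡 n) ((𝓡 n).prod 𝓘(ℝ, F))
      (fun x ↦ TotalSpace.mk' F x ((trivializationAt F E x₀).symmL ℝ x (f x))) y := by
  rw [mdifferentiableAt_section_iff_continuousLinearMapAt hy]
  refine hf.congr_of_eventuallyEq ?_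
  filter_upwards [(trivializationAt F E x₀).open_baseSet.mem_nhds hy] with z hz
  exact (trivializationAt F E x₀).continuousLinearMapAt_symmL hz _

omit [IsManifold (𝓡 n) ∞ M] in
theorem contMDiffAt_symmL_apply (hy : y ∈ (trivializationAt F E x₀).baseSet) {f : M → F}
    (hf : ContMDiffAt (𝓡 n) 𝓘(ℝ, F) ∞ f y) :
    ContMDiffAt (𝓡 n) ((𝓡 n).prod 𝓘(ℝ, F)) ∞
      (fun x ↦ TotalSpace.mk' F x ((trivializationAt F E x₀).symmL ℝ x (f x))) y := by
  rw [contMDiffAt_section_iff_continuousLinearMapAt hy]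
  refine hf.congr_of_eventuallyEq ?_
  filter_upwards [(trivializationAt F E x₀).open_baseSet.mem_nhds hy] with z hz
  exact (trivializationAt F E x₀).continuousLinearMapAt_symmL hz _

section Hom

variable {F' : Type*} [NormedAddCommGroup F'] [NormedSpace ℝ F']
  {E' : M → Type*} [TopologicalSpace (TotalSpace F' E')]
  [∀ x, AddCommGroup (E' x)] [∀ x, Module ℝ (E' x)] [∀ x, TopologicalSpace (E' x)]
  [∀ x, IsTopologicalAddGroup (E' x)] [∀ x, ContinuousSMul ℝ (E' x)]
  [FiberBundle F' E'] [VectorBundle ℝ F' E'] [ContMDiffVectorBundle ∞ F' E' (𝓡 n)]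
  {A : ∀ x, E x →L[ℝ] E' x}

-- The trivialization of the bundle of homomorphisms is, by definition, conjugation by the
-- trivializations of source and target.
omit [IsManifold (𝓡 n) ∞ M] in
theorem contMDiffAt_hom_section_iff (hy : y ∈ (trivializationAt F E x₀).baseSet)
    (hy' : y ∈ (trivializationAt F' E' x₀).baseSet) :
    ContMDiffAt (𝓡 n) ((𝓡 n).prod 𝓘(ℝ, F →L[ℝ] F')) ∞
        (fun x ↦ TotalSpace.mk' (F →L[ℝ] F') (E := fun x ↦ E x →L[ℝ] E' x) x (A x)) y ↔
      ContMDiffAt (𝓡 n) 𝓘(ℝ, F →L[ℝ] F') ∞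
        (fun x ↦ (trivializationAt F' E' x₀).continuousLinearMapAt ℝ x ∘L A x ∘L
          (trivializationAt F E x₀).symmL ℝ x) y := by
  rw [(trivializationAt (F →L[ℝ] F') (fun x ↦ E x →L[ℝ] E' x) x₀).contMDiffAt_section_iff
    ⟨hy, hy'⟩]
  rfl

omit [IsManifold (𝓡 n) ∞ M] in
theorem mdifferentiableAt_hom_section_iff (hy : y ∈ (trivializationAt F E x₀).baseSet)
    (hy' : y ∈ (trivializationAt F' E' x₀).baseSet) :
    MDifferentiableAt (𝓡 n) ((𝓡 n).prod 𝓘(ℝ, F →L[ℝ] F'))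
        (fun x ↦ TotalSpace.mk' (F →L[ℝ] F') (E := fun x ↦ E x →L[ℝ] E' x) x (A x)) y ↔
      MDifferentiableAt (𝓡 n) 𝓘(ℝ, F →L[ℝ] F')
        (fun x ↦ (trivializationAt F' E' x₀).continuousLinearMapAt ℝ x ∘L A x ∘L
          (trivializationAt F E x₀).symmL ℝ x) y := by
  have : ContMDiffVectorBundle 1 F E (𝓡 n) := ContMDiffVectorBundle.of_le (n := ∞) (by simp)
  have : ContMDiffVectorBundle 1 F' E' (𝓡 n) := ContMDiffVectorBundle.of_le (n := ∞) (by simp)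
  rw [(trivializationAt (F →L[ℝ] F') (fun x ↦ E x →L[ℝ] E' x) x₀).mdifferentiableAt_section_iff
    (𝓡 n) _ ⟨hy, hy'⟩]
  rfl

end Hom

end BundleRep

/-! ### The local connection form of a covariant derivative -/

section ConnectionForm

variable {n : ℕ} {M : Type*} [TopologicalSpace M] [ChartedSpace (EuclideanSpace ℝ (Fin n)) M]
  [IsManifold (𝓡 n) ∞ M]
  {F : Type*} [NormedAddCommGroup F] [NormedSpace ℝ F]
  {E : M → Type*} [TopologicalSpace (TotalSpace F E)]
  [∀ x, AddCommGroup (E x)] [∀ x, Module ℝ (E x)] [∀ x, TopologicalSpace (E x)]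
  [∀ x, IsTopologicalAddGroup (E x)] [∀ x, ContinuousSMul ℝ (E x)]
  [FiberBundle F E] [VectorBundle ℝ F E] [ContMDiffVectorBundle ∞ F E (𝓡 n)]

/-- A smooth connection is locally given by a smooth connection form `Γ` in a chart of the manifold
and a trivialization of the bundle. -/
theorem CovariantDerivative.exists_connectionForm [T2Space M] [FiniteDimensional ℝ F]
    (cov : CovariantDerivative (𝓡 n) F E)
    (hcov : CovariantDerivative.ContMDiffCovariantDerivative cov ∞) (x₀ : M) :
    ∃ (U : Set M) (Γ : EuclideanSpace ℝ (Fin n) → EuclideanSpace ℝ (Fin n) →L[ℝ] F →L[ℝ] F),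
      IsOpen U ∧ x₀ ∈ U ∧ U ⊆ (chartAt (EuclideanSpace ℝ (Fin n)) x₀).source ∧
      U ⊆ (trivializationAt F E x₀).baseSet ∧
      (∀ y ∈ U, ContDiffAt ℝ ∞ Γ (chartAt (EuclideanSpace ℝ (Fin n)) x₀ y)) ∧
      ∀ y ∈ U, ∀ s : ∀ x, E x, MDifferentiableAt (𝓡 n) ((𝓡 n).prod 𝓘(ℝ, F))
          (fun x ↦ TotalSpace.mk' F x (s x)) y → ∀ v : TangentSpace (𝓡 n) y,
        (trivializationAt F E x₀).continuousLinearMapAt ℝ y (cov s y v) =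
          fderiv ℝ ((fun z ↦ (trivializationAt F E x₀).continuousLinearMapAt ℝ z (s z)) ∘
            (chartAt (EuclideanSpace ℝ (Fin n)) x₀).symm)
            (chartAt (EuclideanSpace ℝ (Fin n)) x₀ y)
            ((trivializationAt (EuclideanSpace ℝ (Fin n)) (TangentSpace (𝓡 n))
              x₀).continuousLinearMapAt ℝ y v) +
          Γ (chartAt (EuclideanSpace ℝ (Fin n)) x₀ y)
            ((trivializationAt (EuclideanSpace ℝ (Fin n)) (TangentSpace (𝓡 n))
              x₀).continuousLinearMapAt ℝ y v)
            ((trivializationAt F E x₀).continuousLinearMapAt ℝ y (s y)) := by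
  have : ContMDiffVectorBundle 1 F E (𝓡 n) := ContMDiffVectorBundle.of_le (n := ∞) (by simp)
  have hlin := cov.isCovariantDerivativeOnUniv
  set c := chartAt (EuclideanSpace ℝ (Fin n)) x₀ with hc
  set e := trivializationAt F E x₀ with he
  set T := trivializationAt (EuclideanSpace ℝ (Fin n)) (TangentSpace (𝓡 n) : M → Type _) x₀ with hT
  have hx₀e : x₀ ∈ e.baseSet := mem_baseSet_trivializationAt F E x₀
  have hTc : T.baseSet = c.source := rfl
  -- Covariant derivatives act on global sections, so the constant sections of the trivialization
  -- are multiplied by a bump function. They are unchanged where `χ = 1`.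
  obtain ⟨χ, -, hχ⟩ := ((SmoothBumpFunction.nhds_basis_tsupport (I := 𝓡 n) x₀).mem_iff).1
    (e.open_baseSet.mem_nhds hx₀e)
  let σ : F → ∀ x, E x := fun f x ↦ χ x • e.symmL ℝ x f
  have hσ (f : F) : ContMDiff (𝓡 n) ((𝓡 n).prod 𝓘(ℝ, F)) ∞
      (fun x ↦ TotalSpace.mk' F x (σ f x)) := by
    refine ContMDiffOn.smul_section_of_tsupport χ.contMDiff.contMDiffOn e.open_baseSet hχ ?_
    intro z hz
    exact (contMDiffAt_symmL_apply hz contMDiffAt_const).contMDiffWithinAt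
  have hσd (f : F) (x : M) : MDifferentiableAt (𝓡 n) ((𝓡 n).prod 𝓘(ℝ, F))
      (fun x ↦ TotalSpace.mk' F x (σ f x)) x := (hσ f).mdifferentiableAt (by simp)
  have hχ1 : ∀ᶠ x in 𝓝 x₀, χ x = 1 := χ.eventuallyEq_one
  obtain ⟨U₁, hU₁, hU₁o, hxU₁⟩ := mem_nhds_iff.1 hχ1
  -- The covariant derivative of the section with constant coordinates `f`: its matrix is the
  -- connection form, up to exchanging the two arguments.
  let G (x : M) : F →L[ℝ] EuclideanSpace ℝ (Fin n) →L[ℝ] F := LinearMap.toContinuousLinearMap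
    { toFun f := e.continuousLinearMapAt ℝ x ∘L cov (σ f) x ∘L T.symmL ℝ x
      map_add' f g := by
        have : σ (f + g) = σ f + σ g := by
          ext x
          simp [σ]
        rw [this, hlin.add (hσd f x) (hσd g x)]
        ext
        simp
      map_smul' a f := by
        have : σ (a • f) = a • σ f := by
          ext x
          simp [σ, smul_comm a]
        rw [this, hlin.smul_const a (hσd f x)]
        ext
        simp }
  let U := U₁ ∩ (c.source ∩ e.baseSet)
  refine ⟨U, fun p ↦ (G (c.symm p)).flip, hU₁o.inter (c.open_source.inter e.open_baseSet),
    ⟨hxU₁, mem_chart_source _ x₀, hx₀e⟩, fun y hy ↦ hy.2.1, fun y hy ↦ hy.2.2, ?_, ?_⟩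
  · suffices h : ContDiffOn ℝ ∞ (fun p ↦ (G (c.symm p)).flip) (c.target ∩ c.symm ⁻¹' U) by
      intro y hy
      refine h.contDiffAt ((c.isOpen_inter_preimage_symm (hU₁o.inter
        (c.open_source.inter e.open_baseSet))).mem_nhds ⟨c.map_source hy.2.1, ?_⟩)
      simpa only [mem_preimage, c.left_inv hy.2.1] using hy
    refine contDiffOn_clm_apply.2 fun u ↦ contDiffOn_clm_apply.2 fun f p hp ↦
      ContDiffAt.contDiffWithinAt ?_
    obtain ⟨y, hy, rfl⟩ : ∃ y ∈ U, c y = p := ⟨c.symm p, hp.2, c.right_inv hp.1⟩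
    have h1 (f : F) : ContMDiffAt (𝓡 n) 𝓘(ℝ, EuclideanSpace ℝ (Fin n) →L[ℝ] F) ∞
        (fun x ↦ e.continuousLinearMapAt ℝ x ∘L cov (σ f) x ∘L T.symmL ℝ x) y := by
      refine (contMDiffAt_hom_section_iff (E := (TangentSpace (𝓡 n) : M → Type _)) hy.2.1
        hy.2.2).1 ?_
      exact hcov.contMDiff.contMDiff (σ := σ f) ((hσ f).contMDiffOn.of_le le_rfl) |>.contMDiffAt
        Filter.univ_mem
    exact ((contMDiffAt_iff_contDiffAt_comp_chartAt_symm hy.2.1).1 (h1 f)).clm_apply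
      contDiffAt_const
  · intro y hy s hs v
    have hyU : y ∈ e.baseSet := hy.2.2
    have hL : ∀ s : ∀ x, E x, MDifferentiableAt (𝓡 n) ((𝓡 n).prod 𝓘(ℝ, F))
          (fun x ↦ TotalSpace.mk' F x (s x)) y →
        MDifferentiableAt (𝓡 n) 𝓘(ℝ, F) (fun x ↦ e.continuousLinearMapAt ℝ x (s x)) y :=
      fun s hs ↦ (mdifferentiableAt_section_iff_continuousLinearMapAt hyU).1 hs
    -- The difference between the covariant derivative and the ordinary one is tensorial, so `s` may
    -- be replaced by the extended constant section with the same value at `y`, whose ordinary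
    -- derivative is zero.
    have hΦ : TensorialAt (𝓡 n) F (fun s : ∀ x, E x ↦ e.continuousLinearMapAt ℝ y (cov s y v) -
        mvfderiv (𝓡 n) (fun x ↦ e.continuousLinearMapAt ℝ x (s x)) y v) y := by
      constructor
      · intro f s hf hs
        have h1 : (fun x ↦ e.continuousLinearMapAt ℝ x ((f • s) x)) =
            f • fun x ↦ e.continuousLinearMapAt ℝ x (s x) := by
          ext x
          simp
        rw [h1, mvfderiv_smul hf (hL s hs), hlin.leibniz hs hf]
        simp [smul_sub]
      · intro s s' hs hs'
        have h1 : (fun x ↦ e.continuousLinearMapAt ℝ x ((s + s') x)) =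
            (fun x ↦ e.continuousLinearMapAt ℝ x (s x)) +
            fun x ↦ e.continuousLinearMapAt ℝ x (s' x) := by
          ext x
          simp
        rw [h1, mvfderiv_add (hL s hs) (hL s' hs'), hlin.add hs hs']
        simp
        abel
    set f := e.continuousLinearMapAt ℝ y (s y) with hf
    have h1 := hΦ.pointwise hs (hσd f y) (by
      simp [σ, show χ y = 1 from hU₁ hy.1, hf, -Trivialization.continuousLinearMapAt_apply,
        -Trivialization.symmL_apply, e.symmL_continuousLinearMapAt hyU])
    have h2 : mvfderiv (𝓡 n) (fun x ↦ e.continuousLinearMapAt ℝ x (σ f x)) y v = 0 := by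
      have h3 : (fun x ↦ e.continuousLinearMapAt ℝ x (σ f x)) =ᶠ[𝓝 y] fun _ ↦ f := by
        filter_upwards [hU₁o.mem_nhds hy.1, e.open_baseSet.mem_nhds hyU] with z hz hz'
        simp only [σ, show χ z = 1 from hU₁ hz, one_smul]
        exact e.continuousLinearMapAt_symmL hz' f
      rw [mvfderiv, h3.mfderiv_eq, mfderiv_const]
      rfl
    rw [← mvfderiv_eq_fderiv_comp_chartAt_symm hy.2.1 (hL s hs)]
    simp only [h2, sub_zero, sub_eq_iff_eq_add] at h1
    rw [h1, add_comm]
    congr 1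
    change _ = e.continuousLinearMapAt ℝ (c.symm (c y)) (cov (σ f) (c.symm (c y))
      (T.symmL ℝ (c.symm (c y)) (T.continuousLinearMapAt ℝ y v)))
    rw [c.left_inv hy.2.1, T.symmL_continuousLinearMapAt hy.2.1]

end ConnectionForm

/-! ### Transport of quaternionic triples -/

theorem IsQuaternionicTriple.comp_self {X : Type*} [AddCommGroup X] [Module ℝ X]
    [TopologicalSpace X] [IsTopologicalAddGroup X] {A : Fin 3 → X →L[ℝ] X}
    (h : IsQuaternionicTriple A) (i : Fin 3) : A i ∘L A i = -ContinuousLinearMap.id ℝ X := by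
  fin_cases i
  · exact h.sq_zero
  · exact h.sq_one
  · ext e
    have h0 := fun e ↦ DFunLike.congr_fun h.sq_zero e
    have h1 := fun e ↦ DFunLike.congr_fun h.sq_one e
    have h2 := fun e ↦ DFunLike.congr_fun h.zero_one e
    have h3 := fun e ↦ DFunLike.congr_fun h.one_zero e
    simp only [ContinuousLinearMap.comp_apply, neg_apply, ContinuousLinearMap.id_apply] at h0 h1 h2 h3
    change A 2 (A 2 e) = -e
    rw [← h2, ← h2, h3, map_neg, ← h2, h1, map_neg, map_neg, neg_neg, h0]

section Conj

variable {X : Type*} [AddCommGroup X] [Module ℝ X] [TopologicalSpace X] [IsTopologicalAddGroup X]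
  {Y : Type*} [AddCommGroup Y] [Module ℝ Y] [TopologicalSpace Y] [IsTopologicalAddGroup Y]

theorem IsQuaternionicTriple.conj {A : Fin 3 → X →L[ℝ] X} (h : IsQuaternionicTriple A)
    {p : X →L[ℝ] Y} {q : Y →L[ℝ] X} (hpq : ∀ y, p (q y) = y) (hqp : ∀ x, q (p x) = x) :
    IsQuaternionicTriple fun i ↦ p ∘L A i ∘L q where
  sq_zero := by
    ext y
    have := DFunLike.congr_fun h.sq_zero (q y)
    simp only [ContinuousLinearMap.comp_apply, neg_apply, ContinuousLinearMap.id_apply] at this ⊢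
    rw [hqp, this, map_neg, hpq]
  sq_one := by
    ext y
    have := DFunLike.congr_fun h.sq_one (q y)
    simp only [ContinuousLinearMap.comp_apply, neg_apply, ContinuousLinearMap.id_apply] at this ⊢
    rw [hqp, this, map_neg, hpq]
  zero_one := by
    ext y
    have := DFunLike.congr_fun h.zero_one (q y)
    simp only [ContinuousLinearMap.comp_apply] at this ⊢
    rw [hqp, this]
  one_zero := by
    ext y
    have := DFunLike.congr_fun h.one_zero (q y)
    simp only [ContinuousLinearMap.comp_apply, neg_apply] at this ⊢
    rw [hqp, this, map_neg]

end Conj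

theorem ContDiffAt.fderiv_clm_apply_const {X G H : Type*} [NormedAddCommGroup X] [NormedSpace ℝ X]
    [NormedAddCommGroup G] [NormedSpace ℝ G] [NormedAddCommGroup H] [NormedSpace ℝ H]
    {P : X → G →L[ℝ] H} {p : X} (hP : ContDiffAt ℝ ∞ P p) (g : G) (u : X) :
    fderiv ℝ (fun p ↦ P p g) p u = fderiv ℝ P p u g := by
  have h1 := (hP.differentiableAt (by simp)).hasFDerivAt.clm_apply (hasFDerivAt_const g p)
  rw [h1.fderiv]
  simp

/-! ### Coordinate vector fields -/

section ConstantFields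

variable {n : ℕ} {M : Type*} [TopologicalSpace M] [ChartedSpace (EuclideanSpace ℝ (Fin n)) M]
  [IsManifold (𝓡 n) ∞ M] {x₀ y : M}

/-- The coordinate vector fields of a chart commute. -/
theorem mlieBracket_symmL_trivializationAt
    (hy : y ∈ (chartAt (EuclideanSpace ℝ (Fin n)) x₀).source) (u v : EuclideanSpace ℝ (Fin n)) :
    mlieBracket (𝓡 n) (fun z ↦ (trivializationAt (EuclideanSpace ℝ (Fin n))
        (TangentSpace (𝓡 n) : M → Type _) x₀).symmL ℝ z u)
      (fun z ↦ (trivializationAt (EuclideanSpace ℝ (Fin n)) (TangentSpace (𝓡 n) : M → Type _)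
        x₀).symmL ℝ z v) y = 0 := by
  set c := chartAt (EuclideanSpace ℝ (Fin n)) x₀
  set T := trivializationAt (EuclideanSpace ℝ (Fin n)) (TangentSpace (𝓡 n) : M → Type _) x₀
  let K (u : EuclideanSpace ℝ (Fin n)) : ∀ p : EuclideanSpace ℝ (Fin n), TangentSpace (𝓡 n) p :=
    fun _ ↦ u
  -- Coordinate fields are pullbacks of constant fields by the chart, and brackets commute with
  -- pullbacks.
  have key (u : EuclideanSpace ℝ (Fin n)) : (fun z ↦ T.symmL ℝ z u) =ᶠ[𝓝 y]
      mpullback (𝓡 n) (𝓡 n) c (K u) := by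
    filter_upwards [c.open_source.mem_nhds hy] with z hz
    have hzT : z ∈ T.baseSet := hz
    have h1 : mfderiv (𝓡 n) (𝓡 n) c z = (T.continuousLinearEquivAt ℝ z hzT).toContinuousLinearMap :=
      (hasMFDerivAt_chartAt hz).mfderiv.trans (T.coe_continuousLinearEquivAt_eq' hzT).symm
    have h2 : (mfderiv (𝓡 n) (𝓡 n) c z).inverse = T.symmL ℝ z := by
      rw [h1, ← T.symm_continuousLinearEquivAt_eq' hzT]
      exact ContinuousLinearMap.inverse_equiv _
    exact (congrArg (fun L : EuclideanSpace ℝ (Fin n) →L[ℝ] TangentSpace (𝓡 n) z ↦ L u) h2).symm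
  have hK (u p : EuclideanSpace ℝ (Fin n)) : MDifferentiableAt (𝓡 n) ((𝓡 n).prod
      𝓘(ℝ, EuclideanSpace ℝ (Fin n))) (fun z ↦ TotalSpace.mk' (EuclideanSpace ℝ (Fin n)) z
        (K u z)) p := by
    have h := contMDiffAt_vectorSpace_iff_contDiffAt (𝕜 := ℝ) (V := K u) (n := 1) (x := p)
    exact (h.2 contDiffAt_const).mdifferentiableAt one_ne_zero
  have : IsManifold (𝓡 n) (minSmoothness ℝ 2) M := by
    rw [minSmoothness_of_isRCLikeNormedField]
    infer_instance
  have : IsManifold (𝓡 n) (minSmoothness ℝ 3) M := by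
    rw [minSmoothness_of_isRCLikeNormedField]
    infer_instance
  have h1 : ContMDiffAt (𝓡 n) (𝓡 n) ∞ c y :=
    (contMDiffOn_chart (x := x₀)).contMDiffAt (c.open_source.mem_nhds hy)
  refine ((key u).mlieBracket_vectorField_eq (key v)).trans ?_
  refine (mpullback_mlieBracket (n := ∞) (hK u _) (hK v _) h1 ?_).symm.trans ?_
  · rw [minSmoothness_of_isRCLikeNormedField]
    exact ENat.LEInfty.out
  · have h3 : mlieBracket (𝓡 n) (K u) (K v) = fun _ ↦ 0 := by
      rw [← mlieBracketWithin_univ, mlieBracketWithin_eq_lieBracketWithin, lieBracketWithin_univ]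
      ext1 p
      have h : lieBracket ℝ (fun _ : EuclideanSpace ℝ (Fin n) ↦ u) (fun _ ↦ v) p = 0 := by
        simp [lieBracket]
      exact h
    rw [mpullback_apply, h3, map_zero]

end ConstantFields

/-! ### From the intrinsic structure to its coordinate expression -/

section LocalData

variable {n : ℕ} {M : Type*} [TopologicalSpace M] [ChartedSpace (EuclideanSpace ℝ (Fin n)) M]
  [IsManifold (𝓡 n) ∞ M]
  {F : Type*} [NormedAddCommGroup F] [NormedSpace ℝ F]
  {E : M → Type*} [TopologicalSpace (TotalSpace F E)]
  [∀ x, AddCommGroup (E x)] [∀ x, Module ℝ (E x)] [∀ x, TopologicalSpace (E x)]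
  [∀ x, IsTopologicalAddGroup (E x)] [∀ x, ContinuousSMul ℝ (E x)]
  [FiberBundle F E] [VectorBundle ℝ F E]

/-- The expression, in the trivialization at `x₀`, of the linear maps defined by a frame. -/
def frameCoord (x₀ : M) {l : ℕ} (s : Fin l → ∀ x, E x) (y : M) : (Fin l → ℝ) →L[ℝ] F :=
  ∑ i, (ContinuousLinearMap.proj (R := ℝ) (φ := fun _ : Fin l ↦ ℝ) i).smulRight
    ((trivializationAt F E x₀).continuousLinearMapAt ℝ y (s i y))

/-- The expression of endomorphisms in the trivialization at `x₀`. -/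
def endoCoord (x₀ : M) (A : ∀ x, E x →L[ℝ] E x) (y : M) : F →L[ℝ] F :=
  (trivializationAt F E x₀).continuousLinearMapAt ℝ y ∘L A y ∘L (trivializationAt F E x₀).symmL ℝ y

/-- The expression, in the trivializations at `x₀`, of a morphism from the tangent bundle. -/
def embCoord (x₀ : M) (ι : ∀ x : M, TangentSpace (𝓡 n) x →L[ℝ] E x) (y : M) :
    EuclideanSpace ℝ (Fin n) →L[ℝ] F :=
  (trivializationAt F E x₀).continuousLinearMapAt ℝ y ∘L ι y ∘L
    (trivializationAt (EuclideanSpace ℝ (Fin n)) (TangentSpace (𝓡 n) : M → Type _) x₀).symmL ℝ y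

omit [IsManifold (𝓡 n) ∞ M] [∀ x, IsTopologicalAddGroup (E x)] [∀ x, ContinuousSMul ℝ (E x)] in
theorem frameCoord_apply (x₀ : M) {l : ℕ} (s : Fin l → ∀ x, E x) (y : M) (k : Fin l → ℝ) :
    frameCoord (F := F) x₀ s y k =
      (trivializationAt F E x₀).continuousLinearMapAt ℝ y (∑ i, k i • s i y) := by
  simp [frameCoord, -Trivialization.continuousLinearMapAt_apply]

omit [IsManifold (𝓡 n) ∞ M] [∀ x, IsTopologicalAddGroup (E x)] [∀ x, ContinuousSMul ℝ (E x)] in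
theorem range_frameCoord (x₀ : M) {l : ℕ} {s : Fin l → ∀ x, E x} {y : M} {V : Submodule ℝ (E y)}
    (hV : Submodule.span ℝ (range fun i ↦ s i y) = V) :
    LinearMap.range (frameCoord (F := F) x₀ s y).toLinearMap =
      V.map ((trivializationAt F E x₀).continuousLinearMapAt ℝ y).toLinearMap := by
  ext f
  rw [← hV]
  constructor
  · rintro ⟨k, rfl⟩
    refine ⟨∑ i, k i • s i y, ?_, (frameCoord_apply x₀ s y k).symm⟩
    exact (Submodule.mem_span_range_iff_exists_fun ℝ).2 ⟨k, rfl⟩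
  · rintro ⟨w, hw, rfl⟩
    obtain ⟨k, rfl⟩ := (Submodule.mem_span_range_iff_exists_fun ℝ).1 hw
    exact ⟨k, frameCoord_apply x₀ s y k⟩

variable [ContMDiffVectorBundle ∞ F E (𝓡 n)] {l : ℕ}

/-- Passage from the manifold to the vector space: each invariant hypothesis is tested on coordinate
vector fields, on frame sections, or on sections with constant coordinates. -/
theorem AlmostFQuaternionicStructure.isAdaptedConnection
    (S : AlmostFQuaternionicStructure (n := n) F E l) (cov : CovariantDerivative (𝓡 n) F E)
    (D : CovariantDerivative (𝓡 n) (EuclideanSpace ℝ (Fin n)) (TangentSpace (𝓡 n) : M → Type _))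
    (hD : D.torsion = 0) (hcov : S.IsInducedBy cov D) {x₀ : M} {U : Set M} (hU : IsOpen U)
    (hUc : U ⊆ (chartAt (EuclideanSpace ℝ (Fin n)) x₀).source)
    (hUe : U ⊆ (trivializationAt F E x₀).baseSet)
    {Γ : EuclideanSpace ℝ (Fin n) → EuclideanSpace ℝ (Fin n) →L[ℝ] F →L[ℝ] F}
    (hΓ : ∀ y ∈ U, ContDiffAt ℝ ∞ Γ (chartAt (EuclideanSpace ℝ (Fin n)) x₀ y))
    (hΓcov : ∀ y ∈ U, ∀ s : ∀ x, E x, MDifferentiableAt (𝓡 n) ((𝓡 n).prod 𝓘(ℝ, F))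
          (fun x ↦ TotalSpace.mk' F x (s x)) y → ∀ v : TangentSpace (𝓡 n) y,
        (trivializationAt F E x₀).continuousLinearMapAt ℝ y (cov s y v) =
          fderiv ℝ ((fun z ↦ (trivializationAt F E x₀).continuousLinearMapAt ℝ z (s z)) ∘
            (chartAt (EuclideanSpace ℝ (Fin n)) x₀).symm)
            (chartAt (EuclideanSpace ℝ (Fin n)) x₀ y)
            ((trivializationAt (EuclideanSpace ℝ (Fin n)) (TangentSpace (𝓡 n))
              x₀).continuousLinearMapAt ℝ y v) +
          Γ (chartAt (EuclideanSpace ℝ (Fin n)) x₀ y)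
            ((trivializationAt (EuclideanSpace ℝ (Fin n)) (TangentSpace (𝓡 n))
              x₀).continuousLinearMapAt ℝ y v)
            ((trivializationAt F E x₀).continuousLinearMapAt ℝ y (s y)))
    {A : Fin 3 → ∀ x, E x →L[ℝ] E x}
    (hA : ∀ i, ContMDiffOn (𝓡 n) ((𝓡 n).prod 𝓘(ℝ, F →L[ℝ] F)) ∞
        (fun x ↦ TotalSpace.mk' (F →L[ℝ] F) (E := fun x ↦ E x →L[ℝ] E x) x (A i x)) U)
    (hAQ : ∀ x ∈ U, IsQuaternionicTriple (fun i ↦ A i x) ∧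
        Submodule.span ℝ (range fun i ↦ A i x) = S.Q x)
    {s : Fin l → ∀ x, E x}
    (hs : ∀ i, ContMDiffOn (𝓡 n) ((𝓡 n).prod 𝓘(ℝ, F)) ∞
        (fun x ↦ TotalSpace.mk' F x (s i x)) U)
    (hsV : ∀ x ∈ U, LinearIndependent ℝ (fun i ↦ s i x) ∧
        Submodule.span ℝ (range fun i ↦ s i x) = S.V x) :
    IsAdaptedConnection ((chartAt (EuclideanSpace ℝ (Fin n)) x₀).target ∩
        (chartAt (EuclideanSpace ℝ (Fin n)) x₀).symm ⁻¹' U) Γ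
      (embCoord x₀ S.incl ∘ (chartAt (EuclideanSpace ℝ (Fin n)) x₀).symm)
      (frameCoord (F := F) x₀ s ∘ (chartAt (EuclideanSpace ℝ (Fin n)) x₀).symm)
      (fun i ↦ endoCoord (F := F) x₀ (A i) ∘ (chartAt (EuclideanSpace ℝ (Fin n)) x₀).symm) := by
  classical
  set c := chartAt (EuclideanSpace ℝ (Fin n)) x₀ with hc
  set e := trivializationAt F E x₀ with he
  set T := trivializationAt (EuclideanSpace ℝ (Fin n)) (TangentSpace (𝓡 n) : M → Type _) x₀ with hT
  have hexists {p} (hp : p ∈ c.target ∩ c.symm ⁻¹' U) : ∃ y ∈ U, c y = p :=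
    ⟨c.symm p, hp.2, c.right_inv hp.1⟩
  have hcs {y} (hy : y ∈ U) : c.symm (c y) = y := c.left_inv (hUc hy)
  have hTs {y} (hy : y ∈ U) (v) : T.symmL ℝ y (T.continuousLinearMapAt ℝ y v) = v :=
    T.symmL_continuousLinearMapAt (hUc hy) v
  have hsT {y} (hy : y ∈ U) (v) : T.continuousLinearMapAt ℝ y (T.symmL ℝ y v) = v :=
    T.continuousLinearMapAt_symmL (hUc hy) v
  have hes {y} (hy : y ∈ U) (v) : e.symmL ℝ y (e.continuousLinearMapAt ℝ y v) = v :=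
    e.symmL_continuousLinearMapAt (hUe hy) v
  have hse {y} (hy : y ∈ U) (v) : e.continuousLinearMapAt ℝ y (e.symmL ℝ y v) = v :=
    e.continuousLinearMapAt_symmL (hUe hy) v
  have hinj {y} (hy : y ∈ U) : Function.Injective (e.continuousLinearMapAt ℝ y) :=
    Function.LeftInverse.injective (hes hy)
  have hO : IsOpen (c.target ∩ c.symm ⁻¹' U) := c.isOpen_inter_preimage_symm hU
  have hmem {y} (hy : y ∈ U) : c y ∈ c.target ∩ c.symm ⁻¹' U :=
    ⟨c.map_source (hUc hy), by simpa only [mem_preimage, hcs hy] using hy⟩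
  -- the expression of the connection
  have key {y} (hy : y ∈ U) {t : ∀ x, E x} (ht : MDifferentiableAt (𝓡 n) ((𝓡 n).prod 𝓘(ℝ, F))
      (fun x ↦ TotalSpace.mk' F x (t x)) y) {f : EuclideanSpace ℝ (Fin n) → F}
      (hf : ∀ z ∈ U, e.continuousLinearMapAt ℝ z (t z) = f (c z)) (u) :
      e.continuousLinearMapAt ℝ y (cov t y (T.symmL ℝ y u)) =
        fderiv ℝ f (c y) u + Γ (c y) u (f (c y)) := by
    have h1 := hΓcov y hy t ht (T.symmL ℝ y u)
    have h2 : ((fun z ↦ e.continuousLinearMapAt ℝ z (t z)) ∘ c.symm) =ᶠ[𝓝 (c y)] f := by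
      filter_upwards [hO.mem_nhds (hmem hy)] with p hp
      obtain ⟨z, hz, rfl⟩ := hexists hp
      change (fun w ↦ e.continuousLinearMapAt ℝ w (t w)) (c.symm (c z)) = _
      rw [hcs hz]
      exact hf z hz
    rw [h1, h2.fderiv_eq, hsT hy, hf y hy]
  -- smoothness
  have hιs {y} (hy : y ∈ U) : ContMDiffAt (𝓡 n) 𝓘(ℝ, EuclideanSpace ℝ (Fin n) →L[ℝ] F) ∞
      (embCoord x₀ S.incl) y :=
    (contMDiffAt_hom_section_iff (E := (TangentSpace (𝓡 n) : M → Type _)) (hUc hy) (hUe hy)).1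
      (S.contMDiff_incl y)
  have hAs (i) {y} (hy : y ∈ U) : ContMDiffAt (𝓡 n) 𝓘(ℝ, F →L[ℝ] F) ∞
      (endoCoord (F := F) x₀ (A i)) y :=
    (contMDiffAt_hom_section_iff (hUe hy) (hUe hy)).1 ((hA i).contMDiffAt (hU.mem_nhds hy))
  have hss {y} (hy : y ∈ U) : ContMDiffAt (𝓡 n) 𝓘(ℝ, (Fin l → ℝ) →L[ℝ] F) ∞
      (frameCoord (F := F) x₀ s) y := by
    refine ContMDiffAt.sum fun i _ ↦ ?_
    have h1 := (contMDiffAt_section_iff_continuousLinearMapAt (hUe hy)).1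
      ((hs i).contMDiffAt (hU.mem_nhds hy))
    exact (((ContinuousLinearMap.smulRightL ℝ (Fin l → ℝ) F) (ContinuousLinearMap.proj (R := ℝ)
      (φ := fun _ : Fin l ↦ ℝ) i)).contDiff.contMDiff.contMDiffAt).comp y h1
  have hιc {y} (hy : y ∈ U) := (contMDiffAt_iff_contDiffAt_comp_chartAt_symm (hUc hy)).1 (hιs hy)
  have hAc (i) {y} (hy : y ∈ U) :=
    (contMDiffAt_iff_contDiffAt_comp_chartAt_symm (hUc hy)).1 (hAs i hy)
  have hsc {y} (hy : y ∈ U) := (contMDiffAt_iff_contDiffAt_comp_chartAt_symm (hUc hy)).1 (hss hy)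
  -- ranges
  have hrange_ι {y} (hy : y ∈ U) : LinearMap.range (embCoord x₀ S.incl y).toLinearMap =
      (LinearMap.range (S.incl y).toLinearMap).map (e.continuousLinearMapAt ℝ y).toLinearMap := by
    ext f
    constructor
    · rintro ⟨v, rfl⟩
      exact ⟨S.incl y (T.symmL ℝ y v), ⟨_, rfl⟩, rfl⟩
    · rintro ⟨_, ⟨v, rfl⟩, rfl⟩
      refine ⟨T.continuousLinearMapAt ℝ y v, ?_⟩
      change e.continuousLinearMapAt ℝ y (S.incl y (T.symmL ℝ y (T.continuousLinearMapAt ℝ y v))) =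
        _
      rw [hTs hy]
      rfl
  -- On coordinate fields the covariant derivative of the embedding is the image of `D`. Torsion
  -- freeness and the invariance of the tangent bundle both follow from this formula.
  have hιcov {y} (hy : y ∈ U) (u v : EuclideanSpace ℝ (Fin n)) :
      fderiv ℝ (embCoord x₀ S.incl ∘ c.symm) (c y) u v +
        Γ (c y) u ((embCoord x₀ S.incl ∘ c.symm) (c y) v) =
      e.continuousLinearMapAt ℝ y (S.incl y (D (fun z ↦ T.symmL ℝ z v) y (T.symmL ℝ y u))) := by
    have h1 : MDifferentiableAt (𝓡 n) ((𝓡 n).prod 𝓘(ℝ, EuclideanSpace ℝ (Fin n)))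
        (fun z ↦ TotalSpace.mk' (EuclideanSpace ℝ (Fin n)) (E := (TangentSpace (𝓡 n) : M → Type _))
          z (T.symmL ℝ z v)) y :=
      mdifferentiableAt_symmL (hUc hy) mdifferentiableAt_const
    have h2 : MDifferentiableAt (𝓡 n) ((𝓡 n).prod 𝓘(ℝ, F))
        (fun z ↦ TotalSpace.mk' F z (S.incl z (T.symmL ℝ z v))) y := by
      rw [mdifferentiableAt_section_iff_continuousLinearMapAt (hUe hy)]
      exact ((hιs hy).clm_apply contMDiffAt_const).mdifferentiableAt (by simp)
    rw [← hcov.restrict _ y h1, key hy h2 (f := fun p ↦ (embCoord x₀ S.incl ∘ c.symm) p v) _ u,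
      (hιc hy).fderiv_clm_apply_const]
    intro z hz
    rw [Function.comp_apply, hcs hz]
    rfl
  constructor
  · constructor
    · exact hO
    · intro p hp
      obtain ⟨y, hy, rfl⟩ := hexists hp
      exact (hιc hy).contDiffWithinAt
    · intro p hp
      obtain ⟨y, hy, rfl⟩ := hexists hp
      exact (hsc hy).contDiffWithinAt
    · intro i p hp
      obtain ⟨y, hy, rfl⟩ := hexists hp
      exact (hAc i hy).contDiffWithinAt
    · intro p hp
      exact (hAQ _ hp.2).1.conj (hse hp.2) (hes hp.2)
    · intro p hp
      exact (hinj hp.2).comp ((S.injective_incl _).comp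
        (Function.LeftInverse.injective (hsT hp.2)))
    · intro p hp
      refine (injective_iff_map_eq_zero _).2 fun k hk ↦ ?_
      rw [Function.comp_apply, frameCoord_apply] at hk
      have h1 := (hinj hp.2) (hk.trans (map_zero _).symm)
      exact funext (Fintype.linearIndependent_iff.1 (hsV _ hp.2).1 k h1)
    · intro p hp
      simp only [Function.comp_apply]
      rw [range_frameCoord x₀ (hsV _ hp.2).2, hrange_ι hp.2]
      have h1 := (Submodule.orderIsoMapComap
        (e.continuousLinearEquivAt ℝ _ (hUe hp.2)).toLinearEquiv).isCompl (S.isCompl (c.symm p))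
      rw [← e.coe_continuousLinearEquivAt_eq' (hUe hp.2)]
      exact h1
    · intro p hp i k
      simp only [Function.comp_apply]
      rw [frameCoord_apply]
      have hmemV : ∑ a, k a • s a (c.symm p) ∈ S.V (c.symm p) := by
        rw [← (hsV _ hp.2).2]
        exact (Submodule.mem_span_range_iff_exists_fun ℝ).2 ⟨k, rfl⟩
      have h1 := S.map_V (c.symm p) (A i (c.symm p))
        ((hAQ _ hp.2).2 ▸ Submodule.subset_span (mem_range_self i)) ((hAQ _ hp.2).1.comp_self i) _
        hmemV
      have h2 := Submodule.mem_map_of_mem (f := (e.continuousLinearMapAt ℝ (c.symm p)).toLinearMap)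
        h1
      rw [← hrange_ι hp.2] at h2
      obtain ⟨w, hw⟩ := h2
      refine ⟨w, Eq.trans ?_ hw.symm⟩
      change e.continuousLinearMapAt ℝ _ (A i _ (e.symmL ℝ _ (e.continuousLinearMapAt ℝ _ _))) = _
      rw [hes hp.2]
      rfl
  · intro p hp
    obtain ⟨y, hy, rfl⟩ := hexists hp
    exact (hΓ y hy).contDiffWithinAt
  · intro p hp u v
    obtain ⟨y, hy, rfl⟩ := hexists hp
    rw [hιcov hy, hιcov hy]
    have h1 (v) : MDifferentiableAt (𝓡 n) ((𝓡 n).prod 𝓘(ℝ, EuclideanSpace ℝ (Fin n)))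
        (fun z ↦ TotalSpace.mk' (EuclideanSpace ℝ (Fin n)) (E := (TangentSpace (𝓡 n) : M → Type _))
          z (T.symmL ℝ z v)) y :=
      mdifferentiableAt_symmL (hUc hy) mdifferentiableAt_const
    -- The coordinate fields commute, so vanishing torsion is the symmetry of `D` on them.
    have h2 := (CovariantDerivative.torsion_eq_zero_iff D).1 hD (h1 u) (h1 v)
    rw [mlieBracket_symmL_trivializationAt (hUc hy), sub_eq_zero] at h2
    rw [h2]
  · intro p hp u v
    obtain ⟨y, hy, rfl⟩ := hexists hp
    rw [hιcov hy]
    have h2 := Submodule.mem_map_of_mem (f := (e.continuousLinearMapAt ℝ y).toLinearMap)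
      (LinearMap.mem_range_self (S.incl y).toLinearMap
        (D (fun z ↦ T.symmL ℝ z v) y (T.symmL ℝ y u)))
    rw [← hrange_ι hy] at h2
    obtain ⟨w, hw⟩ := h2
    refine ⟨w, hw.symm.trans ?_⟩
    rw [Function.comp_apply, hcs hy]
    rfl
  · intro p hp u k
    obtain ⟨y, hy, rfl⟩ := hexists hp
    -- Invariance of `V` is formulated for global sections of `V`. Extension by zero outside `U`
    -- supplies one, and only its germ at `y ∈ U` needs to be regular.
    let t : ∀ x, E x := fun x ↦ if x ∈ U then ∑ i, k i • s i x else 0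
    have ht {z} (hz : z ∈ U) : e.continuousLinearMapAt ℝ z (t z) = frameCoord (F := F) x₀ s z k := by
      rw [frameCoord_apply, show t z = _ from if_pos hz]
    have ht1 : MDifferentiableAt (𝓡 n) ((𝓡 n).prod 𝓘(ℝ, F)) (fun z ↦ TotalSpace.mk' F z (t z)) y := by
      rw [mdifferentiableAt_section_iff_continuousLinearMapAt (hUe hy)]
      refine (((hss hy).clm_apply (contMDiffAt_const (c := k))).mdifferentiableAt
        (by simp)).congr_of_eventuallyEq ?_
      filter_upwards [hU.mem_nhds hy] with z hz
      exact ht hz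
    have ht2 (z) : t z ∈ S.V z := by
      by_cases hz : z ∈ U
      · rw [show t z = _ from if_pos hz, ← (hsV _ hz).2]
        exact (Submodule.mem_span_range_iff_exists_fun ℝ).2 ⟨k, rfl⟩
      · rw [show t z = _ from if_neg hz]
        exact zero_mem _
    have h2 := Submodule.mem_map_of_mem (f := (e.continuousLinearMapAt ℝ y).toLinearMap)
      (hcov.isCompatible.preserves_V t y ht1 ht2 (T.symmL ℝ y u))
    rw [← range_frameCoord x₀ (hsV _ hy).2] at h2
    obtain ⟨k', hk'⟩ := h2
    refine ⟨k', ?_⟩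
    rw [Function.comp_apply, hcs hy]
    refine Eq.trans ?_ hk'.symm
    refine Eq.trans ?_ (key hy ht1 (f := fun p ↦ (frameCoord (F := F) x₀ s ∘ c.symm) p k) ?_ u).symm
    · rw [(hsc hy).fderiv_clm_apply_const, Function.comp_apply, hcs hy]
    · intro z hz
      rw [Function.comp_apply, hcs hz, ht hz]
  · intro p hp i u
    obtain ⟨y, hy, rfl⟩ := hexists hp
    -- The same extension by zero, for sections of `Q`.
    let B : ∀ x, E x →L[ℝ] E x := fun x ↦ if x ∈ U then A i x else 0
    have hB1 : MDifferentiableAt (𝓡 n) ((𝓡 n).prod 𝓘(ℝ, F →L[ℝ] F))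
        (fun x ↦ TotalSpace.mk' (F →L[ℝ] F) (E := fun x ↦ E x →L[ℝ] E x) x (B x)) y := by
      rw [mdifferentiableAt_hom_section_iff (hUe hy) (hUe hy)]
      refine ((hAs i hy).mdifferentiableAt (by simp)).congr_of_eventuallyEq ?_
      filter_upwards [hU.mem_nhds hy] with z hz
      rw [show B z = _ from if_pos hz]
      rfl
    have hB2 (z) : B z ∈ S.Q z := by
      by_cases hz : z ∈ U
      · rw [show B z = _ from if_pos hz, ← (hAQ _ hz).2]
        exact Submodule.subset_span (mem_range_self i)
      · rw [show B z = _ from if_neg hz]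
        exact zero_mem _
    obtain ⟨R, hR, hRB⟩ := hcov.isCompatible.preserves_Q B y hB1 hB2 (T.symmL ℝ y u)
    rw [← (hAQ y hy).2] at hR
    refine ⟨e.continuousLinearMapAt ℝ y ∘L R ∘L e.symmL ℝ y, ?_, fun f ↦ ?_⟩
    · obtain ⟨a, rfl⟩ := (Submodule.mem_span_range_iff_exists_fun ℝ).1 hR
      refine (Submodule.mem_span_range_iff_exists_fun ℝ).2 ⟨a, ?_⟩
      simp only [Function.comp_apply, hcs hy]
      ext f
      simp [endoCoord, -Trivialization.continuousLinearMapAt_apply, he]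
    · have h1 : MDifferentiableAt (𝓡 n) ((𝓡 n).prod 𝓘(ℝ, F))
          (fun z ↦ TotalSpace.mk' F z (e.symmL ℝ z f)) y :=
        mdifferentiableAt_symmL (hUe hy) mdifferentiableAt_const
      have hBf {z} (hz : z ∈ U) : e.continuousLinearMapAt ℝ z (B z (e.symmL ℝ z f)) =
          endoCoord (F := F) x₀ (A i) z f := by
        rw [show B z = _ from if_pos hz]
        rfl
      have h2 : MDifferentiableAt (𝓡 n) ((𝓡 n).prod 𝓘(ℝ, F))
          (fun z ↦ TotalSpace.mk' F z (B z (e.symmL ℝ z f))) y := by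
        rw [mdifferentiableAt_section_iff_continuousLinearMapAt (hUe hy)]
        refine (((hAs i hy).clm_apply (contMDiffAt_const (c := f))).mdifferentiableAt
          (by simp)).congr_of_eventuallyEq ?_
        filter_upwards [hU.mem_nhds hy] with z hz
        exact hBf hz
      have h3 := congrArg (e.continuousLinearMapAt ℝ y) (hRB _ h1)
      -- For a section with constant coordinates only the connection form contributes.
      have h4 := key hy h1 (f := fun _ ↦ f) (fun z hz ↦ hse hz f) u
      have h5 := key hy h2 (f := fun p ↦ (endoCoord (F := F) x₀ (A i) ∘ c.symm) p f) (by
        intro z hz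
        rw [Function.comp_apply, hcs hz, hBf hz]) u
      rw [(hAc i hy).fderiv_clm_apply_const] at h5
      rw [fderiv_fun_const] at h4
      rw [map_sub, h5, show B y = _ from if_pos hy] at h3
      refine Eq.trans ?_ h3
      congr 1
      rw [Function.comp_apply, hcs hy]
      change e.continuousLinearMapAt ℝ y (A i y (e.symmL ℝ y _)) = _
      congr 2
      refine hinj hy ?_
      rw [hse hy, h4]
      simp

end LocalData

/-! ### Tangent fields on a vector space -/

section VectorSpaceModel

variable {d : ℕ}

/-- The tangent trivializations of a vector space are identities, so sections are ordinary
functions. -/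
theorem mdifferentiableAt_vectorField_iff
    {Y : ∀ z : EuclideanSpace ℝ (Fin d), TangentSpace (𝓡 d) z} {z : EuclideanSpace ℝ (Fin d)} :
    MDifferentiableAt (𝓡 d) ((𝓡 d).prod 𝓘(ℝ, EuclideanSpace ℝ (Fin d)))
        (fun z ↦ TotalSpace.mk' (EuclideanSpace ℝ (Fin d)) z (Y z)) z ↔
      DifferentiableAt (E := EuclideanSpace ℝ (Fin d)) (F := EuclideanSpace ℝ (Fin d)) ℝ Y z := by
  refine (mdifferentiableAt_section_iff_continuousLinearMapAt (x₀ := z)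
    (mem_chart_source _ z)).trans (Iff.trans ?_ mdifferentiableAt_iff_differentiableAt)
  have : (fun x ↦ (trivializationAt (EuclideanSpace ℝ (Fin d)) (TangentSpace (𝓡 d))
      z).continuousLinearMapAt ℝ x (Y x)) = Y := by
    ext1 x
    rw [TangentBundle.continuousLinearMapAt_model_space]
    rfl
  rw [this]

theorem contMDiffAt_endomorphismField_iff
    {A : ∀ z : EuclideanSpace ℝ (Fin d), TangentSpace (𝓡 d) z →L[ℝ] TangentSpace (𝓡 d) z}
    {z : EuclideanSpace ℝ (Fin d)} :
    ContMDiffAt (𝓡 d) ((𝓡 d).prod 𝓘(ℝ, EuclideanSpace ℝ (Fin d) →L[ℝ] EuclideanSpace ℝ (Fin d))) ∞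
        (fun z ↦ TotalSpace.mk' (EuclideanSpace ℝ (Fin d) →L[ℝ] EuclideanSpace ℝ (Fin d))
          (E := fun z : EuclideanSpace ℝ (Fin d) ↦
            TangentSpace (𝓡 d) z →L[ℝ] TangentSpace (𝓡 d) z) z (A z)) z ↔
      ContDiffAt (E := EuclideanSpace ℝ (Fin d))
        (F := EuclideanSpace ℝ (Fin d) →L[ℝ] EuclideanSpace ℝ (Fin d)) ℝ ∞ A z := by
  refine (contMDiffAt_hom_section_iff (x₀ := z) (mem_chart_source _ z)
    (mem_chart_source _ z)).trans (Iff.trans ?_ contMDiffAt_iff_contDiffAt)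
  have : (fun x ↦ (trivializationAt (EuclideanSpace ℝ (Fin d)) (TangentSpace (𝓡 d))
      z).continuousLinearMapAt ℝ x ∘L A x ∘L (trivializationAt (EuclideanSpace ℝ (Fin d))
        (TangentSpace (𝓡 d)) z).symmL ℝ x) = A := by
    ext1 x
    rw [TangentBundle.continuousLinearMapAt_model_space, TangentBundle.symmL_model_space]
    rfl
  rw [this]

theorem mlieBracket_eq_lieBracket_vectorSpace
    (X Y : EuclideanSpace ℝ (Fin d) → EuclideanSpace ℝ (Fin d)) (z : EuclideanSpace ℝ (Fin d)) :
    mlieBracket (𝓡 d) X Y z = lieBracket ℝ X Y z :=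
  (congrFun mlieBracketWithin_univ z).symm.trans
    ((congrFun mlieBracketWithin_eq_lieBracketWithin z).trans (by rw [lieBracketWithin_univ]))

end VectorSpaceModel

/-! ### Hypercomplex structures from parallel triples -/

section Obata

variable {m : ℕ} {J : Fin 3 → EuclideanSpace ℝ (Fin (4 * m)) →
    EuclideanSpace ℝ (Fin (4 * m)) →L[ℝ] EuclideanSpace ℝ (Fin (4 * m))}
  {C : EuclideanSpace ℝ (Fin (4 * m)) → EuclideanSpace ℝ (Fin (4 * m)) →L[ℝ]
    EuclideanSpace ℝ (Fin (4 * m)) →L[ℝ] EuclideanSpace ℝ (Fin (4 * m))}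

/-- The connection `d + C` on the tangent bundle of a vector space. -/
def christoffelConnection {d : ℕ} (C : EuclideanSpace ℝ (Fin d) → EuclideanSpace ℝ (Fin d) →L[ℝ]
      EuclideanSpace ℝ (Fin d) →L[ℝ] EuclideanSpace ℝ (Fin d)) :
    CovariantDerivative (𝓡 d) (EuclideanSpace ℝ (Fin d))
      (TangentSpace (𝓡 d) : EuclideanSpace ℝ (Fin d) → Type _) where
  toFun Y z := fderiv (E := EuclideanSpace ℝ (Fin d)) (F := EuclideanSpace ℝ (Fin d)) ℝ Y z +
    (C z).flip (Y z)
  isCovariantDerivativeOnUniv :=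
    { add := by
        intro Y Y' z hY hY' _
        have h := fderiv_add (mdifferentiableAt_vectorField_iff.1 hY)
          (mdifferentiableAt_vectorField_iff.1 hY')
        ext1 ζ
        have h' := DFunLike.congr_fun h ζ
        refine (congrArg₂ (· + ·) h' (map_add (C z ζ) (Y z) (Y' z))).trans ?_
        exact add_add_add_comm _ _ _ _
      leibniz := by
        intro Y g z hY hg _
        ext1 ζ
        have h := (hg.differentiableAt.hasFDerivAt.smul
          (mdifferentiableAt_vectorField_iff.1 hY).hasFDerivAt).fderiv
        have h' := DFunLike.congr_fun h ζ
        refine (congrArg₂ (· + ·) h' (map_smul (C z ζ) (g z) (Y z))).trans ?_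
        have h1 (a b : ℝ) (p q r : EuclideanSpace ℝ (Fin d)) :
            a • p + b • r + a • q = a • (p + q) + b • r := by module
        have h2 : fderiv ℝ g z ζ = mvfderiv (𝓡 d) g z ζ :=
          congrArg (fun L : EuclideanSpace ℝ (Fin d) →L[ℝ] ℝ ↦ L ζ) mfderiv_eq_fderiv.symm
        have h3 {a b : ℝ} (hab : a = b) (p q : EuclideanSpace ℝ (Fin d)) :
            p + a • q = p + b • q := by rw [hab]
        exact (h1 (g z) (fderiv ℝ g z ζ) _ _ (Y z)).trans (h3 h2 _ _) }

theorem christoffelConnection_apply {d : ℕ} (C : EuclideanSpace ℝ (Fin d) →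
      EuclideanSpace ℝ (Fin d) →L[ℝ] EuclideanSpace ℝ (Fin d) →L[ℝ] EuclideanSpace ℝ (Fin d))
    (Y : EuclideanSpace ℝ (Fin d) → EuclideanSpace ℝ (Fin d)) (z ζ : EuclideanSpace ℝ (Fin d)) :
    christoffelConnection C Y z ζ = fderiv ℝ Y z ζ + C z ζ (Y z) := rfl

theorem contMDiffCovariantDerivative_christoffelConnection {d : ℕ} {C : EuclideanSpace ℝ (Fin d) →
      EuclideanSpace ℝ (Fin d) →L[ℝ] EuclideanSpace ℝ (Fin d) →L[ℝ] EuclideanSpace ℝ (Fin d)}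
    (hC : ContDiff ℝ ∞ C) :
    CovariantDerivative.ContMDiffCovariantDerivative (christoffelConnection C) ∞ where
  contMDiff :=
    { contMDiff := by
        intro Y hY z _
        have hY' : ContDiff (E := EuclideanSpace ℝ (Fin d)) (F := EuclideanSpace ℝ (Fin d)) ℝ ∞ Y :=
          contMDiff_vectorSpace_iff_contDiff.1 (contMDiffOn_univ.1 hY)
        refine (contMDiffAt_endomorphismField_iff.2 ?_).contMDiffWithinAt
        refine ContDiff.contDiffAt ?_
        exact (hY'.fderiv_right (m := ∞) le_rfl).add
          (contDiff_clm_apply_iff.2 fun ζ ↦ (hC.clm_apply contDiff_const).clm_apply hY') }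

theorem torsion_christoffelConnection {d : ℕ} {C : EuclideanSpace ℝ (Fin d) →
      EuclideanSpace ℝ (Fin d) →L[ℝ] EuclideanSpace ℝ (Fin d) →L[ℝ] EuclideanSpace ℝ (Fin d)}
    (hC : ∀ z ζ ζ', C z ζ ζ' = C z ζ' ζ) : (christoffelConnection C).torsion = 0 := by
  rw [CovariantDerivative.torsion_eq_zero_iff]
  intro X Y z hX hY
  refine Eq.trans ?_ (mlieBracket_eq_lieBracket_vectorSpace X Y z).symm
  refine (congrArg₂ (· - ·) (christoffelConnection_apply C Y z (X z))
    (christoffelConnection_apply C X z (Y z))).trans ?_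
  rw [hC z (X z) (Y z)]
  exact add_sub_add_right_eq_sub _ _ _

theorem fderiv_apply_of_parallel {d : ℕ} {J : EuclideanSpace ℝ (Fin d) →
      EuclideanSpace ℝ (Fin d) →L[ℝ] EuclideanSpace ℝ (Fin d)} {C : EuclideanSpace ℝ (Fin d) →
      EuclideanSpace ℝ (Fin d) →L[ℝ] EuclideanSpace ℝ (Fin d) →L[ℝ] EuclideanSpace ℝ (Fin d)}
    (hJ : ContDiff ℝ ∞ J)
    (hJC : ∀ z ζ ζ', fderiv ℝ J z ζ ζ' = J z (C z ζ ζ') - C z ζ (J z ζ'))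
    {Y : EuclideanSpace ℝ (Fin d) → EuclideanSpace ℝ (Fin d)} {z : EuclideanSpace ℝ (Fin d)}
    (hY : DifferentiableAt ℝ Y z) (ζ : EuclideanSpace ℝ (Fin d)) :
    fderiv ℝ (fun z ↦ J z (Y z)) z ζ = J z (fderiv ℝ Y z ζ) + J z (C z ζ (Y z)) - C z ζ (J z (Y z)) := by
  have h := ((hJ.differentiable (by simp)) z).hasFDerivAt.clm_apply hY.hasFDerivAt
  rw [h.fderiv]
  simp [hJC, add_sub_assoc]

/-- For a symmetric connection, brackets can be written with covariant derivatives. These commute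
with `J`, and then `J² = -1` cancels all terms. -/
theorem nijenhuis_eq_zero_of_parallel {d : ℕ} {J : EuclideanSpace ℝ (Fin d) →
      EuclideanSpace ℝ (Fin d) →L[ℝ] EuclideanSpace ℝ (Fin d)} {C : EuclideanSpace ℝ (Fin d) →
      EuclideanSpace ℝ (Fin d) →L[ℝ] EuclideanSpace ℝ (Fin d) →L[ℝ] EuclideanSpace ℝ (Fin d)}
    (hJ : ContDiff ℝ ∞ J) (hJ2 : ∀ z ζ, J z (J z ζ) = -ζ) (hC : ∀ z ζ ζ', C z ζ ζ' = C z ζ' ζ)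
    (hJC : ∀ z ζ ζ', fderiv ℝ J z ζ ζ' = J z (C z ζ ζ') - C z ζ (J z ζ'))
    {X Y : EuclideanSpace ℝ (Fin d) → EuclideanSpace ℝ (Fin d)} {z : EuclideanSpace ℝ (Fin d)}
    (hX : DifferentiableAt ℝ X z) (hY : DifferentiableAt ℝ Y z) :
    lieBracket ℝ (fun z ↦ J z (X z)) (fun z ↦ J z (Y z)) z
      - J z (lieBracket ℝ (fun z ↦ J z (X z)) Y z)
      - J z (lieBracket ℝ X (fun z ↦ J z (Y z)) z) - lieBracket ℝ X Y z = 0 := by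
  simp only [lieBracket_eq, fderiv_apply_of_parallel hJ hJC hX, fderiv_apply_of_parallel hJ hJC hY,
    map_add, map_sub, hJ2]
  rw [hC z (J z (X z)) (Y z), hC z (J z (Y z)) (X z), hC z (J z (Y z)) (J z (X z)),
    hC z (Y z) (X z)]
  abel

/-- A quaternionic triple of endomorphism fields, parallel for a torsion free connection. -/
def HypercomplexStructure.ofParallel (hJ : ∀ i, ContDiff ℝ ∞ (J i))
    (htriple : ∀ z, IsQuaternionicTriple fun i ↦ J i z) (hC : ∀ z ζ ζ', C z ζ ζ' = C z ζ' ζ)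
    (hJC : ∀ i z ζ ζ', fderiv ℝ (J i) z ζ ζ' = J i z (C z ζ ζ') - C z ζ (J i z ζ')) :
    HypercomplexStructure m (EuclideanSpace ℝ (Fin (4 * m))) where
  J := J
  contMDiff_J i z := contMDiffAt_endomorphismField_iff.2 (hJ i).contDiffAt
  isQuaternionicTriple := htriple
  integrable i X Y z hX hY := by
    have hX' : DifferentiableAt (E := EuclideanSpace ℝ (Fin (4 * m)))
      (F := EuclideanSpace ℝ (Fin (4 * m))) ℝ X z :=
      mdifferentiableAt_vectorField_iff.1 (hX.mdifferentiableAt (by simp))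
    have hY' : DifferentiableAt (E := EuclideanSpace ℝ (Fin (4 * m)))
      (F := EuclideanSpace ℝ (Fin (4 * m))) ℝ Y z :=
      mdifferentiableAt_vectorField_iff.1 (hY.mdifferentiableAt (by simp))
    have h := fun X Y ↦ mlieBracket_eq_lieBracket_vectorSpace X Y z
    have h' {a b c d : EuclideanSpace ℝ (Fin (4 * m))} (hab : a = b) (hcd : c = d) :
      a - c = b - d := congrArg₂ _ hab hcd
    refine (h' (h' (h' (h _ _) (congrArg (J i z) (h _ _))) (congrArg (J i z) (h _ _)))
      (h _ _)).trans ?_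
    exact nijenhuis_eq_zero_of_parallel (hJ i) (fun z ζ ↦ DFunLike.congr_fun
      ((htriple z).comp_self i) ζ) hC (hJC i) hX' hY'

theorem HypercomplexStructure.isObata_ofParallel (hJ : ∀ i, ContDiff ℝ ∞ (J i))
    (htriple : ∀ z, IsQuaternionicTriple fun i ↦ J i z) (hCs : ContDiff ℝ ∞ C)
    (hC : ∀ z ζ ζ', C z ζ ζ' = C z ζ' ζ)
    (hJC : ∀ i z ζ ζ', fderiv ℝ (J i) z ζ ζ' = J i z (C z ζ ζ') - C z ζ (J i z ζ')) :
    (HypercomplexStructure.ofParallel hJ htriple hC hJC).IsObata (christoffelConnection C) where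
  smooth := contMDiffCovariantDerivative_christoffelConnection hCs
  torsion_eq_zero := torsion_christoffelConnection hC
  parallel i X z hX ζ := by
    refine (congrArg (· + C z ζ (J i z (X z))) (fderiv_apply_of_parallel (hJ i) (hJC i)
      (mdifferentiableAt_vectorField_iff.1 hX) ζ)).trans ?_
    refine Eq.trans ?_ (map_add (J i z) _ _).symm
    exact sub_add_cancel _ _

end Obata

/-! ### The diffeomorphism onto an open subset of the product -/

/-- The diffeomorphism onto an open subset of a product obtained from a chart of the manifold. -/
def chartDiffeomorph {n m l : ℕ} {M : Type*} [TopologicalSpace M]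
    [ChartedSpace (EuclideanSpace ℝ (Fin n)) M] [IsManifold (𝓡 n) ∞ M] (x₀ : M)
    (φ : OpenPartialHomeomorph (EuclideanSpace ℝ (Fin n))
      ((Fin l → ImH) × EuclideanSpace ℝ (Fin (4 * m))))
    (hφ : ContDiffOn ℝ ∞ φ φ.source) (hφ' : ContDiffOn ℝ ∞ φ.symm φ.target) :
    PartialDiffeomorph (𝓡 n) (𝓘(ℝ, Fin l → ImH).prod (𝓡 (4 * m))) M
      ((Fin l → ImH) × EuclideanSpace ℝ (Fin (4 * m))) ∞ where
  toPartialEquiv := ((chartAt (EuclideanSpace ℝ (Fin n)) x₀).trans φ).toPartialEquiv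
  open_source := ((chartAt (EuclideanSpace ℝ (Fin n)) x₀).trans φ).open_source
  open_target := ((chartAt (EuclideanSpace ℝ (Fin n)) x₀).trans φ).open_target
  contMDiffOn_toFun := by
    have hc : ContMDiffOn (𝓡 n) (𝓡 n) ∞ (chartAt (EuclideanSpace ℝ (Fin n)) x₀)
        ((chartAt (EuclideanSpace ℝ (Fin n)) x₀).trans φ).source :=
      (contMDiffOn_chart (x := x₀)).mono fun y hy ↦ hy.1
    have h1 : ContMDiffOn (𝓡 n) 𝓘(ℝ, Fin l → ImH) ∞ (fun p ↦ (φ p).1) φ.source :=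
      hφ.fst.contMDiffOn
    have h2 : ContMDiffOn (𝓡 n) (𝓡 (4 * m)) ∞ (fun p ↦ (φ p).2) φ.source := hφ.snd.contMDiffOn
    exact (h1.prodMk h2).comp hc fun y hy ↦ hy.2
  contMDiffOn_invFun := by
    have h1 : ContMDiffOn 𝓘(ℝ, (Fin l → ImH) × EuclideanSpace ℝ (Fin (4 * m))) (𝓡 n) ∞ φ.symm
        φ.target := hφ'.contMDiffOn
    -- The identity map, regarded as passing from the product of two model spaces to the product
    -- vector space with its own model.
    have h2 : ContMDiff (𝓘(ℝ, Fin l → ImH).prod (𝓡 (4 * m)))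
        𝓘(ℝ, (Fin l → ImH) × EuclideanSpace ℝ (Fin (4 * m))) ∞
        (fun p : (Fin l → ImH) × EuclideanSpace ℝ (Fin (4 * m)) ↦ (p.1, p.2)) :=
      contMDiff_fst.prodMk_space contMDiff_snd
    have h3 (p) (hp : p ∈ ((chartAt (EuclideanSpace ℝ (Fin n)) x₀).trans φ).target) :
        p ∈ φ.target ∧ φ.symm p ∈ (chartAt (EuclideanSpace ℝ (Fin n)) x₀).target := by
      rwa [OpenPartialHomeomorph.trans_target] at hp
    exact (contMDiffOn_chart_symm (x := x₀)).comp (h1.comp h2.contMDiffOn fun p hp ↦ (h3 p hp).1)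
      fun p hp ↦ (h3 p hp).2

theorem imCoord_surjective : Function.Surjective imCoord := by
  intro a
  refine ⟨a 0 • imUnit 0 + a 1 • imUnit 1 + a 2 • imUnit 2, ?_⟩
  ext i
  fin_cases i <;> simp [imCoord, imI_imUnit, imJ_imUnit, imK_imUnit]

/-! ### Transfer of the product structure back to the manifold -/

section Product

variable {n : ℕ} {M : Type*} [TopologicalSpace M] [ChartedSpace (EuclideanSpace ℝ (Fin n)) M]
  [IsManifold (𝓡 n) ∞ M]
  {F : Type*} [NormedAddCommGroup F] [NormedSpace ℝ F]
  {E : M → Type*} [TopologicalSpace (TotalSpace F E)]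
  [∀ x, AddCommGroup (E x)] [∀ x, Module ℝ (E x)] [∀ x, TopologicalSpace (E x)]
  [∀ x, IsTopologicalAddGroup (E x)] [∀ x, ContinuousSMul ℝ (E x)]
  [FiberBundle F E] [VectorBundle ℝ F E] [ContMDiffVectorBundle ∞ F E (𝓡 n)] {l m : ℕ}

/-- A product chart for the expression of the structure in a trivialization at `x₀` identifies the
structure with the product of `(Im ℍ)ˡ` with a hypercomplex manifold. -/
theorem IsProductChart.isProductVia
    {S : AlmostFQuaternionicStructure (n := n) F E l} {cov : CovariantDerivative (𝓡 n) F E} {x₀ : M}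
    {U : Set M}
    (hUc : U ⊆ (chartAt (EuclideanSpace ℝ (Fin n)) x₀).source)
    (hUe : U ⊆ (trivializationAt F E x₀).baseSet)
    {Γ : EuclideanSpace ℝ (Fin n) → EuclideanSpace ℝ (Fin n) →L[ℝ] F →L[ℝ] F}
    (hΓcov : ∀ y ∈ U, ∀ s : ∀ x, E x, MDifferentiableAt (𝓡 n) ((𝓡 n).prod 𝓘(ℝ, F))
          (fun x ↦ TotalSpace.mk' F x (s x)) y → ∀ v : TangentSpace (𝓡 n) y,
        (trivializationAt F E x₀).continuousLinearMapAt ℝ y (cov s y v) =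
          fderiv ℝ ((fun z ↦ (trivializationAt F E x₀).continuousLinearMapAt ℝ z (s z)) ∘
            (chartAt (EuclideanSpace ℝ (Fin n)) x₀).symm)
            (chartAt (EuclideanSpace ℝ (Fin n)) x₀ y)
            ((trivializationAt (EuclideanSpace ℝ (Fin n)) (TangentSpace (𝓡 n))
              x₀).continuousLinearMapAt ℝ y v) +
          Γ (chartAt (EuclideanSpace ℝ (Fin n)) x₀ y)
            ((trivializationAt (EuclideanSpace ℝ (Fin n)) (TangentSpace (𝓡 n))
              x₀).continuousLinearMapAt ℝ y v)
            ((trivializationAt F E x₀).continuousLinearMapAt ℝ y (s y)))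
    {φ : OpenPartialHomeomorph (EuclideanSpace ℝ (Fin n))
      ((Fin l → ImH) × EuclideanSpace ℝ (Fin (4 * m)))}
    {s : EuclideanSpace ℝ (Fin n) → (Fin l → ℝ) →L[ℝ] F}
    {A : Fin 3 → EuclideanSpace ℝ (Fin n) → F →L[ℝ] F}
    {J : Fin 3 → EuclideanSpace ℝ (Fin (4 * m)) →
      EuclideanSpace ℝ (Fin (4 * m)) →L[ℝ] EuclideanSpace ℝ (Fin (4 * m))}
    {C : EuclideanSpace ℝ (Fin (4 * m)) → EuclideanSpace ℝ (Fin (4 * m)) →L[ℝ]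
      EuclideanSpace ℝ (Fin (4 * m)) →L[ℝ] EuclideanSpace ℝ (Fin (4 * m))}
    {α : EuclideanSpace ℝ (Fin n) → F →L[ℝ] Fin l → ℍ[ℝ]}
    {β : EuclideanSpace ℝ (Fin n) → F →L[ℝ] EuclideanSpace ℝ (Fin (4 * m))}
    (h : IsProductChart φ Γ (embCoord x₀ S.incl ∘ (chartAt (EuclideanSpace ℝ (Fin n)) x₀).symm)
      s A J C α β)
    (hφU : φ.source ⊆ (chartAt (EuclideanSpace ℝ (Fin n)) x₀).target ∩
        (chartAt (EuclideanSpace ℝ (Fin n)) x₀).symm ⁻¹' U)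
    (hs : ∀ y ∈ U, chartAt (EuclideanSpace ℝ (Fin n)) x₀ y ∈ φ.source →
      LinearMap.range (s (chartAt (EuclideanSpace ℝ (Fin n)) x₀ y)).toLinearMap =
        (S.V y).map ((trivializationAt F E x₀).continuousLinearMapAt ℝ y).toLinearMap)
    (hA : ∀ y ∈ U, chartAt (EuclideanSpace ℝ (Fin n)) x₀ y ∈ φ.source → ∀ B : E y →L[ℝ] E y,
      B ∈ S.Q y ↔ (trivializationAt F E x₀).continuousLinearMapAt ℝ y ∘L B ∘L
          (trivializationAt F E x₀).symmL ℝ y ∈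
        Submodule.span ℝ (range fun i ↦ A i (chartAt (EuclideanSpace ℝ (Fin n)) x₀ y))) :
    S.IsProductVia cov (HypercomplexStructure.ofParallel h.contDiff_J h.triple h.C_symm h.fderiv_J)
      (christoffelConnection C) (chartDiffeomorph x₀ φ h.contDiffOn_φ h.contDiffOn_φ_symm)
      (fun y ↦ α (chartAt (EuclideanSpace ℝ (Fin n)) x₀ y) ∘L
        (trivializationAt F E x₀).continuousLinearMapAt ℝ y)
      (fun y ↦ β (chartAt (EuclideanSpace ℝ (Fin n)) x₀ y) ∘L
        (trivializationAt F E x₀).continuousLinearMapAt ℝ y) := by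
  set c := chartAt (EuclideanSpace ℝ (Fin n)) x₀ with hc
  set e := trivializationAt F E x₀ with he
  set T := trivializationAt (EuclideanSpace ℝ (Fin n)) (TangentSpace (𝓡 n) : M → Type _) x₀ with hT
  have hsource (y) (hy : y ∈ (c.trans φ).source) : y ∈ U ∧ c y ∈ φ.source := by
    rw [c.trans_source] at hy
    have h1 := (hφU hy.2).2
    rw [mem_preimage, c.left_inv hy.1] at h1
    exact ⟨h1, hy.2⟩
  have hes {y} (hy : y ∈ U) (v) : e.symmL ℝ y (e.continuousLinearMapAt ℝ y v) = v :=
    e.symmL_continuousLinearMapAt (hUe hy) v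
  have hse {y} (hy : y ∈ U) (v) : e.continuousLinearMapAt ℝ y (e.symmL ℝ y v) = v :=
    e.continuousLinearMapAt_symmL (hUe hy) v
  have hcs {y} (hy : y ∈ U) : c.symm (c y) = y := c.left_inv (hUc hy)
  have hφd {p} (hp : p ∈ φ.source) : DifferentiableAt ℝ φ p :=
    (h.contDiffOn_φ.contDiffAt (φ.open_source.mem_nhds hp)).differentiableAt (by simp)
  have hφ2 {p} (hp : p ∈ φ.source) : DifferentiableAt ℝ (fun p ↦ (φ p).2) p := (hφd hp).snd
  have hsnd {y} (hy : y ∈ U) (hyφ : c y ∈ φ.source) (v : TangentSpace (𝓡 n) y) :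
      mfderiv (𝓡 n) (𝓡 (4 * m)) (fun y ↦ (φ (c y)).2) y v =
        fderiv ℝ (fun p ↦ (φ p).2) (c y) (T.continuousLinearMapAt ℝ y v) := by
    have h1 := HasMFDerivAt.comp y (hφd hyφ).snd.hasFDerivAt.hasMFDerivAt
      (hasMFDerivAt_chartAt (hUc hy))
    exact congrArg (fun L : TangentSpace (𝓡 n) y →L[ℝ] EuclideanSpace ℝ (Fin (4 * m)) ↦ L v)
      h1.mfderiv
  have hincl {y} (hy : y ∈ U) (v : TangentSpace (𝓡 n) y) : e.continuousLinearMapAt ℝ y (S.incl y v) =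
      (embCoord x₀ S.incl ∘ c.symm) (c y) (T.continuousLinearMapAt ℝ y v) := by
    rw [Function.comp_apply, hcs hy]
    change _ = e.continuousLinearMapAt ℝ y (S.incl y (T.symmL ℝ y (T.continuousLinearMapAt ℝ y v)))
    rw [T.symmL_continuousLinearMapAt (hUc hy)]
  have hαd {p} (hp : p ∈ φ.source) : DifferentiableAt ℝ α p :=
    (h.contDiffOn_α.contDiffAt (φ.open_source.mem_nhds hp)).differentiableAt (by simp)
  have hβd {p} (hp : p ∈ φ.source) : DifferentiableAt ℝ β p :=
    (h.contDiffOn_β.contDiffAt (φ.open_source.mem_nhds hp)).differentiableAt (by simp)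
  have hcm {y} (hy : y ∈ U) : ContMDiffAt (𝓡 n) (𝓡 n) ∞ c y :=
    (contMDiffOn_chart (x := x₀)).contMDiffAt (c.open_source.mem_nhds (hUc hy))
  have hcp {p : TotalSpace F E} (hp : p.proj ∈ U) :
      ContMDiffAt ((𝓡 n).prod 𝓘(ℝ, F)) (𝓡 n) ∞ (fun q : TotalSpace F E ↦ c q.proj) p :=
    (hcm hp).comp p (contMDiff_proj E p)
  have hep {p : TotalSpace F E} (hp : p.proj ∈ U) : ContMDiffAt ((𝓡 n).prod 𝓘(ℝ, F)) 𝓘(ℝ, F) ∞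
      (fun q : TotalSpace F E ↦ e.continuousLinearMapAt ℝ q.proj q.snd) p := by
    have hpe : p ∈ e.source := e.mem_source.2 (hUe hp)
    refine (e.contMDiffOn.contMDiffAt (e.open_source.mem_nhds hpe)).snd.congr_of_eventuallyEq ?_
    filter_upwards [e.open_source.mem_nhds hpe] with q hq
    exact e.continuousLinearMapAt_apply_of_mem ℝ (e.mem_source.1 hq) q.snd
  constructor
  case contMDiffOn_α =>
    intro p hp
    obtain ⟨hpU, hpφ⟩ := hsource p.proj hp
    have h1 : ContMDiffAt 𝓘(ℝ, EuclideanSpace ℝ (Fin n)) 𝓘(ℝ, F →L[ℝ] Fin l → ℍ[ℝ]) ∞ α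
      (c p.proj) := (h.contDiffOn_α.contDiffAt (φ.open_source.mem_nhds hpφ)).contMDiffAt
    exact ((h1.comp p (hcp hpU)).clm_apply (hep hpU)).contMDiffWithinAt
  case contMDiffOn_β =>
    intro p hp
    obtain ⟨hpU, hpφ⟩ := hsource p.proj hp
    have h1 : ContMDiffAt 𝓘(ℝ, EuclideanSpace ℝ (Fin n))
      𝓘(ℝ, F →L[ℝ] EuclideanSpace ℝ (Fin (4 * m))) ∞ β
      (c p.proj) := (h.contDiffOn_β.contDiffAt (φ.open_source.mem_nhds hpφ)).contMDiffAt
    have h2 : ContMDiffAt (𝓡 n) (𝓡 (4 * m)) ∞ (fun p ↦ (φ p).2) (c p.proj) :=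
      (h.contDiffOn_φ.contDiffAt (φ.open_source.mem_nhds hpφ)).snd.contMDiffAt
    have h3 := h2.comp p (hcp hpU)
    refine (contMDiffAt_totalSpace.2 ⟨h3, ?_⟩).contMDiffWithinAt
    simp only [trivializationAt_model_space_apply]
    exact (h1.comp p (hcp hpU)).clm_apply (hep hpU)
  case bijective =>
    intro y hy
    obtain ⟨hyU, hyφ⟩ := hsource y hy
    have h1 : Function.Bijective (e.continuousLinearMapAt ℝ y) :=
      ⟨Function.LeftInverse.injective (hes hyU), Function.RightInverse.surjective (hse hyU)⟩
    exact (h.bijective (c y) hyφ).comp h1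
  case α_incl =>
    intro y hy v i
    obtain ⟨hyU, hyφ⟩ := hsource y hy
    have h1 := HasMFDerivAt.comp y (hφd hyφ).fst.hasFDerivAt.hasMFDerivAt
      (hasMFDerivAt_chartAt (hUc hyU))
    refine (congrArg (fun f ↦ α (c y) f i) (hincl hyU v)).trans ((h.α_ι (c y) hyφ _ i).trans ?_)
    exact congrArg (fun L : TangentSpace (𝓡 n) y →L[ℝ] (Fin l → ImH) ↦ ((L v i : ImH) : ℍ[ℝ]))
      h1.mfderiv.symm
  case β_incl =>
    intro y hy v
    obtain ⟨hyU, hyφ⟩ := hsource y hy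
    refine Eq.trans ?_ (hsnd hyU hyφ v).symm
    exact (congrArg (β (c y)) (hincl hyU v)).trans (h.β_ι (c y) hyφ _)
  case mem_V_iff =>
    intro y hy f
    obtain ⟨hyU, hyφ⟩ := hsource y hy
    refine Iff.trans ?_ (h.mem_range_s (c y) hyφ (e.continuousLinearMapAt ℝ y f))
    change _ ↔ e.continuousLinearMapAt ℝ y f ∈ LinearMap.range (s (c y)).toLinearMap
    rw [hs y hyU hyφ]
    refine ⟨Submodule.mem_map_of_mem, ?_⟩
    rintro ⟨f', hf', hff'⟩
    rwa [← Function.LeftInverse.injective (hes hyU) hff']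
  case mem_Q_iff =>
    intro y hy B
    obtain ⟨hyU, hyφ⟩ := hsource y hy
    -- The element of `Q` with coordinates `imCoord u` acts as `u` on both factors. Conversely, the
    -- injectivity of `(α, β)` recovers an endomorphism from its two actions.
    have hα (u : ImH) (f i) : α (c y) (tripleL (fun i ↦ A i (c y)) (imCoord u) f) i =
        (u : ℍ[ℝ]) * α (c y) f i := by
      conv_rhs => rw [← sum_imCoord_smul u]
      simp [tripleL_apply, h.α_A (c y) hyφ, add_mul]
    have hβ (u : ImH) (f) : β (c y) (tripleL (fun i ↦ A i (c y)) (imCoord u) f) =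
        quaternionicAction (fun i ↦ J i (φ (c y)).2) u (β (c y) f) := by
      simp [tripleL_apply, h.β_A (c y) hyφ, quaternionicAction, imCoord]
    rw [hA y hyU hyφ]
    constructor
    · intro hB
      obtain ⟨a, ha⟩ := exists_tripleL_of_mem_span hB
      obtain ⟨u, rfl⟩ := imCoord_surjective a
      have hBf (f) : e.continuousLinearMapAt ℝ y (B f) =
          tripleL (fun i ↦ A i (c y)) (imCoord u) (e.continuousLinearMapAt ℝ y f) := by
        rw [← ha]
        change _ = e.continuousLinearMapAt ℝ y (B (e.symmL ℝ y (e.continuousLinearMapAt ℝ y f)))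
        rw [hes hyU]
      exact ⟨u, fun f ↦ ⟨fun i ↦ (congrArg (fun f ↦ α (c y) f i) (hBf f)).trans (hα u _ i),
        (congrArg (β (c y)) (hBf f)).trans (hβ u _)⟩⟩
    · rintro ⟨u, hu⟩
      have h1 : e.continuousLinearMapAt ℝ y ∘L B ∘L e.symmL ℝ y =
          tripleL (fun i ↦ A i (c y)) (imCoord u) := by
        ext f
        refine (h.bijective (c y) hyφ).1 (Prod.ext (funext fun i ↦ ?_) ?_)
        · refine Eq.trans ?_ (hα u f i).symm
          refine ((hu (e.symmL ℝ y f)).1 i).trans ?_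
          exact congrArg (fun f ↦ (u : ℍ[ℝ]) * α (c y) f i) (hse hyU f)
        · refine Eq.trans ?_ (hβ u f).symm
          refine ((hu (e.symmL ℝ y f)).2).trans ?_
          exact congrArg (fun f ↦ quaternionicAction (fun i ↦ J i (φ (c y)).2) u (β (c y) f))
            (hse hyU f)
      rw [h1]
      exact tripleL_mem_span _ _
  case α_cov =>
    intro y hy t ht v
    obtain ⟨hyU, hyφ⟩ := hsource y hy
    have h1 := (mdifferentiableAt_iff_differentiableAt_comp_chartAt_symm (hUc hyU)).1
      ((mdifferentiableAt_section_iff_continuousLinearMapAt (hUe hyU)).1 ht)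
    have h2 := (hαd hyφ).hasFDerivAt.clm_apply h1.hasFDerivAt
    have h3 := (HasMFDerivAt.comp y h2.hasMFDerivAt
      (hasMFDerivAt_chartAt (hUc hyU))).congr_of_eventuallyEq
        (f₁ := fun y ↦ α (c y) (e.continuousLinearMapAt ℝ y (t y))) (by
      filter_upwards [c.open_source.mem_nhds (hUc hyU)] with z hz
      have h4 := c.left_inv hz
      change _ = α (c z) ((fun w ↦ e.continuousLinearMapAt ℝ w (t w)) (c.symm (c z)))
      rw [h4])
    refine Eq.trans ?_ (congrArg (fun L : TangentSpace (𝓡 n) y →L[ℝ] (Fin l → ℍ[ℝ]) ↦ L v)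
      h3.mfderiv).symm
    refine (congrArg (α (c y)) (hΓcov y hyU t ht v)).trans ?_
    -- Since `dα = α Γ`, applying `α` to `ds + Γ s` gives the product rule for `d (α s)`.
    rw [map_add, ← h.fderiv_α (c y) hyφ]
    have h4 : ((fun z ↦ e.continuousLinearMapAt ℝ z (t z)) ∘ c.symm) (c y) =
        e.continuousLinearMapAt ℝ y (t y) := by
      change (fun z ↦ e.continuousLinearMapAt ℝ z (t z)) (c.symm (c y)) = _
      rw [hcs hyU]
    exact congrArg (fun f ↦ _ + fderiv ℝ α (c y) (T.continuousLinearMapAt ℝ y v) f) h4.symm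
  case β_cov =>
    intro y hy t Y ht hY htY v
    obtain ⟨hyU, hyφ⟩ := hsource y hy
    have h1 := (mdifferentiableAt_iff_differentiableAt_comp_chartAt_symm (hUc hyU)).1
      ((mdifferentiableAt_section_iff_continuousLinearMapAt (hUe hyU)).1 ht)
    have h2 := (hβd hyφ).hasFDerivAt.clm_apply h1.hasFDerivAt
    have h3 := (mdifferentiableAt_vectorField_iff.1 hY).hasFDerivAt.comp (c y)
      (hφd hyφ).snd.hasFDerivAt
    have h4 : (fun p ↦ β p ((fun z ↦ e.continuousLinearMapAt ℝ z (t z)) (c.symm p))) =ᶠ[𝓝 (c y)]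
        fun p ↦ Y (φ p).2 := by
      have h5 : Filter.Tendsto c.symm (𝓝 (c y)) (𝓝 y) := by
        have h6 := c.continuousAt_symm (c.map_source (hUc hyU))
        rwa [ContinuousAt, hcs hyU] at h6
      filter_upwards [h5.eventually htY, c.open_target.mem_nhds (c.map_source (hUc hyU))] with p hp hp'
      have h7 := c.right_inv hp'
      change β (c (c.symm p)) _ = Y (φ (c (c.symm p))).2 at hp
      rw [h7] at hp
      exact hp
    have h5 := DFunLike.congr_fun ((h2.congr_of_eventuallyEq h4.symm).unique h3)
      (T.continuousLinearMapAt ℝ y v)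
    have h6 : ((fun z ↦ e.continuousLinearMapAt ℝ z (t z)) ∘ c.symm) (c y) =
        e.continuousLinearMapAt ℝ y (t y) := by
      change (fun z ↦ e.continuousLinearMapAt ℝ z (t z)) (c.symm (c y)) = _
      rw [hcs hyU]
    have h7 := h.fderiv_β (c y) hyφ (T.continuousLinearMapAt ℝ y v)
      (e.continuousLinearMapAt ℝ y (t y))
    have h8 : β (c y) (e.continuousLinearMapAt ℝ y (t y)) = Y (φ (c y)).2 := htY.self_of_nhds
    -- The equation `β s = Y ∘ φ₂` is differentiated by the product rule. Substituting the
    -- derivative of `β` moves the term with `C` to the side of `Y`, which completes `dY` to the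
    -- connection `d + C`.
    have h9 := (congrArg (fun f ↦ _ + fderiv ℝ β (c y) (T.continuousLinearMapAt ℝ y v) f)
      h6.symm).trans h5
    simp only [h7, h8] at h9
    refine (congrArg (β (c y)) (hΓcov y hyU t ht v)).trans ?_
    refine Eq.trans ?_ (congrArg (christoffelConnection C Y (φ (c y)).2) (hsnd hyU hyφ v)).symm
    have h10 {a b g k : EuclideanSpace ℝ (Fin (4 * m))} (hg : a + (b - k) = g) : a + b = g + k := by
      rw [← hg]
      abel
    exact (map_add (β (c y)) _ _).trans (h10 h9)

end Product
-- The local product theorem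
theorem theorem3p6 {n : ℕ} {M : Type*} [TopologicalSpace M] [T2Space M]
    [ChartedSpace (EuclideanSpace ℝ (Fin n)) M] [IsManifold (𝓡 n) ∞ M]
    {F : Type*} [NormedAddCommGroup F] [NormedSpace ℝ F] [FiniteDimensional ℝ F]
    {E : M → Type*} [TopologicalSpace (TotalSpace F E)]
    [∀ x, AddCommGroup (E x)] [∀ x, Module ℝ (E x)] [∀ x, TopologicalSpace (E x)]
    [∀ x, IsTopologicalAddGroup (E x)] [∀ x, ContinuousSMul ℝ (E x)]
    [FiberBundle F E] [VectorBundle ℝ F E] [ContMDiffVectorBundle ∞ F E (𝓡 n)]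
    {l : ℕ} (S : AlmostFQuaternionicStructure (n := n) F E l)
    (cov : CovariantDerivative (𝓡 n) F E)
    (D : CovariantDerivative (𝓡 n) (EuclideanSpace ℝ (Fin n)) (TangentSpace (𝓡 n) : M → Type _))
    (hD : D.torsion = 0)
    (hcov : S.IsInducedBy cov D)
    (hrank : Module.finrank ℝ F > 4 * l) (hl : 4 * l ≥ 8) (x₀ : M) :
    ∃ (m : ℕ) (N : Type) (_ : TopologicalSpace N)
      (_ : ChartedSpace (EuclideanSpace ℝ (Fin (4 * m))) N) (_ : IsManifold (𝓡 (4 * m)) ∞ N)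
      (_ : T2Space N) (_ : SecondCountableTopology N)
      (h : HypercomplexStructure m N)
      (DN : CovariantDerivative (𝓡 (4 * m)) (EuclideanSpace ℝ (Fin (4 * m)))
        (TangentSpace (𝓡 (4 * m)) : N → Type _))
      (φ : PartialDiffeomorph (𝓡 n) (𝓘(ℝ, Fin l → ImH).prod (𝓡 (4 * m))) M
        ((Fin l → ImH) × N) ∞)
      (α : ∀ x : M, E x →L[ℝ] (Fin l → ℍ[ℝ]))
      (β : ∀ x : M, E x →L[ℝ] TangentSpace (𝓡 (4 * m)) (φ x).2),
      x₀ ∈ φ.source ∧ h.IsObata DN ∧ S.IsProductVia cov h DN φ α β := by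
  obtain ⟨U₀, Γ, hU₀, hx₀, hU₀c, hU₀e, hΓ, hΓcov⟩ :=
    CovariantDerivative.exists_connectionForm cov hcov.isCompatible.smooth x₀
  obtain ⟨U₁, hU₁, hx₁, A, hA, hAQ⟩ := S.exists_frame x₀
  obtain ⟨U₂, hU₂, hx₂, s, hs, hsV⟩ := S.exists_frame_V x₀
  set c := chartAt (EuclideanSpace ℝ (Fin n)) x₀ with hc
  set e := trivializationAt F E x₀ with he
  -- One neighbourhood on which the connection form and both frames are available.
  let U := U₀ ∩ (U₁ ∩ U₂)
  have hUc : U ⊆ c.source := fun y hy ↦ hU₀c hy.1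
  have hUe : U ⊆ e.baseSet := fun y hy ↦ hU₀e hy.1
  have hadapted : IsAdaptedConnection (c.target ∩ c.symm ⁻¹' U) Γ (embCoord x₀ S.incl ∘ c.symm)
      (frameCoord (F := F) x₀ s ∘ c.symm) (fun i ↦ endoCoord (F := F) x₀ (A i) ∘ c.symm) :=
    S.isAdaptedConnection cov D hD hcov (hU₀.inter (hU₁.inter hU₂)) hUc hUe
    (fun y hy ↦ hΓ y hy.1) (fun y hy ↦ hΓcov y hy.1)
    (fun i ↦ (hA i).mono fun y hy ↦ hy.2.1) (fun y hy ↦ hAQ y hy.2.1)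
    (fun i ↦ (hs i).mono fun y hy ↦ hy.2.2) (fun y hy ↦ hsV y hy.2.2)
  have hcx₀ : c x₀ ∈ c.target ∩ c.symm ⁻¹' U := by
    refine ⟨mem_chart_target _ x₀, ?_⟩
    rw [mem_preimage, c.left_inv (mem_chart_source _ x₀)]
    exact ⟨hx₀, hx₁, hx₂⟩
  obtain ⟨O, s', A', hxO, hOU, hparallel, hs', hA'⟩ :=
    hadapted.exists_isParallelFrame hcx₀ hrank (by omega)
  obtain ⟨m, φ, J, C, α, β, hxφ, hφO, hφ⟩ := hparallel.exists_isProductChart hxO hrank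
  have hcs {y} (hy : y ∈ U) : c.symm (c y) = y := c.left_inv (hUc hy)
  -- The hypercomplex factor is a full Euclidean space: its structure is defined everywhere because
  -- the chart is onto in the `z` direction.
  refine ⟨m, EuclideanSpace ℝ (Fin (4 * m)), inferInstance, inferInstance, inferInstance,
    inferInstance, inferInstance, _, _, _, _, _, ?_,
    HypercomplexStructure.isObata_ofParallel hφ.contDiff_J hφ.triple hφ.contDiff_C hφ.C_symm
      hφ.fderiv_J,
    hφ.isProductVia hUc hUe (fun y hy ↦ hΓcov y hy.1) (hφO.trans hOU) ?_ ?_⟩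
  · change x₀ ∈ (c.trans φ).source
    rw [c.trans_source]
    exact ⟨mem_chart_source _ x₀, hxφ⟩
  · intro y hy hyφ
    rw [hs' _ (hφO hyφ), Function.comp_apply, hcs hy]
    exact range_frameCoord x₀ (hsV y hy.2.2).2
  · intro y hy hyφ B
    change B ∈ S.Q y ↔ e.continuousLinearMapAt ℝ y ∘L B ∘L e.symmL ℝ y ∈
      Submodule.span ℝ (range fun i ↦ A' i (c y))
    rw [hA' (c y) (hφO hyφ), ← (hAQ y hy.2.1).2]
    simp only [Function.comp_apply, hcs hy, Submodule.mem_span_range_iff_exists_fun]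
    have hes (v) : e.symmL ℝ y (e.continuousLinearMapAt ℝ y v) = v :=
      e.symmL_continuousLinearMapAt (hUe hy) v
    refine exists_congr fun a ↦ ⟨?_, fun h ↦ ?_⟩
    · rintro rfl
      ext f
      simp [endoCoord, -Trivialization.continuousLinearMapAt_apply, he]
    · ext v
      have h1 := DFunLike.congr_fun h (e.continuousLinearMapAt ℝ y v)
      refine Function.LeftInverse.injective hes ?_
      simpa [endoCoord, -Trivialization.continuousLinearMapAt_apply, -Trivialization.symmL_apply,
        hes, ← he] using h1

end
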